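/- Let $s>-1$ and let $Q_s$ be the Markov transition kernel on $\mathbb N=\{0,1,2,\dots\}$ with $Q_s(0,1)=1$ and, for $r\ge 1$, $Q_s(r,r+1)=\max\left(\tfrac12-\tfrac{s}{4r},\tfrac14\right)$, $Q_s(r,r-1)=1-Q_s(r,r+1)$ (the discrete Bessel walk). (i) Let $\mathcal D=e^{i\pi/4}2^{-1/2}\mathbb Z^2=\{(\tfrac i2,\tfrac r2): i,r\in\mathbb Z,\ i+r \text{ even}\}$ and let $Z^{(s)}$ be the Markov chain on the upper half of $\mathcal D$ which at each time makes a horizontal move by $+\tfrac12$ or $-\tfrac12$ with probability $\tfrac12$ each and, simultaneously and independently, moves its height from $\tfrac r2$ to $\tfrac{r'}2$ with probability $Q_s(r,r')$. Let $\tau_{\mathbb Z}\ge 1$ be its first return time to the horizontal line $\mathbb Z\times\{0\}$. There is a constant $b=b(s)>0$ such that, as $k\to\infty$ ($k\in\mathbb N$), $$\mathbb P_{(0,0)}\left[Z^{(s)}_{\tau_{\mathbb Z}}=(k,0)\right]\sim\frac{b(s)}{k^{2+s}}.$$ (ii) The same asymptotics, with some constant $c=c(s)>0$ in place of $b(s)$,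 hold for the Markov chain on $\mathbb Z\times\mathbb N$ which at each time, with probability $\tfrac12$, moves vertically according to $Q_s$ and, with probability $\tfrac12$, moves horizontally by $+1$ or $-1$ with equal probability; here $\tau_{\mathbb Z}\ge1$ is the first return time to $\mathbb Z\times\{0\}$. (iii) Let $d\ge1$ and $0<v<1$, and let $Z^{(s)}$ be the Markov chain on $\mathbb Z^d\times\mathbb N$ which at each time, with probability $v$, moves its last coordinate according to $Q_s$ and, with probability $1-v$, moves its first $d$ coordinates by a step of the simple random walk on $\mathbb Z^d$. Let $\tau\ge1$ be its first return time to $\mathbb Z^d\times\{0\}$. There is a constant $C=C(s,d,v)>0$ such that, for $a,b\in\mathbb Z^d\times\{0\}$, as $\|a-b\|_2\to\infty$, $$\mathbb P_a\left[Z^{(s)}_{\tau}=b\right]\sim\frac{C}{\|a-b\|_2^{\,d+1+s}}.$$ -/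

import Mathlib

open MeasureTheory ProbabilityTheory Filter Asymptotics
open scoped ENNReal NNReal

namespace BesselWalk

noncomputable section

/-! ### Markov chains on a countable state space and their first returns to a set -/

section Chain

variable {S : Type*} [MeasurableSpace S]

/-- The law, on the path space `ℕ → S`, of the time-homogeneous Markov chain with transition
kernel `κ` started at `x` (constructed by the Ionescu-Tulcea theorem). -/
def chainLaw (κ : Kernel S S) [IsMarkovKernel κ] (x : S) : Measure (ℕ → S) :=
  Kernel.trajMeasure (X := fun _ => S) (Measure.dirac x)
    (fun n => κ.comap (fun h : (i : Finset.Iic n) → S => h ⟨n, Finset.mem_Iic.2 le_rfl⟩)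
      (measurable_pi_apply _))

/-- `n` is the first return time `τ_A = inf {n ≥ 1 : ω n ∈ A}` of the path `ω` to the set `A`. -/
def IsFirstReturn (A : Set S) (ω : ℕ → S) (n : ℕ) : Prop :=
  IsLeast {m : ℕ | 1 ≤ m ∧ ω m ∈ A} n

/-- The probability, for the chain with kernel `κ` started at `x`, that the first return time
`τ_A` to `A` is finite and that the chain at time `τ_A` is in `B`. -/
def returnProb (κ : Kernel S S) [IsMarkovKernel κ] (x : S) (A B : Set S) : ℝ :=
  (chainLaw κ x).real {ω | ∃ n, IsFirstReturn A ω n ∧ ω n ∈ B}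

end Chain

/-! ### The discrete Bessel walk on `ℕ` -/

/-- The probability `Q_s(r, r + 1)` of an upward step from height `r`: it is `1` at `r = 0`, and
`max (1/2 - (s/4)(1/r)) (1/4)` for `r ≥ 1`. -/
def upProb (s : ℝ) (r : ℕ) : ℝ :=
  if r = 0 then 1 else max (1 / 2 - s / 4 * (1 / (r : ℝ))) (1 / 4)

theorem upProb_mem {s : ℝ} (hs : -1 < s) (r : ℕ) : upProb s r ∈ unitInterval := by
  unfold upProb
  split_ifs with h
  · simp
  · have hr : (1 : ℝ) ≤ r := by exact_mod_cast Nat.one_le_iff_ne_zero.2 h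
    have h1 : 1 / (r : ℝ) ≤ 1 := by rw [div_le_one (by linarith)]; exact hr
    have h0 : 0 < 1 / (r : ℝ) := by positivity
    refine ⟨le_trans (by norm_num) (le_max_right _ _), max_le ?_ (by norm_num)⟩
    nlinarith

/-- One step of the discrete Bessel walk `Q_s` from `r`: to `r + 1` with probability `upProb s r`
and to `r - 1` otherwise (the latter has probability `0` when `r = 0`). -/
def besselStep (s : ℝ) (hs : -1 < s) (r : ℕ) : Measure ℕ :=
  bernoulliMeasure (r + 1) (r - 1) ⟨upProb s r, upProb_mem hs r⟩

instance (s : ℝ) (hs : -1 < s) (r : ℕ) : IsProbabilityMeasure (besselStep s hs r) := by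
  unfold besselStep; infer_instance

/-! ### The walk on the diamond graph -/

/-- The number `1/2` as an element of the unit interval. -/
def half : unitInterval := ⟨1 / 2, by norm_num, by norm_num⟩

/-- One step of the simple random walk on `ℤ`. -/
def simpleStep (x : ℤ) : Measure ℤ := bernoulliMeasure (x + 1) (x - 1) half

instance (x : ℤ) : IsProbabilityMeasure (simpleStep x) := by
  unfold simpleStep; infer_instance

/-- The position in the plane of the state `(i, r)` of the walk on the diamond graph
`e^{iπ/4} 2^{-1/2} ℤ² = {(i/2, r/2) : i, r ∈ ℤ, i + r even}`:
the state records both coordinates in units of `1/2`. -/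
def planePoint (z : ℤ × ℕ) : ℂ := ⟨(z.1 : ℝ) / 2, (z.2 : ℝ) / 2⟩

/-- The transition kernel of the Bessel walk on the diamond graph: at each time the walk
makes a symmetric horizontal move by `± 1/2` and, simultaneously and independently, a vertical
move by `± 1/2` according to `Q_s`. (From the origin only states `(i, r)` with `i + r` even are
reached.) -/
def diamondKernel (s : ℝ) (hs : -1 < s) : Kernel (ℤ × ℕ) (ℤ × ℕ) where
  toFun z := (simpleStep z.1).prod (besselStep s hs z.2)
  measurable' := measurable_of_countable _

instance (s : ℝ) (hs : -1 < s) : IsMarkovKernel (diamondKernel s hs) :=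
  ⟨fun z => by
    change IsProbabilityMeasure ((simpleStep z.1).prod (besselStep s hs z.2)); infer_instance⟩

/-! ### The walk on `ℤ^d × ℕ` -/

/-- One step of the simple random walk on `ℤ^d`: uniform on the `2d` nearest neighbours. -/
def simpleStepDim (d : ℕ) (x : Fin d → ℤ) : Measure (Fin d → ℤ) :=
  ((2 * d : ℕ) : ℝ≥0∞)⁻¹ •
    ∑ i : Fin d, (Measure.dirac (x + Pi.single i 1) + Measure.dirac (x - Pi.single i 1))

instance (d : ℕ) [NeZero d] (x : Fin d → ℤ) : IsProbabilityMeasure (simpleStepDim d x) := by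
  refine ⟨?_⟩
  have h : ((2 * d : ℕ) : ℝ≥0∞) ≠ 0 := by
    have := NeZero.ne d
    exact_mod_cast (by omega : 2 * d ≠ 0)
  have h2 : (∑ _i : Fin d, (1 + 1 : ℝ≥0∞)) = ((2 * d : ℕ) : ℝ≥0∞) := by
    simp only [Finset.sum_const, Finset.card_univ, Fintype.card_fin, nsmul_eq_mul]
    push_cast
    ring
  simp only [simpleStepDim, Measure.smul_apply, Measure.finsetSum_apply, Measure.add_apply,
    measure_univ, smul_eq_mul]
  rw [h2]
  exact ENNReal.inv_mul_cancel h (ENNReal.natCast_ne_top _)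

/-- The transition kernel of the Bessel walk on `ℤ^d × ℕ`: at each time, with probability `v`
the last coordinate moves according to `Q_s` (and the others stay put), and with probability
`1 - v` the first `d` coordinates make a step of the simple random walk on `ℤ^d` (and the last
one stays put). -/
def gridKernel (d : ℕ) (v : unitInterval) (s : ℝ) (hs : -1 < s) :
    Kernel ((Fin d → ℤ) × ℕ) ((Fin d → ℤ) × ℕ) where
  toFun z := ENNReal.ofReal v • (Measure.dirac z.1).prod (besselStep s hs z.2) +
    ENNReal.ofReal (1 - v) • (simpleStepDim d z.1).prod (Measure.dirac z.2)
  measurable' := measurable_of_countable _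

instance (d : ℕ) [NeZero d] (v : unitInterval) (s : ℝ) (hs : -1 < s) :
    IsMarkovKernel (gridKernel d v s hs) := by
  refine ⟨fun z => ⟨?_⟩⟩
  change (ENNReal.ofReal v • (Measure.dirac z.1).prod (besselStep s hs z.2) +
    ENNReal.ofReal (1 - v) • (simpleStepDim d z.1).prod (Measure.dirac z.2)) Set.univ = 1
  simp only [Measure.add_apply, Measure.smul_apply, measure_univ, smul_eq_mul, mul_one]
  rw [← ENNReal.ofReal_add v.2.1 (by linarith [v.2.2])]
  simp

/-- The Euclidean distance of two points of `ℤ^d`. -/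
def euclDist {d : ℕ} (a b : Fin d → ℤ) : ℝ := √(∑ i, ((a i - b i : ℤ) : ℝ) ^ 2)

end

end BesselWalk

open BesselWalk

/-! The height alone decides when the walk is back on the line, and given the number of steps made
sideways the horizontal displacement is an ordinary random walk. Hence a return probability at
displacement `x` is a series `∑ j, t j * P j x`. Up to a constant factor, `t j` is the probability
that the Bessel walk from `0` first returns to `0` at time `2 * (j + 1)`, and `P j` is the law of
the horizontal walk at that return (`returnProb_diamondKernel`, `returnProb_gridKernel`). If `t j`
is asymptotic to `L * j ^ (-(s + 3) / 2)` and `P j` satisfies a local limit theorem with good tails,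
then the substitution `j ≈ u * |x| ^ 2` turns `|x| ^ (d + 1 + s)` times the series into an integral
over `u` that converges to a positive constant (`tendsto_tsum_of_local_limit`).

The main work is the asymptotics of `t j` (`exists_tendsto_returnTime`). The walk killed at `0` has
a positive harmonic function `h` growing like `x ^ (s + 1)`, and its `h`-transform has drift
asymptotic to `(1 + s / 2) / x`, that of a Bessel process of dimension `s + 3`. One step applied to
`h x * exp (-g x²)` reproduces this function with `g` replaced by `g / (1 + 2 g)` and a factor `(1 +
2 g) ^ (-(s + 3) / 2)`, up to small errors. Iteration gives the limit Laplace transforms in the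
diffusive scale (`tendsto_killedExp_gaussian`), and Weierstrass approximation gives limits for
continuous test functions.

The survival probability is the expectation of `1 / h` under the `h`-transform, thus about `n ^ (-(s
+ 1) / 2)` times the expectation of a negative power of the rescaled height. This power is singular
at `0`. The contribution of low heights is controlled through the supermartingale `h ^ γ`, but only
after summation over a block of times `[n, 2 n)` (`exists_sum_killedExp_near_zero_le`). Monotonicity
removes the summation: a monotone density theorem (`exists_tendsto_of_antitone_of_sums`) is applied
first to the survival probability, then to its increments at even times, which are monotone because
the killed walk is reversible (`antitone_killedExp_single`).

On the horizontal side, Fourier inversion with an arbitrary real tilt gives both the local limit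
theorem, uniform in the endpoint, and exponential tails on the diffusive scale. The step laws used
are aperiodic: the diamond walk observed every two steps is a lazy walk, and on `ℤ^d × ℕ` one uses
the displacement between consecutive vertical moves, a geometric mixture of simple random walk
steps. -/

namespace BesselWalk

/-! ### First-return probabilities as series of iterates of the killed kernel. -/

section FirstReturn

theorem indicator_one_congr {α β : Type*} {s : Set α} {t : Set β} {x : α} {y : β}
    (h : x ∈ s ↔ y ∈ t) : s.indicator (1 : α → ℝ≥0∞) x = t.indicator 1 y := by
  classical
  rw [Set.indicator_apply, Set.indicator_apply]
  exact if_congr h rfl rfl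

variable {S : Type*} [MeasurableSpace S]

/-- The Markov property in integrated form: in the Ionescu-Tulcea construction the law of the
history up to time `n`, composed with the kernel, is the law of the history together with the next
state. -/
theorem lintegral_chainLaw_succ (κ : Kernel S S) [IsMarkovKernel κ] (x : S) (n : ℕ)
    {g : ((i : Finset.Iic n) → S) → ℝ≥0∞} (hg : Measurable g) {h : S → ℝ≥0∞} (hh : Measurable h) :
    ∫⁻ ω, g (Preorder.frestrictLe n ω) * h (ω (n + 1)) ∂(chainLaw κ x) =
      ∫⁻ ω, g (Preorder.frestrictLe n ω) * ∫⁻ y, h y ∂(κ (ω n)) ∂(chainLaw κ x) := by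
  have key := Kernel.map_frestrictLe_trajMeasure_compProd_eq_map_trajMeasure (X := fun _ => S)
    (μ₀ := Measure.dirac x)
    (κ := fun n => κ.comap (fun h : (i : Finset.Iic n) → S => h ⟨n, Finset.mem_Iic.2 le_rfl⟩)
      (measurable_pi_apply _)) (a := n)
  have hG : Measurable fun p : ((i : Finset.Iic n) → S) × S => g p.1 * h p.2 := by fun_prop
  have h1 := congrArg (fun μ => ∫⁻ p, g p.1 * h p.2 ∂μ) key
  rw [Measure.lintegral_compProd hG, lintegral_map hG.lintegral_kernel_prod_right' (by fun_prop),
    lintegral_map hG (by fun_prop)] at h1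
  unfold chainLaw
  refine h1.symm.trans ?_
  refine lintegral_congr fun ω => ?_
  exact lintegral_const_mul (g (Preorder.frestrictLe n ω)) hh (μ := κ (ω n))

/-- Iterating this operator on functions gives expectations along the chain before its return
to `A`. -/
noncomputable def killedOp (κ : Kernel S S) (A : Set S) (h : S → ℝ≥0∞) (x : S) : ℝ≥0∞ :=
  ∫⁻ y, Aᶜ.indicator h y ∂(κ x)

theorem measurable_killedOp (κ : Kernel S S) {A : Set S} (hA : MeasurableSet A) {h : S → ℝ≥0∞}
    (hh : Measurable h) : Measurable (killedOp κ A h) :=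
  (hh.indicator hA.compl).lintegral_kernel

theorem lintegral_chainLaw_zero (κ : Kernel S S) [IsMarkovKernel κ] (x : S)
    {h : S → ℝ≥0∞} (hh : Measurable h) : ∫⁻ ω, h (ω 0) ∂(chainLaw κ x) = h x := by
  have e : (chainLaw κ x).map (fun ω => ω 0) = Measure.dirac x := by
    unfold chainLaw Kernel.trajMeasure
    have h0 : (fun ω : ℕ → S => ω 0) =
        (fun y : (i : Finset.Iic 0) → S => y ⟨0, by simp⟩) ∘
          Preorder.frestrictLe (π := fun _ => S) 0 := rfl
    rw [h0, ← Measure.map_map (by fun_prop) (by fun_prop), Measure.map_comp _ _ (by fun_prop),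
      Kernel.traj_map_frestrictLe, Kernel.partialTraj_self, Measure.id_comp,
      Measure.map_map (by fun_prop) (by fun_prop), Measure.map_dirac' (by fun_prop)]
    rfl
  rw [← lintegral_dirac' x hh, ← e, lintegral_map hh (by fun_prop)]

/-- Avoiding `A` at the times `1, …, n` depends only on the history up to time `n`, so its indicator
can play the role of `g` in the Markov property. -/
theorem lintegral_chainLaw_killed_succ (κ : Kernel S S) [IsMarkovKernel κ] {A : Set S}
    (hA : MeasurableSet A) (x : S) (n : ℕ) {h : S → ℝ≥0∞} (hh : Measurable h) :
    ∫⁻ ω, {ω : ℕ → S | ∀ i ∈ Finset.Icc 1 n, ω i ∉ A}.indicator 1 ω * h (ω (n + 1))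
        ∂(chainLaw κ x) =
      ∫⁻ ω, {ω : ℕ → S | ∀ i ∈ Finset.Icc 1 n, ω i ∉ A}.indicator 1 ω * ∫⁻ y, h y ∂(κ (ω n))
        ∂(chainLaw κ x) := by
  set T : Set ((i : Finset.Iic n) → S) :=
    {y | ∀ i, ∀ hi : i ∈ Finset.Icc 1 n, y ⟨i, by simp at hi ⊢; omega⟩ ∉ A} with hT
  have hTm : MeasurableSet T := by
    have : T = ⋂ i, ⋂ hi : i ∈ Finset.Icc 1 n,
        (fun y : (i : Finset.Iic n) → S => y ⟨i, by simp at hi ⊢; omega⟩) ⁻¹' Aᶜ := by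
      ext y; simp [hT]
    rw [this]
    exact MeasurableSet.iInter fun i => MeasurableSet.iInter fun hi =>
      (measurable_pi_apply _) hA.compl
  have h1 := lintegral_chainLaw_succ κ x n (g := T.indicator 1) (measurable_one.indicator hTm) hh
  have e2 : ∀ ω : ℕ → S,
      T.indicator (1 : ((i : Finset.Iic n) → S) → ℝ≥0∞) (Preorder.frestrictLe n ω) =
      {ω : ℕ → S | ∀ i ∈ Finset.Icc 1 n, ω i ∉ A}.indicator 1 ω := by
    intro ω
    exact indicator_one_congr Iff.rfl
  simpa only [e2] using h1

/-- The last step is absorbed into the test function, which becomes `killedOp κ A h`; this is why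
the induction runs over all `h`. Time `0` is never tested, so the starting point may lie in `A`. -/
theorem lintegral_chainLaw_killed (κ : Kernel S S) [IsMarkovKernel κ] {A : Set S}
    (hA : MeasurableSet A) (x : S) (n : ℕ) : ∀ {h : S → ℝ≥0∞}, Measurable h →
    ∫⁻ ω, {ω : ℕ → S | ∀ i ∈ Finset.Icc 1 n, ω i ∉ A}.indicator 1 ω * h (ω n) ∂(chainLaw κ x) =
      (killedOp κ A)^[n] h x := by
  induction n with
  | zero =>
    intro h hh
    simpa using lintegral_chainLaw_zero κ x hh
  | succ n ih =>
    intro h hh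
    have h1 := lintegral_chainLaw_killed_succ κ hA x n (hh.indicator hA.compl)
    have h2 := ih (measurable_killedOp κ hA hh)
    rw [Function.iterate_succ_apply, ← h2]
    refine Eq.trans (lintegral_congr fun ω => ?_) h1
    by_cases hω : ω (n + 1) ∈ A
    · have : ¬ ∀ i ∈ Finset.Icc 1 (n + 1), ω i ∉ A := by
        intro hc; exact hc (n + 1) (by simp) hω
      rw [Set.indicator_of_notMem (by simpa using this),
        Set.indicator_of_notMem (s := Aᶜ) (by simpa using hω)]
      simp
    · rw [Set.indicator_of_mem (s := Aᶜ) (by simpa using hω)]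
      congr 1
      have : (∀ i ∈ Finset.Icc 1 (n + 1), ω i ∉ A) ↔ ∀ i ∈ Finset.Icc 1 n, ω i ∉ A := by
        constructor
        · intro hc i hi
          exact hc i (by simp at hi ⊢; omega)
        · intro hc i hi
          by_cases hin : i = n + 1
          · rwa [hin]
          · exact hc i (by simp at hi ⊢; omega)
      exact indicator_one_congr this

theorem returnProb_eq_tsum (κ : Kernel S S) [IsMarkovKernel κ] {A B : Set S}
    (hA : MeasurableSet A) (hB : MeasurableSet B) (x : S) :
    returnProb κ x A B =
      (∑' n, (killedOp κ A)^[n] (fun y => κ y (A ∩ B)) x).toReal := by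
  unfold returnProb
  rw [measureReal_def]
  congr 1
  -- `E n` is the event that the first return occurs exactly at time `n + 1` and lands in `B`. These
  -- events are disjoint and measurable.
  set E : ℕ → Set (ℕ → S) := fun n =>
    {ω | ∀ i ∈ Finset.Icc 1 n, ω i ∉ A} ∩ {ω | ω (n + 1) ∈ A ∩ B} with hE
  have hfirst : ∀ n, MeasurableSet {ω : ℕ → S | ∀ i ∈ Finset.Icc 1 n, ω i ∉ A} := by
    intro n
    have : {ω : ℕ → S | ∀ i ∈ Finset.Icc 1 n, ω i ∉ A} =
        ⋂ i ∈ Finset.Icc 1 n, (fun ω : ℕ → S => ω i) ⁻¹' Aᶜ := by ext; simp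
    rw [this]
    exact Finset.measurableSet_biInter _ fun i _ => (measurable_pi_apply i) hA.compl
  have hmem : ∀ n, {ω : ℕ → S | ω (n + 1) ∈ A ∩ B} = (fun ω : ℕ → S => ω (n + 1)) ⁻¹' (A ∩ B) :=
    fun n => rfl
  have hEm : ∀ n, MeasurableSet (E n) := fun n =>
    (hfirst n).inter (by rw [hmem]; exact (measurable_pi_apply _) (hA.inter hB))
  have hdisj : Pairwise (Function.onFun Disjoint E) := by
    intro m n hmn
    wlog hlt : m < n generalizing m n
    · exact (this hmn.symm (by omega)).symm
    refine Set.disjoint_left.2 fun ω hm hn => ?_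
    exact hn.1 (m + 1) (by simp; omega) hm.2.1
  have hset : {ω : ℕ → S | ∃ n, IsFirstReturn A ω n ∧ ω n ∈ B} = ⋃ n, E n := by
    ext ω
    simp only [Set.mem_ofPred_eq, Set.mem_iUnion, hE, Set.mem_inter_iff, IsFirstReturn]
    constructor
    · rintro ⟨n, ⟨⟨h1, hnA⟩, hle⟩, hnB⟩
      obtain ⟨m, rfl⟩ : ∃ m, n = m + 1 := ⟨n - 1, by omega⟩
      refine ⟨m, fun i hi hiA => ?_, hnA, hnB⟩
      have := hle ⟨(Finset.mem_Icc.1 hi).1, hiA⟩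
      have := (Finset.mem_Icc.1 hi).2
      omega
    · rintro ⟨m, hm, hA', hB'⟩
      refine ⟨m + 1, ⟨⟨by omega, hA'⟩, ?_⟩, hB'⟩
      rintro i ⟨hi1, hiA⟩
      by_contra hc
      exact hm i (by simp; omega) hiA
  rw [hset, measure_iUnion hdisj hEm]
  refine tsum_congr fun n => ?_
  rw [← lintegral_chainLaw_killed κ hA x n (κ.measurable_coe (hA.inter hB))]
  have h1 := lintegral_chainLaw_killed_succ κ hA x n (h := (A ∩ B).indicator 1)
    (measurable_one.indicator (hA.inter hB))
  simp only [lintegral_indicator_one (hA.inter hB)] at h1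
  rw [← h1, ← lintegral_indicator_one (hEm n)]
  refine lintegral_congr fun ω => ?_
  by_cases h1 : ω ∈ {ω : ℕ → S | ∀ i ∈ Finset.Icc 1 n, ω i ∉ A} <;>
    by_cases h2 : ω (n + 1) ∈ A ∩ B
  · rw [Set.indicator_of_mem (show ω ∈ E n from ⟨h1, h2⟩), Set.indicator_of_mem h1,
      Set.indicator_of_mem h2]
    simp
  · rw [Set.indicator_of_notMem (fun h : ω ∈ E n => h2 h.2), Set.indicator_of_notMem h2, mul_zero]
  · rw [Set.indicator_of_notMem (fun h : ω ∈ E n => h1 h.1), Set.indicator_of_notMem h1, zero_mul]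
  · rw [Set.indicator_of_notMem (fun h : ω ∈ E n => h1 h.1), Set.indicator_of_notMem h1, zero_mul]

end FirstReturn

/-! ### The harmonic function of the killed walk and the drift of its Doob transform. -/

section Harmonic

open Topology

theorem upProb_zero (s : ℝ) : upProb s 0 = 1 := by simp [upProb]

theorem quarter_le_upProb (s : ℝ) (r : ℕ) : 1 / 4 ≤ upProb s r := by
  unfold upProb
  split_ifs
  · norm_num
  · exact le_max_right _ _

/-- Since `s > -1` and `1 / r ≤ 1`, the correction `-(s / 4) / r` is at most `1 / 4`. Together with
`quarter_le_upProb` this makes the walk uniformly elliptic away from `0`. -/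
theorem upProb_le {s : ℝ} (hs : -1 < s) {r : ℕ} (hr : r ≠ 0) : upProb s r ≤ 3 / 4 := by
  unfold upProb
  rw [if_neg hr]
  have hr1 : (1 : ℝ) ≤ r := by exact_mod_cast Nat.one_le_iff_ne_zero.2 hr
  have h1 : 1 / (r : ℝ) ≤ 1 := by rw [div_le_one (by linarith)]; exact hr1
  have h0 : 0 < 1 / (r : ℝ) := by positivity
  exact max_le (by nlinarith) (by norm_num)

theorem upProb_eq {s : ℝ} {r : ℕ} (hr : r ≠ 0) (hsr : s ≤ r) :
    upProb s r = 1 / 2 - s / (4 * r) := by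
  unfold upProb
  rw [if_neg hr]
  have hr1 : (0 : ℝ) < r := by exact_mod_cast Nat.pos_of_ne_zero hr
  have : s / 4 * (1 / (r : ℝ)) = s / (4 * r) := by field_simp
  rw [this, max_eq_left]
  have : s / (4 * r) ≤ 1 / 4 := by
    rw [div_le_div_iff₀ (by positivity) (by norm_num)]; linarith
  linarith

/-- One step of the Bessel walk killed at its return to `0`, acting on functions. -/
noncomputable def killedStep (s : ℝ) : Module.End ℝ (ℕ → ℝ) where
  toFun φ := fun x => if x = 0 then 0 else
    upProb s x * φ (x + 1) + (1 - upProb s x) * φ (x - 1)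
  map_add' φ ψ := by
    ext x; simp only [Pi.add_apply]; split_ifs <;> ring
  map_smul' c φ := by
    ext x; simp only [Pi.smul_apply, smul_eq_mul, RingHom.id_apply]; split_ifs <;> ring

theorem killedStep_zero (s : ℝ) (φ : ℕ → ℝ) : killedStep s φ 0 = 0 := by
  simp [killedStep]

theorem killedStep_succ (s : ℝ) (φ : ℕ → ℝ) (x : ℕ) : killedStep s φ (x + 1) =
    upProb s (x + 1) * φ (x + 2) + (1 - upProb s (x + 1)) * φ x := by
  simp [killedStep]

/-- Increments of the harmonic function of the killed Bessel walk. -/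
noncomputable def harmonicIncr (s : ℝ) : ℕ → ℝ
  | 0 => 1
  | j + 1 => harmonicIncr s j * ((1 - upProb s (j + 1)) / upProb s (j + 1))

/-- The positive harmonic function of the killed Bessel walk. -/
noncomputable def harmonic (s : ℝ) (x : ℕ) : ℝ := ∑ j ∈ Finset.range x, harmonicIncr s j

theorem harmonicIncr_pos {s : ℝ} (hs : -1 < s) (j : ℕ) : 0 < harmonicIncr s j := by
  induction j with
  | zero => simp [harmonicIncr]
  | succ j ih =>
    have h1 := quarter_le_upProb s (j + 1)
    have h2 := upProb_le hs (Nat.succ_ne_zero j)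
    exact mul_pos ih (div_pos (by linarith) (by linarith))

theorem harmonic_zero (s : ℝ) : harmonic s 0 = 0 := by simp [harmonic]

theorem harmonic_one (s : ℝ) : harmonic s 1 = 1 := by simp [harmonic, harmonicIncr]

theorem harmonic_succ (s : ℝ) (x : ℕ) : harmonic s (x + 1) = harmonic s x + harmonicIncr s x :=
  Finset.sum_range_succ _ _

theorem harmonic_nonneg {s : ℝ} (hs : -1 < s) (x : ℕ) : 0 ≤ harmonic s x :=
  Finset.sum_nonneg fun j _ => (harmonicIncr_pos hs j).le

theorem harmonic_pos {s : ℝ} (hs : -1 < s) {x : ℕ} (hx : x ≠ 0) : 0 < harmonic s x :=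
  Finset.sum_pos (fun j _ => harmonicIncr_pos hs j) ⟨0, by simp; omega⟩

theorem upProb_mul_harmonicIncr (s : ℝ) (x : ℕ) :
    upProb s (x + 1) * harmonicIncr s (x + 1) = (1 - upProb s (x + 1)) * harmonicIncr s x := by
  have h1 := quarter_le_upProb s (x + 1)
  have : upProb s (x + 1) ≠ 0 := by linarith
  simp only [harmonicIncr]
  field_simp

theorem killedStep_harmonic (s : ℝ) : killedStep s (harmonic s) = harmonic s := by
  ext x
  cases x with
  | zero => rw [killedStep_zero, harmonic_zero]
  | succ x =>
    rw [killedStep_succ, harmonic_succ s (x + 1), harmonic_succ s x]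
    linear_combination upProb_mul_harmonicIncr s x

theorem tendsto_natCast_add_div (k : ℕ) :
    Tendsto (fun n : ℕ => ((n + k : ℕ) : ℝ) / n) atTop (𝓝 1) := by
  have h : Tendsto (fun n : ℕ => 1 + (k : ℝ) / n) atTop (𝓝 (1 + 0)) :=
    tendsto_const_nhds.add (tendsto_const_div_atTop_nhds_zero_nat _)
  rw [add_zero] at h
  refine h.congr' ?_
  filter_upwards [eventually_gt_atTop 0] with n hn
  have : (n : ℝ) ≠ 0 := by positivity
  push_cast
  field_simp

/-- For large `r` the ratio of consecutive increments is `(r + s / 2) / (r - s / 2)`, so the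
increments are quotients of rising factorials. Euler's limit formula for `Γ`, applied to numerator
and denominator, gives the power `j ^ s`. -/
theorem tendsto_harmonicIncr {s : ℝ} (hs : -1 < s) :
    ∃ c, 0 < c ∧ Tendsto (fun j : ℕ => harmonicIncr s j / (j : ℝ) ^ s) atTop (𝓝 c) := by
  -- From height `k + 1` on, the maximum in `upProb` is attained by its first argument, and `a` and
  -- `b` below are positive.
  set k : ℕ := ⌈|s|⌉₊ with hk
  have hks : |s| ≤ k := Nat.le_ceil _
  set a : ℝ := (k + 1 : ℕ) + s / 2 with ha
  set b : ℝ := (k + 1 : ℕ) - s / 2 with hb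
  have hab : |s| < 2 * (k + 1) := by linarith [abs_nonneg s]
  have ha0 : 0 < a := by rw [ha]; push_cast; linarith [(abs_lt.1 hab).1]
  have hb0 : 0 < b := by rw [hb]; push_cast; linarith [(abs_lt.1 hab).2]
  have hprod : ∀ n : ℕ, harmonicIncr s (n + 1 + k) = harmonicIncr s k *
      ((∏ j ∈ Finset.range (n + 1), (a + j)) / ∏ j ∈ Finset.range (n + 1), (b + j)) := by
    have hstep : ∀ n : ℕ, harmonicIncr s (n + 1 + k) =
        harmonicIncr s (n + k) * ((a + n) / (b + n)) := by
      intro n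
      have e : n + 1 + k = (n + k) + 1 := by ring
      rw [e, harmonicIncr, upProb_eq (by omega) (by push_cast; linarith [le_abs_self s])]
      congr 1
      have hb' : b + n ≠ 0 := by positivity
      have h3 : (0 : ℝ) < ((n + k + 1 : ℕ) : ℝ) := by positivity
      have e1 : (1 : ℝ) / 2 - s / (4 * ((n + k + 1 : ℕ) : ℝ)) =
          (b + n) / (2 * ((n + k + 1 : ℕ) : ℝ)) := by
        rw [hb]; field_simp; push_cast; ring
      have e2 : 1 - (b + n) / (2 * ((n + k + 1 : ℕ) : ℝ)) =
          (a + n) / (2 * ((n + k + 1 : ℕ) : ℝ)) := by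
        rw [hb, ha]; field_simp; push_cast; ring
      rw [e1, e2]
      field_simp
    intro n
    induction n with
    | zero => rw [hstep]; simp
    | succ n ih =>
      rw [hstep, ih, Finset.prod_range_succ _ (n + 1), Finset.prod_range_succ _ (n + 1),
        mul_assoc, div_mul_div_comm]
  refine ⟨harmonicIncr s k * (Real.Gamma b / Real.Gamma a),
    mul_pos (harmonicIncr_pos hs k) (div_pos (Real.Gamma_pos_of_pos hb0)
      (Real.Gamma_pos_of_pos ha0)), ?_⟩
  have hG := ((Real.GammaSeq_tendsto_Gamma b).div (Real.GammaSeq_tendsto_Gamma a)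
    (Real.Gamma_pos_of_pos ha0).ne').const_mul (harmonicIncr s k)
  have hr := ((tendsto_natCast_add_div (1 + k)).rpow_const (p := -s) (Or.inl one_ne_zero))
  rw [Real.one_rpow] at hr
  have hmul := hG.mul hr
  rw [mul_one] at hmul
  rw [← tendsto_add_atTop_iff_nat (1 + k)]
  refine hmul.congr' ?_
  filter_upwards [eventually_gt_atTop 0] with n hn
  have hn' : (0 : ℝ) < n := by exact_mod_cast hn
  rw [← add_assoc n 1 k, hprod]
  have hPa : (0 : ℝ) < ∏ j ∈ Finset.range (n + 1), (a + j) :=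
    Finset.prod_pos fun j _ => by positivity
  have hPb : (0 : ℝ) < ∏ j ∈ Finset.range (n + 1), (b + j) :=
    Finset.prod_pos fun j _ => by positivity
  have hna : (0 : ℝ) < (n : ℝ) ^ a := Real.rpow_pos_of_pos hn' _
  have hnb : (n : ℝ) ^ b = (n : ℝ) ^ a * ((n : ℝ) ^ s)⁻¹ := by
    rw [← Real.rpow_neg hn'.le, ← Real.rpow_add hn']; congr 1; rw [ha, hb]; ring
  have hns : (0 : ℝ) < (n : ℝ) ^ s := Real.rpow_pos_of_pos hn' _
  have hnk : (0 : ℝ) < ((n + 1 + k : ℕ) : ℝ) ^ s := Real.rpow_pos_of_pos (by positivity) _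
  have hfac : (0 : ℝ) < (n.factorial : ℝ) := by positivity
  simp only [Pi.div_apply, Real.GammaSeq]
  rw [Real.div_rpow (by positivity) hn'.le, Real.rpow_neg hn'.le, Real.rpow_neg (by positivity),
    hnb]
  field_simp

theorem tendsto_rpow_succ_sub (a : ℝ) :
    Tendsto (fun j : ℕ => (((j : ℝ) + 1) ^ (a + 1) - (j : ℝ) ^ (a + 1)) / (j : ℝ) ^ a) atTop
      (𝓝 (a + 1)) := by
  have hd : HasDerivAt (fun t : ℝ => t ^ (a + 1)) (a + 1) 1 := by
    have := Real.hasDerivAt_rpow_const (x := 1) (p := a + 1) (Or.inl one_ne_zero)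
    simpa using this
  have h1 : Tendsto (fun j : ℕ => ((j : ℝ))⁻¹) atTop (𝓝[≠] 0) := by
    refine tendsto_nhdsWithin_iff.2 ⟨tendsto_inv_atTop_nhds_zero_nat, ?_⟩
    filter_upwards [eventually_gt_atTop 0] with j hj
    have : (j : ℝ) ≠ 0 := by positivity
    simpa using this
  have h2 := (hasDerivAt_iff_tendsto_slope_zero.1 hd).comp h1
  refine h2.congr' ?_
  filter_upwards [eventually_gt_atTop 0] with j hj
  have hj' : (0 : ℝ) < j := by exact_mod_cast hj
  simp only [Function.comp, Real.one_rpow, inv_inv, smul_eq_mul]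
  have e : (1 : ℝ) + (j : ℝ)⁻¹ = ((j : ℝ) + 1) / j := by field_simp
  have e2 : (j : ℝ) ^ (a + 1) = (j : ℝ) ^ a * j := by rw [Real.rpow_add hj', Real.rpow_one]
  have hja : (0 : ℝ) < (j : ℝ) ^ a := Real.rpow_pos_of_pos hj' _
  rw [e, Real.div_rpow (by positivity) hj'.le, e2]
  field_simp

/-- A Stolz–Cesàro argument: the increments are compared with those of `x ^ (s + 1)`, whose partial
sums diverge because `s + 1 > 0`. -/
theorem tendsto_harmonic_of_incr {s : ℝ} (hs : -1 < s) {c : ℝ}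
    (hc : Tendsto (fun j : ℕ => harmonicIncr s j / (j : ℝ) ^ s) atTop (𝓝 c)) :
    Tendsto (fun x : ℕ => harmonic s x / (x : ℝ) ^ (s + 1)) atTop (𝓝 (c / (s + 1))) := by
  have hs1 : 0 < s + 1 := by linarith
  set g : ℕ → ℝ := fun j => ((j : ℝ) + 1) ^ (s + 1) - (j : ℝ) ^ (s + 1) with hg
  have hg0 : ∀ j, 0 ≤ g j := fun j =>
    sub_nonneg.2 (Real.rpow_le_rpow (by positivity) (by linarith) hs1.le)
  have hsum : ∀ x, ∑ j ∈ Finset.range x, g j = (x : ℝ) ^ (s + 1) := by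
    intro x
    have := Finset.sum_range_sub (fun j : ℕ => (j : ℝ) ^ (s + 1)) x
    simp only [Nat.cast_zero, Real.zero_rpow hs1.ne', sub_zero] at this
    rw [← this]
    exact Finset.sum_congr rfl fun j _ => by simp [hg]
  have hratio : Tendsto (fun j : ℕ => (harmonicIncr s j - c / (s + 1) * g j) / g j) atTop (𝓝 0) := by
    have h1 := (hc.div (tendsto_rpow_succ_sub s) hs1.ne').sub_const (c / (s + 1))
    rw [sub_self] at h1
    refine h1.congr' ?_
    filter_upwards [eventually_gt_atTop 0] with j hj
    have hj' : (0 : ℝ) < j := by exact_mod_cast hj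
    have hja : (0 : ℝ) < (j : ℝ) ^ s := Real.rpow_pos_of_pos hj' _
    have hgj : 0 < g j := sub_pos.2 (Real.rpow_lt_rpow hj'.le (by linarith) hs1)
    have : ((j : ℝ) + 1) ^ (s + 1) - (j : ℝ) ^ (s + 1) = g j := rfl
    simp only [Pi.div_apply, this]
    field_simp
  have hne : ∀ᶠ j in atTop, g j = 0 → harmonicIncr s j - c / (s + 1) * g j = 0 := by
    filter_upwards [eventually_gt_atTop 0] with j hj h0
    have hj' : (0 : ℝ) < j := by exact_mod_cast hj
    have hgj : 0 < g j := sub_pos.2 (Real.rpow_lt_rpow hj'.le (by linarith) hs1)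
    exact absurd h0 hgj.ne'
  have ho : (fun j => harmonicIncr s j - c / (s + 1) * g j) =o[atTop] g :=
    (isLittleO_iff_tendsto' hne).2 hratio
  have htop : Tendsto (fun n => ∑ j ∈ Finset.range n, g j) atTop atTop := by
    simp only [hsum]
    exact (tendsto_rpow_atTop hs1).comp tendsto_natCast_atTop_atTop
  have h2 := (ho.sum_range hg0 htop).tendsto_div_nhds_zero
  have h3 := h2.add_const (c / (s + 1))
  rw [zero_add] at h3
  refine h3.congr' ?_
  filter_upwards [eventually_gt_atTop 0] with j hj
  have hj' : (0 : ℝ) < j := by exact_mod_cast hj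
  have hja : (0 : ℝ) < (j : ℝ) ^ (s + 1) := Real.rpow_pos_of_pos hj' _
  rw [Finset.sum_sub_distrib, ← Finset.mul_sum, hsum, harmonic]
  field_simp
  ring

theorem tendsto_mul_harmonicIncr_div {s : ℝ} (hs : -1 < s) :
    Tendsto (fun x : ℕ => (x : ℝ) * harmonicIncr s x / harmonic s x) atTop (𝓝 (s + 1)) := by
  have hs1 : 0 < s + 1 := by linarith
  obtain ⟨c, hc0, hc⟩ := tendsto_harmonicIncr hs
  have h1 := hc.div (tendsto_harmonic_of_incr hs hc) (div_pos hc0 hs1).ne'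
  have e : c / (c / (s + 1)) = s + 1 := by field_simp
  rw [e] at h1
  refine h1.congr' ?_
  filter_upwards [eventually_gt_atTop 0] with j hj
  have hj' : (0 : ℝ) < j := by exact_mod_cast hj
  have hja : (0 : ℝ) < (j : ℝ) ^ s := Real.rpow_pos_of_pos hj' _
  have hH := harmonic_pos hs hj.ne'
  simp only [Pi.div_apply]
  rw [Real.rpow_add hj', Real.rpow_one]
  field_simp

/-- The drift of the Bessel walk conditioned never to return to `0`. -/
noncomputable def condDrift (s : ℝ) (x : ℕ) : ℝ :=
  (upProb s x * harmonic s (x + 1) - (1 - upProb s x) * harmonic s (x - 1)) / harmonic s x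

theorem condDrift_eq {s : ℝ} (hs : -1 < s) {x : ℕ} (hx : x ≠ 0) :
    condDrift s x = 2 * upProb s x - 1 + 2 * upProb s x * (harmonicIncr s x / harmonic s x) := by
  obtain ⟨y, rfl⟩ := Nat.exists_eq_succ_of_ne_zero hx
  have hH := harmonic_pos hs hx
  have h := upProb_mul_harmonicIncr s y
  have h1 := harmonic_succ s y
  simp only [Nat.succ_eq_add_one, condDrift, Nat.add_sub_cancel] at *
  rw [harmonic_succ s (y + 1)]
  field_simp
  rw [h1]
  linear_combination -h

/-- The drift `-s / (2 x)` of the walk itself is corrected by the transform by about `(s + 1) / x`.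
The sum `(1 + s / 2) / x` is the drift of a Bessel process of dimension `s + 3`. -/
theorem tendsto_mul_condDrift {s : ℝ} (hs : -1 < s) :
    Tendsto (fun x : ℕ => (x : ℝ) * condDrift s x) atTop (𝓝 (1 + s / 2)) := by
  have h1 := tendsto_mul_harmonicIncr_div hs
  have h2 : Tendsto (fun x : ℕ => 2 * upProb s x) atTop (𝓝 1) := by
    have h := (tendsto_const_div_atTop_nhds_zero_nat (s / 2)).const_sub 1
    rw [sub_zero] at h
    refine h.congr' ?_
    filter_upwards [eventually_ge_atTop ⌈s⌉₊, eventually_gt_atTop 0] with j hj hj0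
    have hj' : (0 : ℝ) < j := by exact_mod_cast hj0
    rw [upProb_eq hj0.ne' (Nat.ceil_le.1 hj)]
    field_simp
    ring
  have h3 := (h2.mul h1).const_add (-(s / 2))
  have e : -(s / 2) + 1 * (s + 1) = 1 + s / 2 := by ring
  rw [e] at h3
  refine h3.congr' ?_
  filter_upwards [eventually_ge_atTop ⌈s⌉₊, eventually_gt_atTop 0] with j hj hj0
  have hj' : (0 : ℝ) < j := by exact_mod_cast hj0
  have hH := harmonic_pos hs hj0.ne'
  rw [condDrift_eq hs hj0.ne', upProb_eq hj0.ne' (Nat.ceil_le.1 hj)]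
  field_simp
  ring

end Harmonic

/-! ### Expectations of the killed walk, a supermartingale and Jensen's inequality. -/

section KilledExpectation

open Topology

/-- The expectation of `φ` at time `n` for the Bessel walk started at `1` and killed at its return
to `0`, for functions `φ` that vanish at `0`. -/
noncomputable def killedExp (s : ℝ) (n : ℕ) : (ℕ → ℝ) →ₗ[ℝ] ℝ :=
  (LinearMap.proj 1).comp (killedStep s ^ n)

theorem killedExp_apply (s : ℝ) (n : ℕ) (φ : ℕ → ℝ) :
    killedExp s n φ = (killedStep s ^ n) φ 1 := rfl

theorem killedExp_zero (s : ℝ) (φ : ℕ → ℝ) : killedExp s 0 φ = φ 1 := by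
  simp [killedExp_apply]

theorem killedExp_succ (s : ℝ) (n : ℕ) (φ : ℕ → ℝ) :
    killedExp s (n + 1) φ = killedExp s n (killedStep s φ) := by
  rw [killedExp_apply, killedExp_apply, pow_succ, Module.End.mul_apply]

theorem killedStep_mono {s : ℝ} (hs : -1 < s) : Monotone (killedStep s) := by
  intro φ ψ h x
  cases x with
  | zero => simp [killedStep_zero]
  | succ x =>
    rw [killedStep_succ, killedStep_succ]
    have h1 := quarter_le_upProb s (x + 1)
    have h2 := upProb_le hs (Nat.succ_ne_zero x)
    have h3 := h (x + 2)
    have h4 := h x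
    exact add_le_add (mul_le_mul_of_nonneg_left h3 (by linarith))
      (mul_le_mul_of_nonneg_left h4 (by linarith))

theorem killedExp_mono {s : ℝ} (hs : -1 < s) (n : ℕ) : Monotone (killedExp s n) := by
  induction n with
  | zero =>
    intro φ ψ h
    simpa only [killedExp_zero] using h 1
  | succ n ih =>
    intro φ ψ h
    simpa only [killedExp_succ] using ih (killedStep_mono hs h)

theorem killedExp_nonneg {s : ℝ} (hs : -1 < s) (n : ℕ) {φ : ℕ → ℝ} (h : 0 ≤ φ) :
    0 ≤ killedExp s n φ := by
  simpa using killedExp_mono hs n h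

theorem abs_killedExp_le {s : ℝ} (hs : -1 < s) (n : ℕ) {φ ψ : ℕ → ℝ} (h : ∀ x, |φ x| ≤ ψ x) :
    |killedExp s n φ| ≤ killedExp s n ψ := by
  refine abs_le.2 ⟨?_, killedExp_mono hs n fun x => (le_abs_self _).trans (h x)⟩
  rw [← map_neg]
  exact killedExp_mono hs n fun x => neg_le_of_abs_le (h x)

/-- Because `harmonic s 1 = 1`, the functional `φ ↦ killedExp s n (harmonic s * φ)` is the
expectation of a probability law, that of the `h`-transform. Most estimates below pay for an error
by bounding it by a multiple of `harmonic s`. -/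
theorem killedExp_harmonic (s : ℝ) (n : ℕ) : killedExp s n (harmonic s) = 1 := by
  induction n with
  | zero => rw [killedExp_zero, harmonic_one]
  | succ n ih => rw [killedExp_succ, killedStep_harmonic, ih]

theorem exists_pos_le_of_tendsto {a : ℕ → ℝ} {l : ℝ} (ha : ∀ n, 0 < a n) (hl : 0 < l)
    (h : Tendsto a atTop (𝓝 l)) : ∃ c, 0 < c ∧ ∀ n, c ≤ a n := by
  have h1 : Tendsto (fun n => (a n)⁻¹) atTop (𝓝 l⁻¹) := h.inv₀ hl.ne'
  obtain ⟨C, hC⟩ := h1.bddAbove_range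
  have hC' : ∀ n, (a n)⁻¹ ≤ C := fun n => hC ⟨n, rfl⟩
  have hC0 : 0 < C := (inv_pos.2 (ha 0)).trans_le (hC' 0)
  exact ⟨C⁻¹, inv_pos.2 hC0, fun n => inv_le_of_inv_le₀ (ha n) (hC' n)⟩

theorem exists_harmonic_bounds {s : ℝ} (hs : -1 < s) : ∃ c C, 0 < c ∧ 0 < C ∧
    ∀ x : ℕ, x ≠ 0 → c * (x : ℝ) ^ (s + 1) ≤ harmonic s x ∧
      harmonic s x ≤ C * (x : ℝ) ^ (s + 1) := by
  have hs1 : 0 < s + 1 := by linarith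
  obtain ⟨c, hc0, hc⟩ := tendsto_harmonicIncr hs
  have h := (tendsto_add_atTop_iff_nat 1).2 (tendsto_harmonic_of_incr hs hc)
  have hpos : ∀ n : ℕ, (0 : ℝ) < ((n + 1 : ℕ) : ℝ) ^ (s + 1) := fun n =>
    Real.rpow_pos_of_pos (by positivity) _
  obtain ⟨c', hc'0, hc'⟩ := exists_pos_le_of_tendsto
    (fun n => div_pos (harmonic_pos hs (Nat.succ_ne_zero n)) (hpos n)) (div_pos hc0 hs1) h
  obtain ⟨C, hC⟩ := h.bddAbove_range
  have hC' := fun n => hC ⟨n, rfl⟩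
  refine ⟨c', C, hc'0, hc'0.trans_le ((hc' 0).trans (hC' 0)), fun x hx => ?_⟩
  obtain ⟨y, rfl⟩ := Nat.exists_eq_succ_of_ne_zero hx
  exact ⟨(le_div_iff₀ (hpos y)).1 (hc' y), (div_le_iff₀ (hpos y)).1 (hC' y)⟩

theorem exists_le_harmonicIncr_div {s : ℝ} (hs : -1 < s) : ∃ c, 0 < c ∧
    ∀ x : ℕ, c / ((x : ℝ) + 1) ≤ harmonicIncr s x / harmonic s (x + 1) := by
  have h := (tendsto_add_atTop_iff_nat 1).2 (tendsto_mul_harmonicIncr_div hs)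
  obtain ⟨c, hc0, hc⟩ := exists_pos_le_of_tendsto (fun n => div_pos (mul_pos (by positivity)
    (harmonicIncr_pos hs _)) (harmonic_pos hs (Nat.succ_ne_zero n))) (by linarith) h
  refine ⟨c / 3, by positivity, fun x => ?_⟩
  have hH := harmonic_pos hs (Nat.succ_ne_zero x)
  have h1 := hc x
  have h2 := upProb_mul_harmonicIncr s x
  have h3 := quarter_le_upProb s (x + 1)
  have h4 := upProb_le hs (Nat.succ_ne_zero x)
  have h5 := harmonicIncr_pos hs x
  have h6 := harmonicIncr_pos hs (x + 1)
  have h7 : harmonicIncr s (x + 1) ≤ 3 * harmonicIncr s x := by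
    have : 1 / 4 * harmonicIncr s (x + 1) ≤ 3 / 4 * harmonicIncr s x :=
      calc _ ≤ upProb s (x + 1) * harmonicIncr s (x + 1) :=
            mul_le_mul_of_nonneg_right h3 h6.le
        _ = _ := h2
        _ ≤ _ := mul_le_mul_of_nonneg_right (by linarith) h5.le
    linarith
  rw [le_div_iff₀ hH] at h1
  push_cast at h1
  rw [div_div, div_le_div_iff₀ (by positivity) hH]
  have h8 : ((x : ℝ) + 1) * harmonicIncr s (x + 1) ≤ ((x : ℝ) + 1) * (3 * harmonicIncr s x) :=
    mul_le_mul_of_nonneg_left h7 (by positivity)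
  linarith

/-- Bernoulli's inequality with a quadratic gain. It follows from `1 - δ ≤ (1 - δ / 2) ^ 2 * (1 - δ
^ 2 / 4)` by the usual Bernoulli inequality for each factor; the exponent of the first one is `2 *
γ`, whence `γ ≤ 1 / 2`. -/
theorem one_sub_rpow_le {γ δ : ℝ} (hγ : 0 < γ) (hγ' : γ ≤ 1 / 2) (hδ : 0 ≤ δ) (hδ' : δ ≤ 1) :
    (1 - δ) ^ γ ≤ 1 - γ * δ - γ * δ ^ 2 / 8 := by
  have h1 : 1 - δ ≤ ((1 - δ / 2) ^ (2 : ℝ)) * (1 - δ ^ 2 / 4) := by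
    rw [Real.rpow_two]; nlinarith [mul_nonneg (sq_nonneg δ) hδ, sq_nonneg δ, mul_nonneg hδ (sub_nonneg.2 hδ'), mul_nonneg (mul_nonneg (sq_nonneg δ) hδ) (by linarith : 0 ≤ 1 - δ / 4)]
  have hδ2 : δ ^ 2 ≤ 1 := by nlinarith
  have h2 : (1 - δ) ^ γ ≤ (1 - δ / 2) ^ (2 * γ) * (1 - δ ^ 2 / 4) ^ γ := by
    rw [Real.rpow_mul (by linarith), ← Real.mul_rpow (Real.rpow_nonneg (by linarith) _) (by linarith)]
    exact Real.rpow_le_rpow (by linarith) h1 hγ.le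
  have h3 : (1 - δ / 2) ^ (2 * γ) ≤ 1 - γ * δ := by
    have := rpow_one_add_le_one_add_mul_self (s := -(δ / 2)) (by linarith)
      (p := 2 * γ) (by linarith) (by linarith)
    calc _ = (1 + -(δ / 2)) ^ (2 * γ) := by ring_nf
      _ ≤ _ := this
      _ = _ := by ring
  have h4 : (1 - δ ^ 2 / 4) ^ γ ≤ 1 - γ * δ ^ 2 / 4 := by
    have := rpow_one_add_le_one_add_mul_self (s := -(δ ^ 2 / 4)) (by linarith)
      (p := γ) (by linarith) (by linarith)
    calc _ = (1 + -(δ ^ 2 / 4)) ^ γ := by ring_nf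
      _ ≤ _ := this
      _ = _ := by ring
  have h5 : 0 ≤ (1 - δ ^ 2 / 4) ^ γ := Real.rpow_nonneg (by linarith) _
  have h6 : 0 ≤ 1 - γ * δ := by nlinarith
  refine h2.trans ((mul_le_mul h3 h4 h5 h6).trans ?_)
  have h7 : γ * δ ≤ 1 / 2 := by nlinarith
  have h8 : 0 ≤ γ * δ ^ 2 := by positivity
  nlinarith

/-- Strict concavity of `t ↦ t ^ γ` along the martingale `h`: first-order terms cancel, and the
quadratic loss is of order `h ^ γ * δ ^ 2`, where the relative increment `δ` is at least of order `1
/ x`, that is of order `h ^ (-1 / (s + 1))`. -/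
theorem killedStep_harmonic_rpow_le {s : ℝ} (hs : -1 < s) {γ : ℝ} (hγ : 0 < γ)
    (hγ' : γ ≤ 1 / 2) (hγs : γ < 2 / (s + 1)) : ∃ c, 0 < c ∧ ∀ x,
    killedStep s (fun x => harmonic s x ^ γ) x ≤
      harmonic s x ^ γ - c * harmonic s x ^ (γ - 2 / (s + 1)) := by
  have hs1 : 0 < s + 1 := by linarith
  obtain ⟨c₁, hc₁, h₁⟩ := exists_le_harmonicIncr_div hs
  obtain ⟨c₂, _, hc₂, -, h₂⟩ := exists_harmonic_bounds hs
  -- `γ / 32` is the gain `γ / 8` of `one_sub_rpow_le` times the least probability `1 / 4` of a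
  -- downward step; the other factor comes from the lower bound on `δ ^ 2`.
  refine ⟨γ / 32 * (c₁ ^ 2 * c₂ ^ (2 / (s + 1))), by positivity, fun x => ?_⟩
  cases x with
  | zero =>
    -- At height `0` both powers of `0` vanish, since `0 ^ y = 0` for every nonzero real `y`, even
    -- negative; here `γ < 2 / (s + 1)` keeps the last exponent away from `0`.
    rw [killedStep_zero, harmonic_zero, Real.zero_rpow hγ.ne',
      Real.zero_rpow (by linarith)]
    simp
  | succ x =>
    have hH := harmonic_pos hs (Nat.succ_ne_zero x)
    have hp := quarter_le_upProb s (x + 1)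
    have hp' := upProb_le hs (Nat.succ_ne_zero x)
    have hD := harmonicIncr_pos hs x
    have hD' := harmonicIncr_pos hs (x + 1)
    set h := harmonic s (x + 1) with hh
    set p := upProb s (x + 1)
    set δ := harmonicIncr s x / h with hδ
    set δ' := harmonicIncr s (x + 1) / h with hδ'
    have hδ0 : 0 < δ := div_pos hD hH
    have hδ'0 : 0 < δ' := div_pos hD' hH
    have hδ1 : δ ≤ 1 := by
      rw [hδ, div_le_one hH, hh, harmonic_succ]
      linarith [harmonic_nonneg hs x]
    have e1 : harmonic s (x + 2) = h * (1 + δ') := by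
      rw [harmonic_succ s (x + 1), hδ', ← hh]; field_simp
    have e2 : harmonic s x = h * (1 - δ) := by
      have := harmonic_succ s x
      rw [← hh] at this
      rw [hδ]; field_simp; linarith
    have hbal : p * δ' = (1 - p) * δ := by
      rw [hδ, hδ', ← mul_div_assoc, ← mul_div_assoc, upProb_mul_harmonicIncr]
    have b1 : (1 + δ') ^ γ ≤ 1 + γ * δ' :=
      rpow_one_add_le_one_add_mul_self (by linarith) hγ.le (by linarith)
    have b2 := one_sub_rpow_le hγ hγ' hδ0.le hδ1
    have hlow : c₁ ^ 2 * c₂ ^ (2 / (s + 1)) * h ^ (-(2 / (s + 1))) ≤ δ ^ 2 := by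
      have hx := (h₂ (x + 1) (Nat.succ_ne_zero x)).1
      have k1 : c₂ ^ (2 / (s + 1)) * ((x : ℝ) + 1) ^ 2 ≤ h ^ (2 / (s + 1)) := by
        have := Real.rpow_le_rpow (by positivity) hx (by positivity : 0 ≤ 2 / (s + 1))
        rw [Real.mul_rpow hc₂.le (by positivity), ← Real.rpow_mul (by positivity)] at this
        have e : (s + 1) * (2 / (s + 1)) = 2 := by field_simp
        rw [e, Real.rpow_two] at this
        push_cast at this
        exact this
      have k2 : (c₁ / ((x : ℝ) + 1)) ^ 2 ≤ δ ^ 2 := by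
        gcongr
        exact h₁ x
      refine le_trans ?_ k2
      have hhp : 0 < h ^ (2 / (s + 1)) := Real.rpow_pos_of_pos hH _
      rw [Real.rpow_neg hH.le, div_pow, ← div_eq_mul_inv, div_le_div_iff₀ hhp (by positivity),
        mul_assoc]
      exact mul_le_mul_of_nonneg_left k1 (by positivity)
    have hhγ : 0 < h ^ γ := Real.rpow_pos_of_pos hH _
    rw [killedStep_succ, e1, e2, Real.mul_rpow hH.le (by linarith),
      Real.mul_rpow hH.le (by linarith), Real.rpow_sub hH]
    have hA : p * (1 + δ') ^ γ + (1 - p) * (1 - δ) ^ γ ≤ 1 - γ / 32 * δ ^ 2 := by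
      have a1 := mul_le_mul_of_nonneg_left b1 (by linarith : 0 ≤ p)
      have a2 := mul_le_mul_of_nonneg_left b2 (by linarith : 0 ≤ 1 - p)
      have a3 : 0 ≤ (1 - p - 1 / 4) * (γ * δ ^ 2) :=
        mul_nonneg (by linarith) (by positivity)
      nlinarith [congrArg (fun t => γ * t) hbal]
    calc p * (h ^ γ * (1 + δ') ^ γ) + (1 - p) * (h ^ γ * (1 - δ) ^ γ)
        = h ^ γ * (p * (1 + δ') ^ γ + (1 - p) * (1 - δ) ^ γ) := by ring
      _ ≤ h ^ γ * (1 - γ / 32 * δ ^ 2) := mul_le_mul_of_nonneg_left hA hhγ.le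
      _ ≤ h ^ γ * (1 - γ / 32 * (c₁ ^ 2 * c₂ ^ (2 / (s + 1)) * h ^ (-(2 / (s + 1))))) := by
        gcongr
      _ = _ := by
        rw [Real.rpow_neg hH.le]; ring

/-- Jensen's inequality for the convex function `y ↦ y ^ r` and the variable `y = h ^ (γ - 1)` under
the `h`-transformed law, since `h ^ γ = h * y` and `h ^ ((γ - 1) * r + 1) = h * y ^ r`. -/
theorem killedExp_rpow_le {s : ℝ} (hs : -1 < s) {γ r : ℝ} (hr : 1 ≤ r)
    (hr0 : (γ - 1) * r + 1 ≠ 0) (hγ : γ ≠ 0) (n : ℕ) :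
    (killedExp s n fun x => harmonic s x ^ γ) ^ r ≤
      killedExp s n fun x => harmonic s x ^ ((γ - 1) * r + 1) := by
  set m := killedExp s n fun x => harmonic s x ^ γ with hm
  have hm0 : 0 ≤ m :=
    killedExp_nonneg hs n fun x => Real.rpow_nonneg (harmonic_nonneg hs x) _
  rcases hm0.eq_or_lt with h0 | hpos
  · rw [← h0, Real.zero_rpow (by linarith)]
    exact killedExp_nonneg hs n fun x => Real.rpow_nonneg (harmonic_nonneg hs x) _
  -- The tangent line of `y ↦ y ^ r` at the mean `m`, multiplied by `h`.
  have hpt : (m ^ r * (1 - r)) • harmonic s + (r * m ^ (r - 1)) • (fun x => harmonic s x ^ γ) ≤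
      fun x => harmonic s x ^ ((γ - 1) * r + 1) := by
    intro x
    simp only [Pi.add_apply, Pi.smul_apply, smul_eq_mul]
    rcases Nat.eq_zero_or_pos x with rfl | hx
    · rw [harmonic_zero, Real.zero_rpow hγ, Real.zero_rpow hr0]
      simp
    · have hH := harmonic_pos hs hx.ne'
      have hy : 0 < harmonic s x ^ (γ - 1) := Real.rpow_pos_of_pos hH _
      set y := harmonic s x ^ (γ - 1) with hy'
      have hb := one_add_mul_self_le_rpow_one_add (s := y / m - 1)
        (by have := div_pos hy hpos; linarith) hr
      have e1 : 1 + (y / m - 1) = y / m := by ring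
      rw [e1, Real.div_rpow hy.le hpos.le, le_div_iff₀ (Real.rpow_pos_of_pos hpos _)] at hb
      have e2 : harmonic s x ^ ((γ - 1) * r + 1) = y ^ r * harmonic s x := by
        rw [hy', ← Real.rpow_mul hH.le, Real.rpow_add hH, Real.rpow_one]
      have e3 : harmonic s x ^ γ = y * harmonic s x := by
        rw [hy', ← Real.rpow_add_one hH.ne']; congr 1; ring
      rw [e2, e3]
      have e4 : m ^ (r - 1) = m ^ r / m := by rw [Real.rpow_sub hpos, Real.rpow_one]
      rw [e4]
      calc _ = (1 + r * (y / m - 1)) * m ^ r * harmonic s x := by field_simp; ring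
        _ ≤ _ := mul_le_mul_of_nonneg_right hb hH.le
  have := killedExp_mono hs n hpt
  rw [map_add, map_smul, map_smul, killedExp_harmonic, ← hm, smul_eq_mul, smul_eq_mul] at this
  refine le_trans (le_of_eq ?_) this
  rw [Real.rpow_sub hpos, Real.rpow_one]
  field_simp
  ring

/-- A discrete form of `y' ≤ -c * y ^ (1 + 1 / ρ)`: as long as `y` is positive, `y ^ (-1 / ρ)` grows
by at least `c / ρ` per step. -/
theorem exists_le_rpow_of_recursion {y : ℕ → ℝ} (hy : ∀ n, 0 ≤ y n) {c ρ : ℝ} (hc : 0 < c)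
    (hρ : 0 < ρ) (h : ∀ n, y (n + 1) ≤ y n - c * y n ^ (1 + 1 / ρ)) :
    ∃ C, 0 < C ∧ ∀ n : ℕ, n ≠ 0 → y n ≤ C * (n : ℝ) ^ (-ρ) := by
  have key : ∀ n, 0 < y n → c / ρ * n ≤ y n ^ (-(1 / ρ)) := by
    intro n
    induction n with
    | zero => intro h0; simpa using Real.rpow_nonneg h0.le _
    | succ n ih =>
      intro h1
      have hn0 : 0 < y n := by
        rcases (hy n).eq_or_lt with h0 | h0
        · have := h n
          rw [← h0, Real.zero_rpow (by positivity)] at this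
          linarith
        · exact h0
      have hz : 0 < y n ^ (1 / ρ) := Real.rpow_pos_of_pos hn0 _
      have h2 : y (n + 1) ≤ y n * Real.exp (-(c * y n ^ (1 / ρ))) := by
        refine (h n).trans ?_
        rw [Real.rpow_add hn0, Real.rpow_one]
        have := Real.add_one_le_exp (-(c * y n ^ (1 / ρ)))
        nlinarith
      have h3 : (y n * Real.exp (-(c * y n ^ (1 / ρ)))) ^ (-(1 / ρ)) ≤ y (n + 1) ^ (-(1 / ρ)) :=
        Real.rpow_le_rpow_of_nonpos h1 h2 (by have : 0 < 1 / ρ := by positivity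
                                              linarith)
      refine le_trans ?_ h3
      rw [Real.mul_rpow hn0.le (Real.exp_pos _).le, ← Real.exp_mul, Real.rpow_neg hn0.le]
      have h4 := Real.add_one_le_exp (-(c * y n ^ (1 / ρ)) * -(1 / ρ))
      have h5 : (y n ^ (1 / ρ))⁻¹ * (-(c * y n ^ (1 / ρ)) * -(1 / ρ) + 1) ≤
          (y n ^ (1 / ρ))⁻¹ * Real.exp (-(c * y n ^ (1 / ρ)) * -(1 / ρ)) :=
        mul_le_mul_of_nonneg_left h4 (by positivity)
      refine le_trans ?_ h5
      have h6 := ih hn0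
      rw [Real.rpow_neg hn0.le] at h6
      push_cast
      have e : (y n ^ (1 / ρ))⁻¹ * (-(c * y n ^ (1 / ρ)) * -(1 / ρ) + 1) =
          c / ρ + (y n ^ (1 / ρ))⁻¹ := by field_simp
      rw [e]
      linarith
  refine ⟨(c / ρ) ^ (-ρ), by positivity, fun n hn => ?_⟩
  have hn' : (0 : ℝ) < n := by positivity
  rcases (hy n).eq_or_lt with h0 | h0
  · rw [← h0]; positivity
  have h1 := Real.rpow_le_rpow_of_nonpos (by positivity) (key n h0) (by linarith : -ρ ≤ 0)
  rw [← Real.rpow_mul h0.le, Real.mul_rpow (by positivity) hn'.le] at h1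
  have e : -(1 / ρ) * -ρ = 1 := by field_simp
  rwa [e, Real.rpow_one] at h1

end KilledExpectation

/-! ### Time spent by the killed walk at low heights. -/

section Occupation

open Topology

theorem killedExp_le_mul {s : ℝ} (hs : -1 < s) (n : ℕ) {φ ψ : ℕ → ℝ} {c : ℝ}
    (h : ∀ x, φ x ≤ c * ψ x) : killedExp s n φ ≤ c * killedExp s n ψ := by
  rw [← smul_eq_mul, ← map_smul]
  exact killedExp_mono hs n h

/-- Let `y n` and `w n` be the expectations of `h ^ γ` and of `h ^ (γ - 2 / (s + 1))`. The
supermartingale inequality gives `y (n + 1) ≤ y n - c * w n`, and Jensen bounds `w n` below by a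
power of `y n`, so `y` decays polynomially. Summing the first inequality bounds the sum of `w` from
time `n` on by `y n / c`. -/
theorem exists_sum_killedExp_le {s : ℝ} (hs : -1 < s) : ∃ γ C, 0 < γ ∧ γ * ((s + 1) / 2) < 1 ∧
    0 < C ∧ γ - 2 / (s + 1) < 0 ∧ ∀ n N : ℕ, n ≠ 0 →
      ∑ k ∈ Finset.Ico n N, killedExp s k (fun x => harmonic s x ^ (γ - 2 / (s + 1))) ≤
        C * (n : ℝ) ^ (-((1 - γ) * ((s + 1) / 2))) := by
  have hs1 : 0 < s + 1 := by linarith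
  -- Any `γ > 0` with `γ ≤ 1 / 2` and `γ < 2 / (s + 1)` would do; this one works for all `s > -1`.
  set γ : ℝ := 1 / (2 * (s + 2)) with hγ
  have hs2 : 0 < s + 2 := by linarith
  have hγ0 : 0 < γ := by positivity
  have hγ1 : γ ≤ 1 / 2 := by
    rw [hγ, div_le_div_iff₀ (by positivity) (by norm_num)]; linarith
  have hγ2 : γ < 2 / (s + 1) := by
    rw [hγ, div_lt_div_iff₀ (by positivity) hs1]; linarith
  obtain ⟨c, hc, h⟩ := killedStep_harmonic_rpow_le hs hγ0 hγ1 hγ2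
  set y : ℕ → ℝ := fun n => killedExp s n fun x => harmonic s x ^ γ with hy
  set w : ℕ → ℝ := fun n => killedExp s n fun x => harmonic s x ^ (γ - 2 / (s + 1)) with hw
  have hy0 : ∀ n, 0 ≤ y n := fun n =>
    killedExp_nonneg hs n fun x => Real.rpow_nonneg (harmonic_nonneg hs x) _
  have hrec : ∀ n, y (n + 1) ≤ y n - c * w n := by
    intro n
    simp only [hy, hw]
    rw [killedExp_succ, ← smul_eq_mul, ← map_smul, ← map_sub]
    exact killedExp_mono hs n h
  set ρ : ℝ := (1 - γ) * ((s + 1) / 2) with hρ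
  have hρ0 : 0 < ρ := mul_pos (by linarith) (by linarith)
  have hne : (1 - γ) ≠ 0 := by linarith
  have hexp : (γ - 1) * (1 + 1 / ρ) + 1 = γ - 2 / (s + 1) := by
    rw [hρ]; field_simp; ring
  have hjen : ∀ n, y n ^ (1 + 1 / ρ) ≤ w n := by
    intro n
    have := killedExp_rpow_le hs (γ := γ) (r := 1 + 1 / ρ)
      (by have : 0 < 1 / ρ := by positivity
          linarith) (by rw [hexp]; linarith) hγ0.ne' n
    rwa [hexp] at this
  obtain ⟨C, hC, hyC⟩ := exists_le_rpow_of_recursion hy0 hc hρ0 fun n =>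
    (hrec n).trans (by have := mul_le_mul_of_nonneg_left (hjen n) hc.le; linarith)
  refine ⟨γ, c⁻¹ * C, hγ0, ?_, by positivity, by linarith, fun n N hn => ?_⟩
  · rw [hγ, div_mul_div_comm, div_lt_one (by positivity)]; linarith
  have htel : ∀ N, c * ∑ k ∈ Finset.Ico n N, w k ≤ y n := by
    intro N
    rcases le_total N n with hN | hN
    · rw [Finset.Ico_eq_empty_of_le hN]; simpa using hy0 n
    have : c * ∑ k ∈ Finset.Ico n N, w k ≤ y n - y N := by
      induction N, hN using Nat.le_induction with
      | base => simp
      | succ N hN ih =>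
        rw [Finset.sum_Ico_succ_top hN, mul_add]
        linarith [hrec N]
    linarith [hy0 N]
  rw [mul_assoc, ← div_eq_inv_mul, le_div_iff₀ hc, mul_comm]
  exact (htel N).trans (hyC n hn)

/-- Transience of the `h`-transform. The expectations `w n` are summable, and on the finitely many
heights below `K` the function `h` is bounded by a multiple of `h ^ (γ - 2 / (s + 1))`. -/
theorem tendsto_killedExp_initial {s : ℝ} (hs : -1 < s) (K : ℕ) :
    Tendsto (fun n => killedExp s n fun x => if x < K then harmonic s x else 0) atTop (𝓝 0) := by
  obtain ⟨γ, C, hγ, -, hC, hneg, h⟩ := exists_sum_killedExp_le hs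
  set w : ℕ → ℝ := fun n => killedExp s n fun x => harmonic s x ^ (γ - 2 / (s + 1)) with hw
  have hw0 : ∀ n, 0 ≤ w n := fun n =>
    killedExp_nonneg hs n fun x => Real.rpow_nonneg (harmonic_nonneg hs x) _
  have hsum : Summable fun n => w (n + 1) := by
    refine summable_of_sum_range_le (c := C) (fun n => hw0 _) fun n => ?_
    have := h 1 (n + 1) one_ne_zero
    rw [Nat.cast_one, Real.one_rpow, mul_one, Finset.sum_Ico_eq_sum_range, Nat.add_sub_cancel]
      at this
    simpa only [add_comm 1] using this
  have hw1 : Tendsto w atTop (𝓝 0) := (tendsto_add_atTop_iff_nat 1).1 hsum.tendsto_atTop_zero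
  set M : ℝ := ∑ x ∈ Finset.range K, harmonic s x / harmonic s x ^ (γ - 2 / (s + 1)) with hM
  have hMt : ∀ x, 0 ≤ harmonic s x / harmonic s x ^ (γ - 2 / (s + 1)) := fun x =>
    div_nonneg (harmonic_nonneg hs x) (Real.rpow_nonneg (harmonic_nonneg hs x) _)
  have hbound : ∀ n, (killedExp s n fun x => if x < K then harmonic s x else 0) ≤ M * w n := by
    intro n
    simp only [hw]
    refine killedExp_le_mul hs n fun x => ?_
    have hr := Real.rpow_nonneg (harmonic_nonneg hs x) (γ - 2 / (s + 1))
    split_ifs with hx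
    · rcases Nat.eq_zero_or_pos x with rfl | hx0
      · rw [harmonic_zero, Real.zero_rpow hneg.ne]; simp
      · have hr' : 0 < harmonic s x ^ (γ - 2 / (s + 1)) :=
          Real.rpow_pos_of_pos (harmonic_pos hs hx0.ne') _
        rw [← div_le_iff₀ hr']
        exact Finset.single_le_sum (f := fun x => harmonic s x / harmonic s x ^ (γ - 2 / (s + 1)))
          (fun x _ => hMt x) (Finset.mem_range.2 hx)
    · exact mul_nonneg (Finset.sum_nonneg fun x _ => hMt x) hr
  refine squeeze_zero (fun n => killedExp_nonneg hs n fun x => ?_) hbound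
    (by simpa using hw1.const_mul M)
  dsimp only [Pi.zero_apply]
  split_ifs
  exacts [harmonic_nonneg hs x, le_rfl]

/-- In the layer `x ^ 2 ≤ ε * k` with `k < 2 * n` the constant `1` is at most a multiple of `(ε * n)
^ δ * h ^ w`, with `w` negative, so the previous occupation bound applies. The factor `ε ^ δ` later
makes the singularity of `1 / h` at low heights negligible. -/
theorem exists_sum_killedExp_near_zero_le {s : ℝ} (hs : -1 < s) : ∃ C δ : ℝ, 0 < C ∧ 0 < δ ∧
    ∀ ε : ℝ, 0 < ε → ∀ n : ℕ, n ≠ 0 →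
      ∑ k ∈ Finset.Ico n (2 * n),
        killedExp s k (fun x => if x ≠ 0 ∧ (x : ℝ) ^ 2 ≤ ε * k then 1 else 0) ≤
        C * ε ^ δ * (n : ℝ) ^ (1 - (s + 1) / 2) := by
  have hs1 : 0 < s + 1 := by linarith
  obtain ⟨γ, C, hγ, hγ1, hC, hneg, h⟩ := exists_sum_killedExp_le hs
  obtain ⟨_, C₂, -, hC₂, hbd⟩ := exists_harmonic_bounds hs
  set δ : ℝ := 1 - γ * ((s + 1) / 2) with hδ
  have hδ0 : 0 < δ := by linarith
  set w : ℝ := γ - 2 / (s + 1) with hw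
  refine ⟨C₂ ^ (-w) * 2 ^ δ * C, δ, by positivity, hδ0, fun ε hε n hn => ?_⟩
  have hn' : (0 : ℝ) < n := by positivity
  have hterm : ∀ k ∈ Finset.Ico n (2 * n),
      killedExp s k (fun x => if x ≠ 0 ∧ (x : ℝ) ^ 2 ≤ ε * k then (1 : ℝ) else 0) ≤
      C₂ ^ (-w) * (ε * (2 * n)) ^ δ * killedExp s k (fun x => harmonic s x ^ w) := by
    intro k hk
    have hk2 : (k : ℝ) ≤ 2 * n := by exact_mod_cast (Finset.mem_Ico.1 hk).2.le
    refine killedExp_le_mul hs k fun x => ?_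
    split_ifs with hx
    · have hH := harmonic_pos hs hx.1
      have hx0 : (0 : ℝ) < x := by exact_mod_cast Nat.pos_of_ne_zero hx.1
      have h1 : harmonic s x ^ (-w) ≤ C₂ ^ (-w) * (ε * (2 * n)) ^ δ := by
        have h2 := Real.rpow_le_rpow hH.le (hbd x hx.1).2 (by linarith : 0 ≤ -w)
        refine h2.trans ?_
        rw [Real.mul_rpow hC₂.le (by positivity), ← Real.rpow_mul hx0.le]
        refine mul_le_mul_of_nonneg_left ?_ (by positivity)
        have e : (s + 1) * -w = 2 * δ := by rw [hw, hδ]; field_simp; ring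
        rw [e, Real.rpow_mul hx0.le, Real.rpow_two]
        refine Real.rpow_le_rpow (by positivity) (hx.2.trans ?_) hδ0.le
        exact mul_le_mul_of_nonneg_left hk2 hε.le
      have h3 : 0 < harmonic s x ^ w := Real.rpow_pos_of_pos hH _
      rw [Real.rpow_neg hH.le, inv_le_iff_one_le_mul₀ h3] at h1
      exact h1
    · have := Real.rpow_nonneg (harmonic_nonneg hs x) w
      positivity
  refine (Finset.sum_le_sum hterm).trans ?_
  rw [← Finset.mul_sum]
  refine (mul_le_mul_of_nonneg_left (h n (2 * n) hn) (by positivity)).trans (le_of_eq ?_)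
  have e1 : (1 : ℝ) - (s + 1) / 2 = δ + -((1 - γ) * ((s + 1) / 2)) := by rw [hδ]; ring
  rw [e1, Real.rpow_add hn', Real.mul_rpow hε.le (by positivity),
    Real.mul_rpow (by norm_num) hn'.le]
  ring

end Occupation

/-! ### One step of the conditioned walk on Gaussian functions. -/

section Laplace

open Topology

theorem abs_exp_sub_sum_le (x : ℝ) (n : ℕ) :
    |Real.exp x - ∑ m ∈ Finset.range n, x ^ m / m.factorial| ≤ |x| ^ n * Real.exp |x| := by
  have h := Complex.norm_exp_sub_sum_le_norm_mul_exp (x : ℂ) n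
  rw [Complex.norm_real] at h
  rw [← Real.norm_eq_abs, ← Real.norm_eq_abs, ← Complex.norm_real]
  push_cast
  exact h

theorem abs_exp_sub_le (x : ℝ) : |Real.exp x - (1 + x)| ≤ x ^ 2 * Real.exp |x| := by
  have h := abs_exp_sub_sum_le x 2
  simpa [Finset.sum_range_succ] using h

/-- Taylor expansion to fourth order. The odd terms survive only with the factor `b`, so the cubic
term can be kept in the form `b * z * z ^ 2`: in the application `b * z` is already of order `g`,
although `z` is only of order `√g` on the relevant scale. -/
theorem abs_average_exp_sub_le {b z : ℝ} (hz0 : 0 ≤ z) :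
    |(1 + b) / 2 * Real.exp (-z) + (1 - b) / 2 * Real.exp z - (1 - b * z + z ^ 2 / 2)| ≤
      (1 + |b|) * (z ^ 4 * Real.exp z) + |b * z| * z ^ 2 / 6 := by
  have r1 := abs_exp_sub_sum_le z 4
  have r2 := abs_exp_sub_sum_le (-z) 4
  rw [abs_neg] at r2
  rw [abs_of_nonneg hz0] at r1 r2
  set R₁ := Real.exp z - ∑ m ∈ Finset.range 4, z ^ m / m.factorial with hR₁
  set R₂ := Real.exp (-z) - ∑ m ∈ Finset.range 4, (-z) ^ m / m.factorial with hR₂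
  have e0 : (1 + b) / 2 * Real.exp (-z) + (1 - b) / 2 * Real.exp z - (1 - b * z + z ^ 2 / 2) =
      (1 + b) / 2 * R₂ + (1 - b) / 2 * R₁ - b * z * z ^ 2 / 6 := by
    rw [hR₁, hR₂]
    simp only [Finset.sum_range_succ, Finset.sum_range_zero, Nat.factorial]
    push_cast
    ring
  have q1 : |(1 + b) / 2 * R₂| ≤ (1 + |b|) / 2 * (z ^ 4 * Real.exp z) := by
    rw [abs_mul]
    refine mul_le_mul ?_ r2 (abs_nonneg _) (by positivity)
    rw [abs_div, abs_two]
    have := abs_add_le 1 b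
    rw [abs_one] at this
    linarith
  have q2 : |(1 - b) / 2 * R₁| ≤ (1 + |b|) / 2 * (z ^ 4 * Real.exp z) := by
    rw [abs_mul]
    refine mul_le_mul ?_ r1 (abs_nonneg _) (by positivity)
    rw [abs_div, abs_two]
    have := abs_sub 1 b
    rw [abs_one] at this
    linarith
  have q3 : |b * z * z ^ 2 / 6| = |b * z| * z ^ 2 / 6 := by
    rw [abs_div, abs_mul, abs_of_nonneg (sq_nonneg z), abs_of_pos (by norm_num : (0 : ℝ) < 6)]
  rw [e0]
  have s1 := abs_sub ((1 + b) / 2 * R₂ + (1 - b) / 2 * R₁) (b * z * z ^ 2 / 6)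
  have s2 := abs_add_le ((1 + b) / 2 * R₂) ((1 - b) / 2 * R₁)
  linarith

theorem gaussian_exponent_bounds {a g Y : ℝ} (ha : 0 ≤ a) (hg : 0 < g) (hY0 : 0 ≤ Y) :
    |2 * g * Y - 2 * a * g + g - (2 * g * Y / (1 + 2 * g) - a * Real.log (1 + 2 * g) + g)| ≤
        (4 + 2 * a) * g ^ 2 * (1 + Y) ∧
      |2 * g * Y / (1 + 2 * g) - a * Real.log (1 + 2 * g) + g| ≤ g * (2 * Y + 2 * a + 1) := by
  have hg1 : 0 < 1 + 2 * g := by positivity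
  have hlog1 : Real.log (1 + 2 * g) ≤ 2 * g := by
    have := Real.log_le_sub_one_of_pos hg1; linarith
  have hlog2 : 2 * g - 2 * g ^ 2 ≤ Real.log (1 + 2 * g) := by
    have := Real.le_log_one_add_of_nonneg (x := 2 * g) (by positivity)
    refine le_trans ?_ this
    rw [le_div_iff₀ (by positivity)]
    have : 0 < g ^ 3 := by positivity
    nlinarith
  have hlog0 : 0 ≤ Real.log (1 + 2 * g) := Real.log_nonneg (by linarith)
  have hfr1 : 2 * g * Y / (1 + 2 * g) ≤ 2 * g * Y := div_le_self (by positivity) (by linarith)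
  have hfr2 : 2 * g * Y - 4 * g ^ 2 * Y ≤ 2 * g * Y / (1 + 2 * g) := by
    rw [le_div_iff₀ hg1]
    have : 0 ≤ g ^ 3 * Y := by positivity
    nlinarith
  have hfr0 : 0 ≤ 2 * g * Y / (1 + 2 * g) := by positivity
  generalize 2 * g * Y / (1 + 2 * g) = w at *
  generalize Real.log (1 + 2 * g) = l at *
  have u1 := mul_le_mul_of_nonneg_left hlog1 ha
  have u2 := mul_le_mul_of_nonneg_left hlog2 ha
  have u3 : 0 ≤ a * (g ^ 2 * Y) := by positivity
  have u4 : 0 ≤ g ^ 2 * Y := by positivity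
  have u5 : 0 ≤ a * g ^ 2 := by positivity
  have u6 : 0 ≤ g ^ 2 := by positivity
  have u7 := mul_nonneg ha hlog0
  have u8 : 0 ≤ g * Y := by positivity
  have u9 : 0 ≤ a * g := by positivity
  have e1 : (4 + 2 * a) * g ^ 2 * (1 + Y) =
      4 * g ^ 2 + 4 * (g ^ 2 * Y) + 2 * (a * g ^ 2) + 2 * (a * (g ^ 2 * Y)) := by ring
  have e2 : g * (2 * Y + 2 * a + 1) = 2 * (g * Y) + 2 * (a * g) + g := by ring
  rw [e1, e2]
  constructor <;> refine abs_le.2 ⟨?_, ?_⟩ <;> linarith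

/-- Both sides agree to first order in `g` apart from the drift error `e`. The remainder is of order
`g ^ 2` with a growth in `Y` of at most `(1 + Y) ^ 2 * exp (Y / 2)`, which the factor `exp (-Y)`
absorbs in `exists_gaussian_step_bound`. -/
theorem abs_average_exp_sub_exp_le {a : ℝ} (ha : 0 ≤ a) {A : ℝ} (hA : 0 ≤ A) : ∃ K, 0 ≤ K ∧
    ∀ g Y z b e : ℝ, 0 < g → g ≤ 1 / 8 → 0 ≤ Y → 0 ≤ z → z ^ 2 = 4 * g * Y →
      b * z = 2 * g * (a - 1 / 2 + e) → |a - 1 / 2 + e| ≤ A → |b| ≤ A →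
      |(1 + b) / 2 * Real.exp (-z) + (1 - b) / 2 * Real.exp z -
        Real.exp (2 * g * Y / (1 + 2 * g) - a * Real.log (1 + 2 * g) + g)| ≤
        2 * g * |e| + K * g ^ 2 * ((1 + Y) ^ 2 * Real.exp (Y / 2)) := by
  set K₁ : ℝ := ((1 + A) * 16 + 2 * A) * Real.exp (1 / 4) with hK₁
  set K₂ : ℝ := 4 + 2 * a with hK₂
  set K₃ : ℝ := (2 * a + 2) ^ 2 * Real.exp ((2 * a + 1) / 8) with hK₃
  refine ⟨K₁ + K₂ + K₃, by positivity, fun g Y z b e hg hg8 hY0 hz0 hzz hbz hbA hb => ?_⟩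
  set E : ℝ := Real.exp (Y / 2) with hE
  have hE1 : 1 ≤ E := Real.one_le_exp (by positivity)
  have h14 : 1 ≤ Real.exp (1 / 4 : ℝ) := Real.one_le_exp (by norm_num)
  have hYY : Y ≤ (1 + Y) ^ 2 := by nlinarith
  have hYY1 : 1 + Y ≤ (1 + Y) ^ 2 := by nlinarith
  have hYY2 : Y ^ 2 ≤ (1 + Y) ^ 2 := by nlinarith
  have hezY : Real.exp z ≤ Real.exp (1 / 4) * E := by
    rw [hE, ← Real.exp_add]
    refine Real.exp_le_exp.2 ?_
    nlinarith [sq_nonneg (z - 4 * g)]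
  have h1 : |(1 + b) / 2 * Real.exp (-z) + (1 - b) / 2 * Real.exp z - (1 - b * z + z ^ 2 / 2)| ≤
      K₁ * g ^ 2 * ((1 + Y) ^ 2 * E) := by
    refine (abs_average_exp_sub_le hz0).trans ?_
    have hz4 : z ^ 4 = 16 * g ^ 2 * Y ^ 2 := by
      have : z ^ 4 = (z ^ 2) ^ 2 := by ring
      rw [this, hzz]; ring
    have t2 : (1 + |b|) * (z ^ 4 * Real.exp z) ≤
        (1 + A) * (16 * g ^ 2 * (1 + Y) ^ 2 * (Real.exp (1 / 4) * E)) := by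
      rw [hz4]
      gcongr
    have t3 : |b * z| * z ^ 2 / 6 ≤ 2 * A * g ^ 2 * ((1 + Y) ^ 2 * (Real.exp (1 / 4) * E)) := by
      have : |b * z| * z ^ 2 / 6 = |a - 1 / 2 + e| * (4 / 3 * g ^ 2 * Y) := by
        rw [hbz, hzz, abs_mul, abs_of_pos (by positivity : 0 < 2 * g)]; ring
      rw [this]
      calc |a - 1 / 2 + e| * (4 / 3 * g ^ 2 * Y) ≤ A * (2 * g ^ 2 * ((1 + Y) ^ 2 * (1 * 1))) := by
            gcongr
            · norm_num
            · linarith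
        _ ≤ A * (2 * g ^ 2 * ((1 + Y) ^ 2 * (Real.exp (1 / 4) * E))) := by gcongr
        _ = _ := by ring
    calc _ ≤ _ := add_le_add t2 t3
      _ = _ := by rw [hK₁]; ring
  obtain ⟨h3, hUabs⟩ := gaussian_exponent_bounds ha hg hY0
  set U : ℝ := 2 * g * Y / (1 + 2 * g) - a * Real.log (1 + 2 * g) + g with hU
  have h4 : |Real.exp U - (1 + U)| ≤ K₃ * g ^ 2 * ((1 + Y) ^ 2 * E) := by
    refine (abs_exp_sub_le U).trans ?_
    have u1 : U ^ 2 ≤ (g * ((2 * a + 2) * (1 + Y))) ^ 2 := by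
      rw [← sq_abs U]
      refine pow_le_pow_left₀ (abs_nonneg _) (hUabs.trans ?_) 2
      refine mul_le_mul_of_nonneg_left ?_ hg.le
      nlinarith [mul_nonneg ha hY0]
    have u2 : Real.exp |U| ≤ Real.exp ((2 * a + 1) / 8) * E := by
      rw [hE, ← Real.exp_add]
      refine Real.exp_le_exp.2 (hUabs.trans ?_)
      have := mul_le_mul_of_nonneg_right hg8 (by positivity : 0 ≤ 2 * Y + 2 * a + 1)
      linarith
    calc _ ≤ _ := mul_le_mul u1 u2 (Real.exp_pos _).le (by positivity)
      _ = _ := by rw [hK₃]; ring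
  have h3' : K₂ * g ^ 2 * (1 + Y) ≤ K₂ * g ^ 2 * ((1 + Y) ^ 2 * E) := by
    refine mul_le_mul_of_nonneg_left ?_ (by positivity)
    calc (1 + Y) ≤ (1 + Y) ^ 2 * 1 := by linarith
      _ ≤ _ := mul_le_mul_of_nonneg_left hE1 (by positivity)
  have h2 : |(-(2 * g * e))| = 2 * g * |e| := by
    rw [abs_neg, abs_mul, abs_of_nonneg (by positivity)]
  set M := (1 + b) / 2 * Real.exp (-z) + (1 - b) / 2 * Real.exp z with hM
  have hdec : M - Real.exp U = (M - (1 - b * z + z ^ 2 / 2)) + (-(2 * g * e)) +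
      (2 * g * Y - 2 * a * g + g - U) - (Real.exp U - (1 + U)) := by
    rw [hbz, hzz]; ring
  rw [hdec]
  have s1 := abs_sub ((M - (1 - b * z + z ^ 2 / 2)) + (-(2 * g * e)) +
      (2 * g * Y - 2 * a * g + g - U)) (Real.exp U - (1 + U))
  have s2 := abs_add_le ((M - (1 - b * z + z ^ 2 / 2)) + (-(2 * g * e)))
      (2 * g * Y - 2 * a * g + g - U)
  have s3 := abs_add_le (M - (1 - b * z + z ^ 2 / 2)) (-(2 * g * e))
  rw [add_mul, add_mul, add_mul, add_mul]
  linarith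

/-- The subtracted term is what the Bessel process of dimension `2 * a` gives exactly in unit time,
and `(a - 1 / 2) / x` is its drift. The walk imitates it up to the drift error `e` and a remainder
uniform in `x`; here `z = 2 * g * x` and `Y = g * x ^ 2`. -/
theorem exists_gaussian_step_bound {a : ℝ} (ha : 0 ≤ a) {B : ℝ} (hB : 0 ≤ B) : ∃ K, 0 ≤ K ∧
    ∀ g x b e : ℝ, 0 < g → g ≤ 1 / 8 → 1 ≤ x → x * b = a - 1 / 2 + e → |e| ≤ B →
      |Real.exp (-g) * ((1 + b) / 2 * Real.exp (-(2 * g * x)) + (1 - b) / 2 * Real.exp (2 * g * x))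
          * Real.exp (-(g * x ^ 2)) -
        (1 + 2 * g) ^ (-a) * Real.exp (-(g / (1 + 2 * g) * x ^ 2))| ≤ 2 * g * |e| + K * g ^ 2 := by
  have hA0 : 0 ≤ a + 1 / 2 + B := by positivity
  obtain ⟨K, hK, h⟩ := abs_average_exp_sub_exp_le ha hA0
  refine ⟨K * 8, by positivity, fun g x b e hg hg8 hx hxb he => ?_⟩
  have hbA : |a - 1 / 2 + e| ≤ a + 1 / 2 + B := by
    refine (abs_add_le _ _).trans ?_
    have : |a - 1 / 2| ≤ a + 1 / 2 := abs_le.2 ⟨by linarith, by linarith⟩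
    linarith
  have hb : |b| ≤ a + 1 / 2 + B := by
    have h1 : |x * b| ≤ a + 1 / 2 + B := by rw [hxb]; exact hbA
    rw [abs_mul, abs_of_nonneg (by linarith : 0 ≤ x)] at h1
    nlinarith [abs_nonneg b]
  have hmain := h g (g * x ^ 2) (2 * g * x) b e hg hg8 (by positivity) (by positivity) (by ring)
    (by rw [← hxb]; ring) hbA hb
  have hg1 : 0 < 1 + 2 * g := by positivity
  have hrhs : (1 + 2 * g) ^ (-a) * Real.exp (-(g / (1 + 2 * g) * x ^ 2)) =
      Real.exp (-g) * Real.exp (-(g * x ^ 2)) *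
        Real.exp (2 * g * (g * x ^ 2) / (1 + 2 * g) - a * Real.log (1 + 2 * g) + g) := by
    rw [Real.rpow_def_of_pos hg1, ← Real.exp_add, ← Real.exp_add, ← Real.exp_add]
    congr 1
    field_simp
    ring
  rw [hrhs]
  set M := (1 + b) / 2 * Real.exp (-(2 * g * x)) + (1 - b) / 2 * Real.exp (2 * g * x)
  set W := Real.exp (2 * g * (g * x ^ 2) / (1 + 2 * g) - a * Real.log (1 + 2 * g) + g)
  have hY0 : 0 ≤ g * x ^ 2 := by positivity
  set Y := g * x ^ 2
  have hlhs : Real.exp (-g) * M * Real.exp (-Y) - Real.exp (-g) * Real.exp (-Y) * W =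
      Real.exp (-g) * Real.exp (-Y) * (M - W) := by ring
  rw [hlhs, abs_mul, abs_of_pos (by positivity)]
  have hexpg : Real.exp (-g) ≤ 1 := Real.exp_le_one_iff.2 (by linarith)
  have hexpY : Real.exp (-Y) ≤ 1 := Real.exp_le_one_iff.2 (by linarith)
  have hpoly : Real.exp (-Y) * ((1 + Y) ^ 2 * Real.exp (Y / 2)) ≤ 8 := by
    have w1 := Real.quadratic_le_exp_of_nonneg (x := Y / 2) (by positivity)
    have w2 : (1 + Y) ^ 2 ≤ 8 * Real.exp (Y / 2) := by nlinarith
    have w3 : Real.exp (-Y) * (Real.exp (Y / 2) * Real.exp (Y / 2)) = 1 := by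
      rw [← Real.exp_add, ← Real.exp_add]; simp
    calc Real.exp (-Y) * ((1 + Y) ^ 2 * Real.exp (Y / 2))
        ≤ Real.exp (-Y) * ((8 * Real.exp (Y / 2)) * Real.exp (Y / 2)) := by gcongr
      _ = 8 * (Real.exp (-Y) * (Real.exp (Y / 2) * Real.exp (Y / 2))) := by ring
      _ = 8 := by rw [w3]; norm_num
  calc Real.exp (-g) * Real.exp (-Y) * |M - W|
      ≤ 1 * Real.exp (-Y) * |M - W| := by gcongr
    _ ≤ 1 * Real.exp (-Y) * (2 * g * |e| +
      K * g ^ 2 * ((1 + Y) ^ 2 * Real.exp (Y / 2))) := by gcongr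
    _ = Real.exp (-Y) * (2 * g * |e|) + K * g ^ 2 *
        (Real.exp (-Y) * ((1 + Y) ^ 2 * Real.exp (Y / 2))) := by ring
    _ ≤ 1 * (2 * g * |e|) + K * g ^ 2 * 8 := by gcongr
    _ = _ := by ring

end Laplace

/-! ### Scaling limit of the conditioned walk. -/

section LaplaceLimit

open Topology

theorem exists_killedStep_gaussian {s : ℝ} (hs : -1 < s) : ∃ K B, ∃ e : ℕ → ℝ, 0 ≤ K ∧
    (∀ x, |e x| ≤ B) ∧ Tendsto e atTop (𝓝 0) ∧ ∀ g : ℝ, 0 < g → g ≤ 1 / 8 → ∀ x,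
      |killedStep s (fun x => harmonic s x * Real.exp (-(g * (x : ℝ) ^ 2))) x -
        (1 + 2 * g) ^ (-((s + 3) / 2)) *
          (harmonic s x * Real.exp (-(g / (1 + 2 * g) * (x : ℝ) ^ 2)))| ≤
        2 * g * (harmonic s x * |e x|) + K * g ^ 2 * harmonic s x := by
  set e : ℕ → ℝ := fun x => (x : ℝ) * condDrift s x - (1 + s / 2) with he
  have he0 : Tendsto e atTop (𝓝 0) := by
    have := (tendsto_mul_condDrift hs).sub_const (1 + s / 2)
    rwa [sub_self] at this
  obtain ⟨B, hB⟩ := he0.abs.bddAbove_range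
  have hB' : ∀ x, |e x| ≤ B := fun x => hB ⟨x, rfl⟩
  have hB0 : 0 ≤ B := (abs_nonneg _).trans (hB' 0)
  obtain ⟨K, hK, h⟩ := exists_gaussian_step_bound (a := (s + 3) / 2) (by linarith) hB0
  refine ⟨K, B, e, hK, hB', he0, fun g hg hg8 x => ?_⟩
  cases x with
  | zero => simp [killedStep_zero, harmonic_zero]
  | succ y =>
    have hH := harmonic_pos hs (Nat.succ_ne_zero y)
    have hx1 : (1 : ℝ) ≤ ((y + 1 : ℕ) : ℝ) := by push_cast; linarith [(Nat.cast_nonneg y : (0 : ℝ) ≤ y)]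
    have hb := h g ((y + 1 : ℕ) : ℝ) (condDrift s (y + 1)) (e (y + 1)) hg hg8 hx1
      (by rw [he]; ring) (hB' _)
    have hharm := congrFun (killedStep_harmonic s) (y + 1)
    rw [killedStep_succ] at hharm
    have hdr : condDrift s (y + 1) * harmonic s (y + 1) =
        upProb s (y + 1) * harmonic s (y + 2) - (1 - upProb s (y + 1)) * harmonic s y := by
      rw [condDrift, Nat.add_sub_cancel]; field_simp
    have w1 : upProb s (y + 1) * harmonic s (y + 2) =
        (1 + condDrift s (y + 1)) / 2 * harmonic s (y + 1) := by linarith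
    have w2 : (1 - upProb s (y + 1)) * harmonic s y =
        (1 - condDrift s (y + 1)) / 2 * harmonic s (y + 1) := by linarith
    rw [killedStep_succ]
    set b := condDrift s (y + 1)
    set X : ℝ := ((y + 1 : ℕ) : ℝ) with hX
    have x1 : ((y + 2 : ℕ) : ℝ) = X + 1 := by rw [hX]; push_cast; ring
    have x2 : (y : ℝ) = X - 1 := by rw [hX]; push_cast; ring
    have E1 : Real.exp (-(g * (X + 1) ^ 2)) =
        Real.exp (-g) * Real.exp (-(2 * g * X)) * Real.exp (-(g * X ^ 2)) := by
      rw [← Real.exp_add, ← Real.exp_add]; congr 1; ring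
    have E2 : Real.exp (-(g * (X - 1) ^ 2)) =
        Real.exp (-g) * Real.exp (2 * g * X) * Real.exp (-(g * X ^ 2)) := by
      rw [← Real.exp_add, ← Real.exp_add]; congr 1; ring
    rw [x1, x2, ← mul_assoc, ← mul_assoc, w1, w2, E1, E2]
    have e3 : (1 + b) / 2 * harmonic s (y + 1) *
          (Real.exp (-g) * Real.exp (-(2 * g * X)) * Real.exp (-(g * X ^ 2))) +
        (1 - b) / 2 * harmonic s (y + 1) *
          (Real.exp (-g) * Real.exp (2 * g * X) * Real.exp (-(g * X ^ 2))) -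
        (1 + 2 * g) ^ (-((s + 3) / 2)) *
          (harmonic s (y + 1) * Real.exp (-(g / (1 + 2 * g) * X ^ 2))) =
        harmonic s (y + 1) * (Real.exp (-g) * ((1 + b) / 2 * Real.exp (-(2 * g * X)) +
            (1 - b) / 2 * Real.exp (2 * g * X)) * Real.exp (-(g * X ^ 2)) -
          (1 + 2 * g) ^ (-((s + 3) / 2)) * Real.exp (-(g / (1 + 2 * g) * X ^ 2))) := by ring
    rw [e3, abs_mul, abs_of_pos hH]
    calc _ ≤ _ := mul_le_mul_of_nonneg_left hb hH.le
      _ = _ := by ring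

/-- At heights at least `K` the error is small and `h` has total mass `1`; the mass below `K`
vanishes by transience. -/
theorem tendsto_killedExp_harmonic_mul {s : ℝ} (hs : -1 < s) {e : ℕ → ℝ} {B : ℝ}
    (hB : ∀ x, |e x| ≤ B) (he : Tendsto e atTop (𝓝 0)) :
    Tendsto (fun n => killedExp s n fun x => harmonic s x * |e x|) atTop (𝓝 0) := by
  have hnn : ∀ n, 0 ≤ killedExp s n fun x => harmonic s x * |e x| := fun n =>
    killedExp_nonneg hs n fun x => mul_nonneg (harmonic_nonneg hs x) (abs_nonneg _)
  rw [Metric.tendsto_atTop]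
  intro ε hε
  obtain ⟨K, hK⟩ := (Metric.tendsto_atTop.1 he) (ε / 2) (by positivity)
  have hB0 : 0 ≤ B := (abs_nonneg _).trans (hB 0)
  have h1 := (tendsto_killedExp_initial hs K).const_mul B
  rw [mul_zero] at h1
  obtain ⟨N, hN⟩ := (Metric.tendsto_atTop.1 h1) (ε / 2) (by positivity)
  refine ⟨N, fun n hn => ?_⟩
  have hN' := hN n hn
  rw [Real.dist_eq, sub_zero] at hN' ⊢
  rw [abs_of_nonneg (hnn n)]
  have hle : (killedExp s n fun x => harmonic s x * |e x|) ≤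
      B * (killedExp s n fun x => if x < K then harmonic s x else 0) + ε / 2 * 1 := by
    rw [← killedExp_harmonic s n, ← smul_eq_mul, ← smul_eq_mul (ε / 2), ← map_smul, ← map_smul,
      ← map_add]
    refine killedExp_mono hs n fun x => ?_
    simp only [Pi.add_apply, Pi.smul_apply, smul_eq_mul]
    have hH := harmonic_nonneg hs x
    split_ifs with hx
    · have := mul_le_mul_of_nonneg_left (hB x) hH
      have h3 : 0 ≤ ε / 2 * harmonic s x := by positivity
      linarith
    · have h2 := hK x (by omega)
      rw [Real.dist_eq, sub_zero] at h2
      have := mul_le_mul_of_nonneg_left h2.le hH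
      linarith
  have := le_abs_self (B * (killedExp s n fun x => if x < K then harmonic s x else 0))
  linarith

/-- The one-step formula is iterated backwards from time `N` to time `0`. The step errors add up to
a Cesàro mean of quantities tending to `0` plus a term of order `1 / N`. The limit is the Laplace
transform of the squared Bessel process of dimension `s + 3` at time `1`, started at `0`. -/
theorem tendsto_killedExp_gaussian {s : ℝ} (hs : -1 < s) {θ : ℝ} (hθ : 0 < θ) :
    Tendsto (fun N : ℕ => killedExp s N
      fun x => harmonic s x * Real.exp (-(θ / N * (x : ℝ) ^ 2))) atTop
      (𝓝 ((1 + 2 * θ) ^ (-((s + 3) / 2)))) := by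
  obtain ⟨K, B, e, hK, hB, he, hstep⟩ := exists_killedStep_gaussian hs
  set a : ℝ := (s + 3) / 2 with ha
  have ha0 : 0 < a := by rw [ha]; linarith
  set η : ℕ → ℝ := fun n => killedExp s n fun x => harmonic s x * |e x| with hη
  have hη0 : ∀ n, 0 ≤ η n := fun n =>
    killedExp_nonneg hs n fun x => mul_nonneg (harmonic_nonneg hs x) (abs_nonneg _)
  have hces := (tendsto_killedExp_harmonic_mul hs hB he).cesaro
  set F : ℝ → ℕ → ℝ := fun g n =>
    killedExp s n fun x => harmonic s x * Real.exp (-(g * (x : ℝ) ^ 2)) with hF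
  have hFstep : ∀ g : ℝ, 0 < g → g ≤ 1 / 8 → ∀ n,
      |F g (n + 1) - (1 + 2 * g) ^ (-a) * F (g / (1 + 2 * g)) n| ≤
        2 * g * η n + K * g ^ 2 := by
    intro g hg hg8 n
    have h1 : F g (n + 1) - (1 + 2 * g) ^ (-a) * F (g / (1 + 2 * g)) n =
        killedExp s n (killedStep s (fun x => harmonic s x * Real.exp (-(g * (x : ℝ) ^ 2))) -
          (1 + 2 * g) ^ (-a) • fun x : ℕ =>
            harmonic s x * Real.exp (-(g / (1 + 2 * g) * (x : ℝ) ^ 2))) := by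
      rw [map_sub, map_smul, ← killedExp_succ, smul_eq_mul]
    rw [h1]
    refine (abs_killedExp_le hs n (ψ := (2 * g) • (fun x => harmonic s x * |e x|) +
      (K * g ^ 2) • harmonic s) fun x => hstep g hg hg8 x).trans (le_of_eq ?_)
    rw [map_add, map_smul, map_smul, killedExp_harmonic, smul_eq_mul, smul_eq_mul, mul_one]
  have hmain : ∀ N : ℕ, N ≠ 0 → 8 * θ ≤ N →
      |F (θ / N) N - (1 + 2 * θ) ^ (-a) * F (θ / (N * (1 + 2 * θ))) 0| ≤
        2 * θ * ((N : ℝ)⁻¹ * ∑ k ∈ Finset.range N, η k) + K * θ ^ 2 / N := by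
    intro N hN hNθ
    have hN' : (0 : ℝ) < N := by positivity
    -- `G` solves `G k = G (k + 1) / (1 + 2 * G (k + 1))` with `G N = θ / N`, as the reciprocals
    -- increase by `2` per backward step. The prefactors multiply to `c k`, which telescopes to `(1
    -- + 2 * θ) ^ (-a)` at `k = 0`.
    set G : ℕ → ℝ := fun k => θ / (N + 2 * θ * ((N : ℝ) - k)) with hG
    set c : ℕ → ℝ := fun k => (1 + 2 * (θ / N) * ((N : ℝ) - k)) ^ (-a) with hc
    have hind : ∀ k ≤ N, |c k * F (G k) k - c 0 * F (G 0) 0| ≤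
        ∑ j ∈ Finset.range k, (2 * (θ / N) * η j + K * (θ / N) ^ 2) := by
      intro k
      induction k with
      | zero => intro _; simp
      | succ k ih =>
        intro hk
        rw [Finset.sum_range_succ]
        have hkN : ((k + 1 : ℕ) : ℝ) ≤ N := by exact_mod_cast hk
        push_cast at hkN
        have hd0 : (0 : ℝ) < N + 2 * θ * ((N : ℝ) - (k + 1 : ℕ)) := by
          push_cast
          have : 0 ≤ 2 * θ * ((N : ℝ) - (k + 1)) := mul_nonneg (by positivity) (by linarith)
          linarith
        have hd1 : (0 : ℝ) < N + 2 * θ * ((N : ℝ) - k) := by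
          have : 0 ≤ 2 * θ * ((N : ℝ) - k) := mul_nonneg (by positivity) (by linarith)
          linarith
        have hd01 : (N : ℝ) + 2 * θ * ((N : ℝ) - k) =
            N + 2 * θ * ((N : ℝ) - (k + 1 : ℕ)) + 2 * θ := by push_cast; ring
        have hg : 0 < G (k + 1) := div_pos hθ hd0
        have hgN : G (k + 1) ≤ θ / N := by
          refine div_le_div_of_nonneg_left hθ.le hN' ?_
          push_cast
          have : 0 ≤ 2 * θ * ((N : ℝ) - (k + 1)) := mul_nonneg (by positivity) (by linarith)
          linarith
        have hg8 : G (k + 1) ≤ 1 / 8 := hgN.trans (by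
          rw [div_le_div_iff₀ hN' (by norm_num)]; linarith)
        have hGk : G (k + 1) / (1 + 2 * G (k + 1)) = G k := by
          have hne : (1 + 2 * G (k + 1)) ≠ 0 := by positivity
          rw [div_eq_iff hne]
          simp only [hG]
          rw [hd01]
          generalize (N : ℝ) + 2 * θ * ((N : ℝ) - (k + 1 : ℕ)) = d at hd0
          field_simp
        have hbase0 : 0 ≤ 1 + 2 * (θ / N) * ((N : ℝ) - (k + 1 : ℕ)) := by
          push_cast
          have : 0 ≤ 2 * (θ / N) * ((N : ℝ) - (k + 1)) := mul_nonneg (by positivity) (by linarith)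
          linarith
        have hck : c (k + 1) * (1 + 2 * G (k + 1)) ^ (-a) = c k := by
          simp only [hc]
          rw [← Real.mul_rpow hbase0 (by positivity)]
          have hb1 : ∀ y : ℝ, 1 + 2 * (θ / N) * ((N : ℝ) - y) =
              (N + 2 * θ * ((N : ℝ) - y)) / N := by intro y; field_simp
          congr 1
          simp only [hG]
          rw [hb1, hb1, hd01]
          generalize (N : ℝ) + 2 * θ * ((N : ℝ) - (k + 1 : ℕ)) = d at hd0
          field_simp
        have hc0 : 0 ≤ c (k + 1) := Real.rpow_nonneg hbase0 _
        have hc1 : c (k + 1) ≤ 1 := by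
          refine Real.rpow_le_one_of_one_le_of_nonpos ?_ (by linarith)
          push_cast
          have : 0 ≤ 2 * (θ / N) * ((N : ℝ) - (k + 1)) := mul_nonneg (by positivity) (by linarith)
          linarith
        have hs1 := hFstep (G (k + 1)) hg hg8 k
        rw [hGk] at hs1
        have hs2 : |c (k + 1) * F (G (k + 1)) (k + 1) - c k * F (G k) k| ≤
            2 * (θ / N) * η k + K * (θ / N) ^ 2 := by
          rw [← hck, mul_assoc, ← mul_sub, abs_mul, abs_of_nonneg hc0]
          calc _ ≤ 1 * (2 * G (k + 1) * η k + K * G (k + 1) ^ 2) := by gcongr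
            _ ≤ 1 * (2 * (θ / N) * η k + K * (θ / N) ^ 2) := by
              have := hη0 k
              gcongr
            _ = _ := one_mul _
        have := abs_sub_le (c (k + 1) * F (G (k + 1)) (k + 1)) (c k * F (G k) k) (c 0 * F (G 0) 0)
        have := ih (by omega)
        linarith
    have hN1 := hind N le_rfl
    have c0 : c 0 = (1 + 2 * θ) ^ (-a) := by
      simp only [hc]; congr 1; push_cast; field_simp; ring
    have cN : c N = 1 := by simp [hc]
    have G0 : G 0 = θ / (N * (1 + 2 * θ)) := by
      simp only [hG]; congr 1; push_cast; ring
    have GN : G N = θ / N := by simp [hG]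
    rw [c0, cN, G0, GN, one_mul] at hN1
    refine hN1.trans (le_of_eq ?_)
    rw [Finset.sum_add_distrib, ← Finset.mul_sum, Finset.sum_const, Finset.card_range,
      nsmul_eq_mul]
    field_simp
  have hF0 : Tendsto (fun N : ℕ => F (θ / (N * (1 + 2 * θ))) 0) atTop (𝓝 1) := by
    have h1 : Tendsto (fun N : ℕ => Real.exp (-(θ / (1 + 2 * θ) / N))) atTop (𝓝 (Real.exp (-0))) :=
      (Real.continuous_exp.tendsto _).comp (tendsto_const_div_atTop_nhds_zero_nat _).neg
    rw [neg_zero, Real.exp_zero] at h1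
    refine h1.congr fun N => ?_
    simp only [hF, killedExp_zero, harmonic_one, one_mul, Nat.cast_one, one_pow, mul_one]
    rw [div_div, mul_comm (N : ℝ)]
  have hR : Tendsto (fun N : ℕ => 2 * θ * ((N : ℝ)⁻¹ * ∑ k ∈ Finset.range N, η k) +
      K * θ ^ 2 / N) atTop (𝓝 0) := by
    have := (hces.const_mul (2 * θ)).add (tendsto_const_div_atTop_nhds_zero_nat (K * θ ^ 2))
    simpa using this
  have hdiff : Tendsto (fun N : ℕ => F (θ / N) N -
      (1 + 2 * θ) ^ (-a) * F (θ / (N * (1 + 2 * θ))) 0) atTop (𝓝 0) := by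
    refine squeeze_zero_norm' ?_ hR
    filter_upwards [eventually_ne_atTop 0, eventually_ge_atTop ⌈8 * θ⌉₊] with N h1 h2
    exact hmain N h1 (Nat.ceil_le.1 h2)
  have := hdiff.add (hF0.const_mul ((1 + 2 * θ) ^ (-a)))
  simpa using this

/-- In the variable `t = exp (-x ^ 2 / N)` the monomials are the Gaussians already treated, with the
constant handled by harmonicity. Weierstrass approximation on `[0, 1]` does the rest; the endpoint
`t = 0` stands for infinite height. Only existence of the limit is needed, so a Cauchy argument
suffices. -/
theorem exists_tendsto_killedExp_comp_exp {s : ℝ} (hs : -1 < s) {ψ : ℝ → ℝ}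
    (hψ : ContinuousOn ψ (Set.Icc 0 1)) : ∃ l, Tendsto (fun N : ℕ => killedExp s N
      fun x => harmonic s x * ψ (Real.exp (-((x : ℝ) ^ 2 / N)))) atTop (𝓝 l) := by
  have hmon : ∀ j : ℕ, ∃ l, Tendsto (fun N : ℕ => killedExp s N
      fun x => harmonic s x * Real.exp (-((x : ℝ) ^ 2 / N)) ^ j) atTop (𝓝 l) := by
    intro j
    rcases Nat.eq_zero_or_pos j with rfl | hj
    · refine ⟨1, ?_⟩
      simp only [pow_zero, mul_one]
      simp only [killedExp_harmonic]
      exact tendsto_const_nhds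
    · refine ⟨_, (tendsto_killedExp_gaussian hs (θ := j) (by exact_mod_cast hj)).congr fun N => ?_⟩
      congr 1
      ext x
      rw [← Real.exp_nat_mul]
      congr 2
      ring
  have hpoly : ∀ p : Polynomial ℝ, ∃ l, Tendsto (fun N : ℕ => killedExp s N
      fun x => harmonic s x * p.eval (Real.exp (-((x : ℝ) ^ 2 / N)))) atTop (𝓝 l) := by
    intro p
    induction p using Polynomial.induction_on' with
    | add p q hp hq =>
      obtain ⟨l, hl⟩ := hp
      obtain ⟨m, hm⟩ := hq
      refine ⟨l + m, (hl.add hm).congr fun N => ?_⟩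
      rw [← map_add]
      congr 1
      ext x
      simp [mul_add]
    | monomial j c =>
      obtain ⟨l, hl⟩ := hmon j
      refine ⟨c * l, (hl.const_mul c).congr fun N => ?_⟩
      rw [← smul_eq_mul, ← map_smul]
      congr 1
      ext x
      simp only [Pi.smul_apply, smul_eq_mul, Polynomial.eval_monomial]
      ring
  refine cauchySeq_tendsto_of_complete ?_
  rw [Metric.cauchySeq_iff]
  intro ε hε
  obtain ⟨p, hp⟩ := exists_polynomial_near_of_continuousOn 0 1 ψ hψ (ε / 3) (by positivity)
  obtain ⟨l, hl⟩ := hpoly p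
  obtain ⟨N, hN⟩ := (Metric.cauchySeq_iff.1 hl.cauchySeq) (ε / 3) (by positivity)
  have hclose : ∀ n : ℕ, |(killedExp s n fun x => harmonic s x * ψ (Real.exp (-((x : ℝ) ^ 2 / n)))) -
      killedExp s n fun x => harmonic s x * p.eval (Real.exp (-((x : ℝ) ^ 2 / n)))| ≤ ε / 3 := by
    intro n
    rw [← map_sub]
    refine (abs_killedExp_le hs n (ψ := (ε / 3) • harmonic s) fun x => ?_).trans (le_of_eq ?_)
    · simp only [Pi.sub_apply, Pi.smul_apply, smul_eq_mul]
      rw [← mul_sub, abs_mul, abs_of_nonneg (harmonic_nonneg hs x), mul_comm]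
      refine mul_le_mul_of_nonneg_right ?_ (harmonic_nonneg hs x)
      rw [abs_sub_comm]
      exact (hp _ ⟨(Real.exp_pos _).le, Real.exp_le_one_iff.2
        (neg_nonpos.2 (by positivity))⟩).le
    · rw [map_smul, killedExp_harmonic, smul_eq_mul, mul_one]
  refine ⟨N, fun m hm n hn => ?_⟩
  have h1 := hN m hm n hn
  have h2 := hclose m
  have h3 := hclose n
  rw [Real.dist_eq] at h1 ⊢
  rw [abs_le] at h2 h3
  rw [abs_lt] at h1 ⊢
  constructor <;> linarith

end LaplaceLimit

/-! ### From block sums of a monotone sequence to its terms. -/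

section MonotoneDensity

open Topology

/-- By monotonicity `g N` is at least the average of `g` over a short block to the right of `N` and
at most the average over a block to its left. The constant `l` may change with the precision, since
the block asymptotics are only known up to a truncation. -/
theorem eventually_bounds_of_antitone_of_sums {g : ℕ → ℝ} (hg : Antitone g) {κ : ℝ} (hκ : 0 < κ)
    {c₀ : ℝ} (hc₀ : 0 < c₀)
    (h : ∀ ε > 0, ∃ l ≥ c₀, ∀ᶠ n : ℕ in atTop, ∀ m, n ≤ m → m ≤ 2 * n →
      |∑ k ∈ Finset.Ico n m, (g k - l * (k : ℝ) ^ (-κ))| ≤ ε * (n : ℝ) ^ (1 - κ))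
    {ω : ℝ} (hω : 0 < ω) (hω' : ω ≤ 1 / 2) :
    ∃ l ≥ c₀, ∀ᶠ n : ℕ in atTop, (1 - ω) * l - ω ≤ (n : ℝ) ^ κ * g n ∧
      (n : ℝ) ^ κ * g n ≤ (1 + ω) * l + ω := by
  -- `t` is the relative block length, small enough that `k ^ (-κ)` varies by a factor within `1 ±
  -- ω` over a block.
  obtain ⟨t, ht0, ht1, hta, htb⟩ : ∃ t : ℝ, 0 < t ∧ t ≤ 1 / 2 ∧ 1 - ω ≤ (1 + t) ^ (-κ) ∧
      (1 - t) ^ (-κ) ≤ 1 + ω := by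
    have h1 : Tendsto (fun t : ℝ => (1 + t) ^ (-κ)) (𝓝[>] 0) (𝓝 ((1 + 0) ^ (-κ))) := by
      refine Tendsto.rpow_const ?_ (Or.inl (by norm_num))
      exact (tendsto_const_nhds.add tendsto_id).mono_left nhdsWithin_le_nhds
    have h2 : Tendsto (fun t : ℝ => (1 - t) ^ (-κ)) (𝓝[>] 0) (𝓝 ((1 - 0) ^ (-κ))) := by
      refine Tendsto.rpow_const ?_ (Or.inl (by norm_num))
      exact (tendsto_const_nhds.sub tendsto_id).mono_left nhdsWithin_le_nhds
    rw [add_zero, Real.one_rpow] at h1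
    rw [sub_zero, Real.one_rpow] at h2
    have h3 := h1.eventually_const_le (by linarith : 1 - ω < 1)
    have h4 := h2.eventually_le_const (by linarith : 1 < 1 + ω)
    have h5 : ∀ᶠ t : ℝ in 𝓝[>] 0, t ∈ Set.Ioc 0 (1 / 2) :=
      Ioc_mem_nhdsGT (by norm_num)
    obtain ⟨t, ⟨h3, h4⟩, h5⟩ := ((h3.and h4).and h5).exists
    exact ⟨t, h5.1, h5.2, h3, h4⟩
  -- A block has `r ≥ t * N / 2` terms, so after division by `r` this error costs `ω / 2`.
  obtain ⟨l, hl, hev⟩ := h (ω * t / 4) (by positivity)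
  have hl0 : 0 < l := hc₀.trans_le hl
  refine ⟨l, hl, ?_⟩
  obtain ⟨n₀, hn₀⟩ := eventually_atTop.1 hev
  filter_upwards [eventually_ge_atTop (2 * n₀), eventually_ge_atTop ⌈2 / t⌉₊,
    eventually_gt_atTop 0] with N hN₀ hNt hN
  have hN' : (0 : ℝ) < N := by exact_mod_cast hN
  have htN : 2 ≤ t * N := by
    have := Nat.ceil_le.1 hNt
    rw [div_le_iff₀ ht0] at this
    linarith
  set r : ℕ := ⌊t * N⌋₊ with hr
  have hr1 : (r : ℝ) ≤ t * N := Nat.floor_le (by positivity)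
  have hr2 : t * N / 2 ≤ r := by
    have := Nat.sub_one_lt_floor (t * N)
    linarith
  have hr0 : (0 : ℝ) < r := by linarith
  have hrN : r ≤ N := by
    have : (r : ℝ) ≤ N := hr1.trans (by nlinarith)
    exact_mod_cast this
  have hεr : ω * t / 4 * N ≤ ω / 2 * r := by nlinarith
  have hNκ : 0 < (N : ℝ) ^ κ := Real.rpow_pos_of_pos hN' _
  constructor
  · have h1 := hn₀ N (by omega) (N + r) (by omega) (by omega)
    rw [Finset.sum_sub_distrib] at h1
    have h2 : ∑ k ∈ Finset.Ico N (N + r), g k ≤ r * g N := by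
      have := Finset.sum_le_card_nsmul (Finset.Ico N (N + r)) g (g N)
        fun k hk => hg (Finset.mem_Ico.1 hk).1
      simpa using this
    have h3 : r * (l * (((1 + t) * N) ^ (-κ))) ≤
        ∑ k ∈ Finset.Ico N (N + r), l * (k : ℝ) ^ (-κ) := by
      have := Finset.card_nsmul_le_sum (Finset.Ico N (N + r)) (fun k : ℕ => l * (k : ℝ) ^ (-κ))
        (l * (((1 + t) * N) ^ (-κ))) fun k hk => by
          have hk1 : (N : ℝ) ≤ k := by exact_mod_cast (Finset.mem_Ico.1 hk).1
          have hk2 : (k : ℝ) ≤ N + r := by exact_mod_cast (Finset.mem_Ico.1 hk).2.le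
          refine mul_le_mul_of_nonneg_left ?_ hl0.le
          exact Real.rpow_le_rpow_of_nonpos (by linarith) (by linarith) (by linarith)
      simpa using this
    have h4 := (abs_le.1 h1).1
    rw [Real.mul_rpow (by linarith) hN'.le] at h3
    have e1 : (N : ℝ) ^ (1 - κ) = N * (N : ℝ) ^ (-κ) := by
      rw [sub_eq_add_neg, Real.rpow_add hN', Real.rpow_one]
    rw [e1] at h4
    have hm : 0 < (N : ℝ) ^ (-κ) := Real.rpow_pos_of_pos hN' _
    have e2 : (N : ℝ) ^ (-κ) * (N : ℝ) ^ κ = 1 := by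
      rw [← Real.rpow_add hN', neg_add_cancel, Real.rpow_zero]
    have h5 : r * ((N : ℝ) ^ (-κ) * ((1 - ω) * l - ω)) ≤ r * g N := by
      have a1 := mul_le_mul_of_nonneg_right hεr hm.le
      have a2 : r * (l * ((1 - ω) * (N : ℝ) ^ (-κ))) ≤
          r * (l * ((1 + t) ^ (-κ) * (N : ℝ) ^ (-κ))) := by gcongr
      have a3 : 0 ≤ r * ((N : ℝ) ^ (-κ) * ω) := by positivity
      linarith
    have h6 := le_of_mul_le_mul_left h5 hr0
    calc (1 - ω) * l - ω = ((N : ℝ) ^ (-κ) * (N : ℝ) ^ κ) * ((1 - ω) * l - ω) := by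
          rw [e2, one_mul]
      _ = (N : ℝ) ^ κ * ((N : ℝ) ^ (-κ) * ((1 - ω) * l - ω)) := by ring
      _ ≤ _ := mul_le_mul_of_nonneg_left h6 hNκ.le
  · have hr3 : (r : ℝ) ≤ N / 2 := hr1.trans (by nlinarith)
    have hr4 : 2 * r ≤ N := by
      have : (2 : ℝ) * r ≤ N := by linarith
      exact_mod_cast this
    obtain ⟨n, hn⟩ : ∃ n, N = n + r := ⟨N - r, by omega⟩
    have h1 := hn₀ n (by omega) N (by omega) (by omega)
    rw [Finset.sum_sub_distrib] at h1
    have hcard : (Finset.Ico n N).card = r := by rw [Nat.card_Ico]; omega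
    have hNn : (N : ℝ) = n + r := by exact_mod_cast hn
    have hn1 : (1 - t) * N ≤ n := by linarith
    have hn0 : (0 : ℝ) < n := lt_of_lt_of_le (by nlinarith) hn1
    have h2 : r * g N ≤ ∑ k ∈ Finset.Ico n N, g k := by
      have := Finset.card_nsmul_le_sum (Finset.Ico n N) g (g N)
        fun k hk => hg (Finset.mem_Ico.1 hk).2.le
      rwa [hcard, nsmul_eq_mul] at this
    have h3 : ∑ k ∈ Finset.Ico n N, l * (k : ℝ) ^ (-κ) ≤ r * (l * (n : ℝ) ^ (-κ)) := by
      have := Finset.sum_le_card_nsmul (Finset.Ico n N) (fun k : ℕ => l * (k : ℝ) ^ (-κ))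
        (l * (n : ℝ) ^ (-κ)) fun k hk => by
          have hk1 : (n : ℝ) ≤ k := by exact_mod_cast (Finset.mem_Ico.1 hk).1
          refine mul_le_mul_of_nonneg_left ?_ hl0.le
          exact Real.rpow_le_rpow_of_nonpos hn0 hk1 (by linarith)
      rwa [hcard, nsmul_eq_mul] at this
    have h4 := (abs_le.1 h1).2
    have e1 : (n : ℝ) ^ (1 - κ) = n * (n : ℝ) ^ (-κ) := by
      rw [sub_eq_add_neg, Real.rpow_add hn0, Real.rpow_one]
    rw [e1] at h4
    have hm : 0 < (n : ℝ) ^ (-κ) := Real.rpow_pos_of_pos hn0 _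
    have h5 : (n : ℝ) ^ (-κ) ≤ (1 + ω) * (N : ℝ) ^ (-κ) := by
      have := Real.rpow_le_rpow_of_nonpos (by nlinarith : 0 < (1 - t) * N) hn1
        (by linarith : -κ ≤ 0)
      refine this.trans ?_
      rw [Real.mul_rpow (by linarith) hN'.le]
      exact mul_le_mul_of_nonneg_right htb (Real.rpow_nonneg hN'.le _)
    have h6 : r * g N ≤ r * ((n : ℝ) ^ (-κ) * (l + ω / 2)) := by
      have a1 : ω * t / 4 * n ≤ ω / 2 * r := by
        refine le_trans ?_ hεr
        refine mul_le_mul_of_nonneg_left (by linarith) (by positivity)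
      have a2 := mul_le_mul_of_nonneg_right a1 hm.le
      linarith
    have h7 := le_of_mul_le_mul_left h6 hr0
    have e2 : (N : ℝ) ^ κ * (N : ℝ) ^ (-κ) = 1 := by
      rw [← Real.rpow_add hN', add_neg_cancel, Real.rpow_zero]
    calc (N : ℝ) ^ κ * g N ≤ (N : ℝ) ^ κ * ((n : ℝ) ^ (-κ) * (l + ω / 2)) :=
          mul_le_mul_of_nonneg_left h7 hNκ.le
      _ ≤ (N : ℝ) ^ κ * ((1 + ω) * (N : ℝ) ^ (-κ) * (l + ω / 2)) := by gcongr
      _ = (N : ℝ) ^ κ * (N : ℝ) ^ (-κ) * ((1 + ω) * (l + ω / 2)) := by ring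
      _ ≤ (1 + ω) * l + ω := by rw [e2]; nlinarith

/-- A monotone density theorem: a monotone sequence is regularly varying when its sums over
blocks `[n, m)` with `n ≤ m ≤ 2 n` are asymptotically those of powers. -/
theorem exists_tendsto_of_antitone_of_sums {g : ℕ → ℝ} (hg : Antitone g) {κ : ℝ} (hκ : 0 < κ)
    {c₀ : ℝ} (hc₀ : 0 < c₀)
    (h : ∀ ε > 0, ∃ l ≥ c₀, ∀ᶠ n : ℕ in atTop, ∀ m, n ≤ m → m ≤ 2 * n →
      |∑ k ∈ Finset.Ico n m, (g k - l * (k : ℝ) ^ (-κ))| ≤ ε * (n : ℝ) ^ (1 - κ)) :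
    ∃ L > 0, Tendsto (fun n : ℕ => (n : ℝ) ^ κ * g n) atTop (𝓝 L) := by
  obtain ⟨l₀, hl₀, hev₀⟩ := eventually_bounds_of_antitone_of_sums hg hκ hc₀ h
    (by norm_num : (0 : ℝ) < 1 / 2) le_rfl
  set A : ℝ := 2 * l₀ + 1 with hA
  have hA0 : 0 < A := by linarith
  -- Comparison with the bounds for `ω = 1 / 2` confines every admissible `l` to a fixed bounded
  -- range. The relative error then becomes an absolute one, and the normalized sequence is Cauchy.
  have hb : ∀ ω : ℝ, 0 < ω → ω ≤ 1 / 2 → ∃ l ≥ c₀, ∀ᶠ n : ℕ in atTop,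
      |(n : ℝ) ^ κ * g n - l| ≤ ω * (2 * A + 2) := by
    intro ω hω hω'
    obtain ⟨l, hl, hev⟩ := eventually_bounds_of_antitone_of_sums hg hκ hc₀ h hω hω'
    have hl0 : 0 < l := hc₀.trans_le hl
    have hlA : l ≤ 2 * A + 1 := by
      obtain ⟨n, hn1, hn2⟩ := (hev.and hev₀).exists
      nlinarith [hn1.1, hn2.2]
    refine ⟨l, hl, ?_⟩
    filter_upwards [hev] with n hn
    refine abs_le.2 ⟨?_, ?_⟩ <;> nlinarith [hn.1, hn.2]
  have hcau : CauchySeq fun n : ℕ => (n : ℝ) ^ κ * g n := by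
    rw [Metric.cauchySeq_iff]
    intro ε hε
    obtain ⟨l, -, hev⟩ := hb (min (1 / 2) (ε / (3 * (2 * A + 2)))) (by positivity) (min_le_left _ _)
    obtain ⟨N, hN⟩ := eventually_atTop.1 hev
    have hω : min (1 / 2) (ε / (3 * (2 * A + 2))) * (2 * A + 2) ≤ ε / 3 := by
      calc _ ≤ ε / (3 * (2 * A + 2)) * (2 * A + 2) :=
            mul_le_mul_of_nonneg_right (min_le_right _ _) (by positivity)
        _ = ε / 3 := by field_simp
    refine ⟨N, fun m hm n hn => ?_⟩
    have h1 := (hN m hm).trans hω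
    have h2 := (hN n hn).trans hω
    rw [abs_le] at h1 h2
    rw [Real.dist_eq, abs_lt]
    constructor <;> linarith
  obtain ⟨L, hL⟩ := cauchySeq_tendsto_of_complete hcau
  refine ⟨L, ?_, hL⟩
  obtain ⟨l, hl, hev⟩ := hb (min (1 / 2) (c₀ / (2 * (2 * A + 2)))) (by positivity) (min_le_left _ _)
  have hω : min (1 / 2) (c₀ / (2 * (2 * A + 2))) * (2 * A + 2) ≤ c₀ / 2 := by
    calc _ ≤ c₀ / (2 * (2 * A + 2)) * (2 * A + 2) :=
          mul_le_mul_of_nonneg_right (min_le_right _ _) (by positivity)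
      _ = c₀ / 2 := by field_simp
  have : c₀ / 2 ≤ L := by
    refine ge_of_tendsto hL ?_
    filter_upwards [hev] with n hn
    linarith [(abs_le.1 hn).1]
  linarith

end MonotoneDensity

/-! ### Asymptotics of the survival probability. -/

section Survival

open Topology

/-- The probability that the Bessel walk started at `1` does not return to `0` up to time `n`. -/
noncomputable def survival (s : ℝ) (n : ℕ) : ℝ :=
  killedExp s n fun x => if x = 0 then 0 else 1

/-- Mass is lost only by a downward step from height `1`. -/
theorem killedStep_survival (s : ℝ) : killedStep s (fun x => if x = 0 then 0 else 1) =
    (fun x => if x = 0 then 0 else 1) - (1 - upProb s 1) • Pi.single 1 1 := by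
  ext x
  rcases x with _ | _ | x
  · simp [killedStep_zero]
  · simp [killedStep_succ]
  · rw [killedStep_succ]
    simp

theorem survival_succ (s : ℝ) (n : ℕ) : survival s (n + 1) =
    survival s n - (1 - upProb s 1) * killedExp s n (Pi.single 1 1) := by
  rw [survival, killedExp_succ, killedStep_survival, map_sub, map_smul, smul_eq_mul, survival]

theorem antitone_survival {s : ℝ} (hs : -1 < s) : Antitone (survival s) := by
  refine antitone_nat_of_succ_le fun n => ?_
  rw [survival_succ]
  have h1 := upProb_le hs one_ne_zero
  have h2 : 0 ≤ killedExp s n (Pi.single 1 1) :=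
    killedExp_nonneg hs n (Pi.single_nonneg.2 zero_le_one)
  have := mul_nonneg (by linarith : 0 ≤ 1 - upProb s 1) h2
  linarith

/-- The function `y ↦ (max y ε) ^ (-κ)` in the variable `t = exp (-y)`. -/
noncomputable def truncPow (κ ε t : ℝ) : ℝ :=
  if t ≤ 0 then 0 else (max (-Real.log t) ε) ^ (-κ)

theorem continuousOn_truncPow {κ ε : ℝ} (hκ : 0 < κ) (hε : 0 < ε) :
    ContinuousOn (truncPow κ ε) (Set.Icc 0 1) := by
  intro t ht
  rcases ht.1.eq_or_lt with h0 | h0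
  · rw [← h0]
    have hz : truncPow κ ε 0 = 0 := by simp [truncPow]
    rw [ContinuousWithinAt, hz]
    have h1 : Tendsto (fun t => (max (-Real.log t) ε) ^ (-κ)) (𝓝[>] 0) (𝓝 0) := by
      refine (tendsto_rpow_neg_atTop hκ).comp ?_
      refine tendsto_atTop_mono (fun t => le_max_left _ _) ?_
      exact tendsto_neg_atBot_atTop.comp Real.tendsto_log_nhdsGT_zero
    have h2 : Tendsto (truncPow κ ε) (𝓝[>] 0) (𝓝 0) := by
      refine h1.congr' ?_
      filter_upwards [self_mem_nhdsWithin] with t ht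
      rw [truncPow, if_neg (not_le.2 ht)]
    have h3 : Tendsto (truncPow κ ε) (𝓝[≥] 0) (𝓝 0) := by
      rw [← Set.Ioi_insert, nhdsWithin_insert, tendsto_sup]
      refine ⟨?_, h2⟩
      rw [tendsto_pure_left]
      intro s hs
      rw [hz]
      exact mem_of_mem_nhds hs
    exact h3.mono_left (nhdsWithin_mono _ fun t ht => ht.1)
  · refine ContinuousAt.continuousWithinAt ?_
    have h1 : ContinuousAt (fun t => (max (-Real.log t) ε) ^ (-κ)) t := by
      refine ContinuousAt.rpow_const ?_ (Or.inl ?_)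
      · exact (Real.continuousAt_log h0.ne').neg.max continuousAt_const
      · exact (hε.trans_le (le_max_right _ _)).ne'
    refine h1.congr ?_
    filter_upwards [lt_mem_nhds h0] with t ht
    rw [truncPow, if_neg (not_le.2 ht)]

theorem truncPow_exp (κ ε y : ℝ) : truncPow κ ε (Real.exp (-y)) = (max y ε) ^ (-κ) := by
  rw [truncPow, if_neg (not_le.2 (Real.exp_pos _)), Real.log_exp, neg_neg]

/-- The constant does not depend on `ε`. Through the Gaussian limit with `θ = 1` this gives the
lower bound `c₀`, uniform in the truncation, which makes the final limit positive. -/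
theorem exp_le_truncPow {κ ε y : ℝ} (hκ : 0 < κ) (hε : 0 < ε) (hε' : ε ≤ 1) (hy : 0 ≤ y) :
    (κ ^ κ * Real.exp 1)⁻¹ * Real.exp (-y) ≤ truncPow κ ε (Real.exp (-y)) := by
  rw [truncPow_exp]
  have h1 : max y ε ≤ y + 1 := max_le (by linarith) (by linarith)
  have h2 : (y + 1) ^ (-κ) ≤ (max y ε) ^ (-κ) :=
    Real.rpow_le_rpow_of_nonpos (hε.trans_le (le_max_right _ _)) h1 (by linarith)
  refine le_trans ?_ h2
  have h3 : (y + 1) ^ κ ≤ κ ^ κ * Real.exp 1 * Real.exp y := by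
    have h4 : y + 1 ≤ κ * Real.exp ((y + 1) / κ) := by
      have h5 := Real.add_one_le_exp ((y + 1) / κ)
      have h6 : κ * ((y + 1) / κ) ≤ κ * Real.exp ((y + 1) / κ) :=
        mul_le_mul_of_nonneg_left (by linarith) hκ.le
      have e : κ * ((y + 1) / κ) = y + 1 := by field_simp
      linarith
    have h7 := Real.rpow_le_rpow (by linarith) h4 hκ.le
    rw [Real.mul_rpow hκ.le (Real.exp_pos _).le, ← Real.exp_mul] at h7
    refine h7.trans (le_of_eq ?_)
    have e : (y + 1) / κ * κ = 1 + y := by field_simp; ring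
    rw [e, Real.exp_add, mul_assoc]
  have h8 : 0 < (y + 1) ^ κ := Real.rpow_pos_of_pos (by linarith) _
  rw [Real.rpow_neg (by linarith), Real.exp_neg, ← mul_inv]
  exact inv_anti₀ h8 h3

/-- Since `h x` is asymptotic to `η * x ^ (2 * κ)`, the constant `1` is close to `η⁻¹ * k ^ (-κ) * h
x * (x ^ 2 / k) ^ (-κ)` for large `x`. Truncating the singular power at level `ε'` makes it an
admissible continuous test function, and the discrepancy at heights with `x ^ 2 ≤ ε' * k` is small
in block sums. -/
theorem exists_tendsto_survival {s : ℝ} (hs : -1 < s) : ∃ L > 0,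
    Tendsto (fun n : ℕ => (n : ℝ) ^ ((s + 1) / 2) * survival s n) atTop (𝓝 L) := by
  have hs1 : 0 < s + 1 := by linarith
  set κ : ℝ := (s + 1) / 2 with hκdef
  have hκ : 0 < κ := by positivity
  have h2κ : s + 1 = 2 * κ := by rw [hκdef]; ring
  obtain ⟨C, δ, hC, hδ, hnear⟩ := exists_sum_killedExp_near_zero_le hs
  obtain ⟨c₁, C₂, hc₁, hC₂, hbd⟩ := exists_harmonic_bounds hs
  obtain ⟨c, hc0, hc⟩ := tendsto_harmonicIncr hs
  have hlim := tendsto_harmonic_of_incr hs hc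
  set η : ℝ := c / (s + 1) with hη
  have hη0 : 0 < η := div_pos hc0 hs1
  set c₀ : ℝ := η⁻¹ * ((κ ^ κ * Real.exp 1)⁻¹ * (1 + 2 * 1) ^ (-((s + 3) / 2))) with hc₀
  have hc₀0 : 0 < c₀ := by positivity
  refine exists_tendsto_of_antitone_of_sums (antitone_survival hs) hκ hc₀0 fun ε hε => ?_
  -- choice of the truncation level
  obtain ⟨ε', hε'0, hε'1, hε'⟩ : ∃ ε', 0 < ε' ∧ ε' ≤ 1 ∧
      (1 + η⁻¹ * C₂) * (C * ε' ^ δ) ≤ ε / 3 := by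
    have h1 : Tendsto (fun t : ℝ => (1 + η⁻¹ * C₂) * (C * t ^ δ)) (𝓝[>] 0)
        (𝓝 ((1 + η⁻¹ * C₂) * (C * 0 ^ δ))) := by
      refine ((Tendsto.rpow_const ?_ (Or.inr hδ.le)).const_mul C).const_mul _
      exact tendsto_id.mono_left nhdsWithin_le_nhds
    rw [Real.zero_rpow hδ.ne', mul_zero, mul_zero] at h1
    have h2 := h1.eventually_le_const (by positivity : 0 < ε / 3)
    have h3 : ∀ᶠ t : ℝ in 𝓝[>] 0, t ∈ Set.Ioc 0 1 := Ioc_mem_nhdsGT zero_lt_one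
    obtain ⟨t, h2, h3⟩ := (h2.and h3).exists
    exact ⟨t, h3.1, h3.2, h2⟩
  set Λ : ℕ → ℝ := fun k => killedExp s k fun x =>
    harmonic s x * truncPow κ ε' (Real.exp (-((x : ℝ) ^ 2 / k))) with hΛ
  obtain ⟨l, hl⟩ := exists_tendsto_killedExp_comp_exp hs (continuousOn_truncPow hκ hε'0)
  have hlΛ : Tendsto Λ atTop (𝓝 l) := hl
  refine ⟨η⁻¹ * l, ?_, ?_⟩
  · rw [hc₀]
    refine mul_le_mul_of_nonneg_left ?_ (by positivity)
    refine le_of_tendsto_of_tendsto'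
      ((tendsto_killedExp_gaussian hs one_pos).const_mul (κ ^ κ * Real.exp 1)⁻¹) hlΛ fun k => ?_
    rw [← smul_eq_mul, ← map_smul]
    refine killedExp_mono hs k fun x => ?_
    simp only [Pi.smul_apply, smul_eq_mul]
    have h1 := exp_le_truncPow hκ hε'0 hε'1 (by positivity : 0 ≤ (x : ℝ) ^ 2 / k)
    have e1 : (1 : ℝ) / k * (x : ℝ) ^ 2 = (x : ℝ) ^ 2 / k := by ring
    rw [e1]
    have := mul_le_mul_of_nonneg_left h1 (harmonic_nonneg hs x)
    linarith
  -- the harmonic function is asymptotically a power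
  have hrel : ∀ᶠ x : ℕ in atTop, |1 - η⁻¹ * (harmonic s x / (x : ℝ) ^ (s + 1))| ≤
      ε / 3 * (c₁ * ε' ^ κ) := by
    have h1 := (hlim.const_mul η⁻¹).const_sub 1
    rw [inv_mul_cancel₀ hη0.ne', sub_self] at h1
    have h2 := h1.abs
    rw [abs_zero] at h2
    exact h2.eventually_le_const (by positivity)
  obtain ⟨X, hX⟩ := eventually_atTop.1 hrel
  -- The error away from `0` is written as a multiple of `h`, so that its expectation is explicit.
  -- This is possible as `h x ≥ c₁ * (ε' * k) ^ κ` there, which explains the factor `c₁ * ε' ^ κ` in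
  -- `hrel`.
  have hpt : ∀ᶠ k : ℕ in atTop, ∀ x : ℕ,
      |(if x = 0 then 0 else 1) - η⁻¹ * (k : ℝ) ^ (-κ) *
        (harmonic s x * truncPow κ ε' (Real.exp (-((x : ℝ) ^ 2 / k))))| ≤
      (1 + η⁻¹ * C₂) * (if x ≠ 0 ∧ (x : ℝ) ^ 2 ≤ ε' * k then 1 else 0) +
        ε / 3 * (k : ℝ) ^ (-κ) * harmonic s x := by
    filter_upwards [eventually_gt_atTop 0, eventually_ge_atTop ⌈(X : ℝ) ^ 2 / ε'⌉₊]
      with k hk hkX x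
    have hk' : (0 : ℝ) < k := by exact_mod_cast hk
    have hkX' : (X : ℝ) ^ 2 ≤ ε' * k := by
      have := Nat.ceil_le.1 hkX
      rw [div_le_iff₀ hε'0] at this
      linarith
    rcases Nat.eq_zero_or_pos x with rfl | hx
    · simp [harmonic_zero]
    have hx' : (0 : ℝ) < x := by exact_mod_cast hx
    have hH := harmonic_pos hs hx.ne'
    have hkκ : 0 < (k : ℝ) ^ (-κ) := Real.rpow_pos_of_pos hk' _
    have hxκ : (x : ℝ) ^ (s + 1) = ((x : ℝ) ^ 2) ^ κ := by
      rw [h2κ, Real.rpow_mul hx'.le, Real.rpow_two]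
    rw [truncPow_exp, if_neg hx.ne']
    by_cases hcase : (x : ℝ) ^ 2 ≤ ε' * k
    · rw [if_pos ⟨hx.ne', hcase⟩, mul_one]
      have hmax : max ((x : ℝ) ^ 2 / k) ε' = ε' := max_eq_right (by rwa [div_le_iff₀ hk'])
      rw [hmax]
      have h1 : harmonic s x * ε' ^ (-κ) * (k : ℝ) ^ (-κ) ≤ C₂ := by
        have h2 : harmonic s x ≤ C₂ * (ε' * k) ^ κ := by
          refine (hbd x hx.ne').2.trans ?_
          rw [hxκ]
          gcongr
        have h3 : (ε' * k) ^ κ * (ε' ^ (-κ) * (k : ℝ) ^ (-κ)) = 1 := by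
          rw [← Real.mul_rpow hε'0.le hk'.le, ← Real.rpow_add (by positivity), add_neg_cancel,
            Real.rpow_zero]
        have h4 : 0 < ε' ^ (-κ) := Real.rpow_pos_of_pos hε'0 _
        calc harmonic s x * ε' ^ (-κ) * (k : ℝ) ^ (-κ)
            ≤ C₂ * (ε' * k) ^ κ * ε' ^ (-κ) * (k : ℝ) ^ (-κ) := by gcongr
          _ = C₂ * ((ε' * k) ^ κ * (ε' ^ (-κ) * (k : ℝ) ^ (-κ))) := by ring
          _ = C₂ := by rw [h3, mul_one]
      have h5 : 0 ≤ η⁻¹ * (k : ℝ) ^ (-κ) * (harmonic s x * ε' ^ (-κ)) := by positivity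
      have h6 : η⁻¹ * (k : ℝ) ^ (-κ) * (harmonic s x * ε' ^ (-κ)) ≤ η⁻¹ * C₂ := by
        calc _ = η⁻¹ * (harmonic s x * ε' ^ (-κ) * (k : ℝ) ^ (-κ)) := by ring
          _ ≤ _ := mul_le_mul_of_nonneg_left h1 (by positivity)
      have h7 : 0 ≤ ε / 3 * (k : ℝ) ^ (-κ) * harmonic s x := by positivity
      have h8 : 0 ≤ η⁻¹ * C₂ := by positivity
      refine abs_le.2 ⟨?_, ?_⟩ <;> linarith
    · rw [if_neg (fun h => hcase h.2), mul_zero, zero_add]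
      have hcase' := not_le.1 hcase
      have hxX : X ≤ x := by
        have : (X : ℝ) ^ 2 ≤ (x : ℝ) ^ 2 := by linarith
        exact_mod_cast (pow_le_pow_iff_left₀ (by positivity) hx'.le two_ne_zero).1 this
      have hmax : max ((x : ℝ) ^ 2 / k) ε' = (x : ℝ) ^ 2 / k :=
        max_eq_left (by rw [le_div_iff₀ hk']; exact hcase'.le)
      have e1 : η⁻¹ * (k : ℝ) ^ (-κ) * (harmonic s x * ((x : ℝ) ^ 2 / k) ^ (-κ)) =
          η⁻¹ * (harmonic s x / (x : ℝ) ^ (s + 1)) := by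
        have h1 : 0 < (k : ℝ) ^ κ := Real.rpow_pos_of_pos hk' _
        have h2 : 0 < ((x : ℝ) ^ 2) ^ κ := Real.rpow_pos_of_pos (by positivity) _
        rw [hxκ, Real.div_rpow (by positivity) hk'.le, Real.rpow_neg hk'.le,
          Real.rpow_neg (by positivity)]
        field_simp
      rw [hmax, e1]
      refine (hX x hxX).trans ?_
      rw [mul_assoc]
      refine mul_le_mul_of_nonneg_left ?_ (by positivity)
      calc c₁ * ε' ^ κ = (k : ℝ) ^ (-κ) * (c₁ * (ε' * k) ^ κ) := by
            rw [Real.mul_rpow hε'0.le hk'.le, Real.rpow_neg hk'.le]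
            have h1 : 0 < (k : ℝ) ^ κ := Real.rpow_pos_of_pos hk' _
            field_simp
        _ ≤ (k : ℝ) ^ (-κ) * (c₁ * ((x : ℝ) ^ 2) ^ κ) := by gcongr
        _ ≤ (k : ℝ) ^ (-κ) * harmonic s x := by
          rw [← hxκ]
          exact mul_le_mul_of_nonneg_left (hbd x hx.ne').1 hkκ.le
  -- integrate and sum over blocks
  have hΛev : ∀ᶠ k : ℕ in atTop, |Λ k - l| ≤ ε / 3 * η := by
    have h1 := (hlΛ.sub_const l).abs
    rw [sub_self, abs_zero] at h1
    exact h1.eventually_le_const (by positivity)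
  obtain ⟨N, hN⟩ := eventually_atTop.1 (hpt.and hΛev)
  filter_upwards [eventually_ge_atTop N, eventually_ne_atTop 0] with n hnN hn0 m hnm hm
  have hn' : (0 : ℝ) < n := by positivity
  have hterm : ∀ k ∈ Finset.Ico n m, |survival s k - η⁻¹ * l * (k : ℝ) ^ (-κ)| ≤
      (1 + η⁻¹ * C₂) * killedExp s k (fun x => if x ≠ 0 ∧ (x : ℝ) ^ 2 ≤ ε' * k then 1 else 0) +
        2 * (ε / 3) * (n : ℝ) ^ (-κ) := by
    intro k hk
    have hkn : n ≤ k := (Finset.mem_Ico.1 hk).1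
    obtain ⟨h1, h2⟩ := hN k (hnN.trans hkn)
    have h3 : |survival s k - η⁻¹ * (k : ℝ) ^ (-κ) * Λ k| ≤
        (1 + η⁻¹ * C₂) * killedExp s k (fun x => if x ≠ 0 ∧ (x : ℝ) ^ 2 ≤ ε' * k then 1 else 0) +
          ε / 3 * (k : ℝ) ^ (-κ) := by
      have e1 : survival s k - η⁻¹ * (k : ℝ) ^ (-κ) * Λ k =
          killedExp s k ((fun x : ℕ => if x = 0 then (0 : ℝ) else 1) - (η⁻¹ * (k : ℝ) ^ (-κ)) •
            fun x : ℕ => harmonic s x * truncPow κ ε' (Real.exp (-((x : ℝ) ^ 2 / k)))) := by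
        rw [map_sub, map_smul, smul_eq_mul]; rfl
      rw [e1]
      refine (abs_killedExp_le hs k (ψ := (1 + η⁻¹ * C₂) •
        (fun x : ℕ => if x ≠ 0 ∧ (x : ℝ) ^ 2 ≤ ε' * k then (1 : ℝ) else 0) +
          (ε / 3 * (k : ℝ) ^ (-κ)) • harmonic s) fun x => h1 x).trans (le_of_eq ?_)
      rw [map_add, map_smul, map_smul, killedExp_harmonic, smul_eq_mul, smul_eq_mul, mul_one]
    have hk' : (n : ℝ) ≤ k := by exact_mod_cast hkn
    have hkκ : (k : ℝ) ^ (-κ) ≤ (n : ℝ) ^ (-κ) :=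
      Real.rpow_le_rpow_of_nonpos hn' hk' (by linarith)
    have hkκ0 : 0 ≤ (k : ℝ) ^ (-κ) := Real.rpow_nonneg (by linarith) _
    have h4 : |η⁻¹ * (k : ℝ) ^ (-κ) * Λ k - η⁻¹ * l * (k : ℝ) ^ (-κ)| ≤ ε / 3 * (k : ℝ) ^ (-κ) := by
      have e2 : η⁻¹ * (k : ℝ) ^ (-κ) * Λ k - η⁻¹ * l * (k : ℝ) ^ (-κ) =
          η⁻¹ * (k : ℝ) ^ (-κ) * (Λ k - l) := by ring
      rw [e2, abs_mul, abs_of_nonneg (by positivity)]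
      calc _ ≤ η⁻¹ * (k : ℝ) ^ (-κ) * (ε / 3 * η) := by gcongr
        _ = _ := by field_simp
    have h5 := abs_sub_le (survival s k) (η⁻¹ * (k : ℝ) ^ (-κ) * Λ k) (η⁻¹ * l * (k : ℝ) ^ (-κ))
    have h6 := mul_le_mul_of_nonneg_left hkκ (by positivity : 0 ≤ ε / 3)
    linarith
  have hnn : ∀ k, 0 ≤ killedExp s k
      (fun x => if x ≠ 0 ∧ (x : ℝ) ^ 2 ≤ ε' * k then (1 : ℝ) else 0) := fun k =>
    killedExp_nonneg hs k fun x => by dsimp only [Pi.zero_apply]; split_ifs <;> norm_num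
  have hcardle : ((Finset.Ico n m).card : ℝ) ≤ n := by
    rw [Nat.card_Ico]; exact_mod_cast (by omega : m - n ≤ n)
  have e1 : (n : ℝ) ^ (1 - κ) = n * (n : ℝ) ^ (-κ) := by
    rw [sub_eq_add_neg, Real.rpow_add hn', Real.rpow_one]
  have hnκ : 0 < (n : ℝ) ^ (-κ) := Real.rpow_pos_of_pos hn' _
  calc |∑ k ∈ Finset.Ico n m, (survival s k - η⁻¹ * l * (k : ℝ) ^ (-κ))|
      ≤ ∑ k ∈ Finset.Ico n m, |survival s k - η⁻¹ * l * (k : ℝ) ^ (-κ)| :=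
        Finset.abs_sum_le_sum_abs _ _
    _ ≤ _ := Finset.sum_le_sum hterm
    _ = (1 + η⁻¹ * C₂) * ∑ k ∈ Finset.Ico n m,
          killedExp s k (fun x => if x ≠ 0 ∧ (x : ℝ) ^ 2 ≤ ε' * k then 1 else 0) +
        (Finset.Ico n m).card * (2 * (ε / 3) * (n : ℝ) ^ (-κ)) := by
      rw [Finset.sum_add_distrib, ← Finset.mul_sum, Finset.sum_const, nsmul_eq_mul]
    _ ≤ (1 + η⁻¹ * C₂) * ∑ k ∈ Finset.Ico n (2 * n),
          killedExp s k (fun x => if x ≠ 0 ∧ (x : ℝ) ^ 2 ≤ ε' * k then 1 else 0) +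
        n * (2 * (ε / 3) * (n : ℝ) ^ (-κ)) := by
      refine add_le_add (mul_le_mul_of_nonneg_left (Finset.sum_le_sum_of_subset_of_nonneg
        (Finset.Ico_subset_Ico_right hm) fun k _ _ => hnn k) (by positivity)) ?_
      gcongr
    _ ≤ (1 + η⁻¹ * C₂) * (C * ε' ^ δ * (n : ℝ) ^ (1 - κ)) +
        n * (2 * (ε / 3) * (n : ℝ) ^ (-κ)) := by
      gcongr
      exact hnear ε' hε'0 n hn0
    _ = ((1 + η⁻¹ * C₂) * (C * ε' ^ δ) + 2 * (ε / 3)) * (n : ℝ) ^ (1 - κ) := by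
      rw [e1]; ring
    _ ≤ (ε / 3 + 2 * (ε / 3)) * (n : ℝ) ^ (1 - κ) := by gcongr
    _ = _ := by ring

end Survival

/-! ### Reversibility and the law of the return time. -/

section ReturnTime

open Topology

/-- The reversible measure of the Bessel walk, on the heights `1, 2, …` (indexed from `0`). -/
noncomputable def revMeas (s : ℝ) : ℕ → ℝ
  | 0 => 1
  | x + 1 => revMeas s x * (upProb s (x + 1) / (1 - upProb s (x + 2)))

theorem revMeas_pos {s : ℝ} (hs : -1 < s) (x : ℕ) : 0 < revMeas s x := by
  induction x with
  | zero => simp [revMeas]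
  | succ x ih =>
    have h1 := quarter_le_upProb s (x + 1)
    have h2 := upProb_le hs (Nat.succ_ne_zero (x + 1))
    exact mul_pos ih (div_pos (by linarith) (by linarith))

theorem revMeas_balance {s : ℝ} (hs : -1 < s) (x : ℕ) :
    revMeas s (x + 1) * (1 - upProb s (x + 2)) = revMeas s x * upProb s (x + 1) := by
  have h2 := upProb_le hs (Nat.succ_ne_zero (x + 1))
  have : 1 - upProb s (x + 2) ≠ 0 := by
    have : upProb s (x + 2) ≤ 3 / 4 := h2
    linarith
  rw [revMeas]; field_simp

/-- Detailed balance moves the downward part onto the edge below. What remains is symmetric in `f`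
and `g`, except for a boundary term at the cutoff `M`. -/
theorem sum_killedStep_mul {s : ℝ} (hs : -1 < s) {f g : ℕ → ℝ} (hf : f 0 = 0) (M : ℕ) :
    ∑ y ∈ Finset.range (M + 1), revMeas s y * (killedStep s f (y + 1) * g (y + 1)) =
      ∑ y ∈ Finset.range M, revMeas s y * upProb s (y + 1) *
        (f (y + 2) * g (y + 1) + f (y + 1) * g (y + 2)) +
        revMeas s M * upProb s (M + 1) * (f (M + 2) * g (M + 1)) := by
  have h1 : ∀ y, revMeas s y * (killedStep s f (y + 1) * g (y + 1)) =
      revMeas s y * upProb s (y + 1) * (f (y + 2) * g (y + 1)) +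
        revMeas s y * (1 - upProb s (y + 1)) * (f y * g (y + 1)) := by
    intro y; rw [killedStep_succ]; ring
  simp only [h1]
  rw [Finset.sum_add_distrib, Finset.sum_range_succ' (fun y =>
    revMeas s y * (1 - upProb s (y + 1)) * (f y * g (y + 1))), hf]
  rw [Finset.sum_range_succ]
  have h2 : ∀ y ∈ Finset.range M, revMeas s (y + 1) * (1 - upProb s (y + 1 + 1)) *
      (f (y + 1) * g (y + 1 + 1)) =
      revMeas s y * upProb s (y + 1) * (f (y + 1) * g (y + 2)) := by
    intro y _
    rw [← revMeas_balance hs y]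
  rw [Finset.sum_congr rfl h2]
  simp only [mul_add, Finset.sum_add_distrib]
  ring

theorem sum_killedStep_mul_comm {s : ℝ} (hs : -1 < s) {f g : ℕ → ℝ} (hf : f 0 = 0) (hg : g 0 = 0)
    {M : ℕ} (hfM : ∀ x > M, f x = 0) :
    ∑ y ∈ Finset.range (M + 1), revMeas s y * (killedStep s f (y + 1) * g (y + 1)) =
      ∑ y ∈ Finset.range (M + 1), revMeas s y * (f (y + 1) * killedStep s g (y + 1)) := by
  have h1 := sum_killedStep_mul hs hf (g := g) M
  have h2 := sum_killedStep_mul hs hg (g := f) M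
  rw [hfM (M + 2) (by omega)] at h1
  rw [hfM (M + 1) (by omega)] at h2
  have h3 : ∑ y ∈ Finset.range (M + 1), revMeas s y * (f (y + 1) * killedStep s g (y + 1)) =
      ∑ y ∈ Finset.range (M + 1), revMeas s y * (killedStep s g (y + 1) * f (y + 1)) :=
    Finset.sum_congr rfl fun y _ => by ring
  rw [h1, h3, h2, zero_mul, mul_zero, mul_zero, mul_zero]
  congr 1
  refine Finset.sum_congr rfl fun y _ => by ring

theorem killedStep_pow_single_eq_zero (s : ℝ) (n : ℕ) {x : ℕ} (hx : x = 0 ∨ n + 1 < x) :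
    (killedStep s ^ n) (Pi.single 1 1) x = 0 := by
  induction n generalizing x with
  | zero =>
    rw [pow_zero, Module.End.one_apply, Pi.single_apply, if_neg (by omega)]
  | succ n ih =>
    rw [pow_succ', Module.End.mul_apply]
    cases x with
    | zero => exact killedStep_zero _ _
    | succ x =>
      rw [killedStep_succ, ih (Or.inr (by omega)), ih (Or.inr (by omega))]
      simp

/-- Self-adjointness moves the operator from one factor to the other, one power at a time. The
normalization `revMeas s 0 = 1` identifies the final pairing with the value at height `1`, and
finite propagation speed keeps the support below the cutoff. -/
theorem sum_killedStep_pow_mul {s : ℝ} (hs : -1 < s) (i j : ℕ) {M : ℕ} (hM : i + j < M) :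
    ∑ y ∈ Finset.range (M + 1), revMeas s y * ((killedStep s ^ i) (Pi.single 1 1) (y + 1) *
      (killedStep s ^ j) (Pi.single 1 1) (y + 1)) =
      (killedStep s ^ (i + j)) (Pi.single 1 1) 1 := by
  induction i generalizing j with
  | zero =>
    rw [Finset.sum_eq_single 0]
    · simp [revMeas]
    · intro y _ hy
      rw [pow_zero, Module.End.one_apply, Pi.single_apply, if_neg (by omega)]
      simp
    · simp
  | succ i ih =>
    have h := sum_killedStep_mul_comm hs (f := (killedStep s ^ i) (Pi.single 1 1))
      (g := (killedStep s ^ j) (Pi.single 1 1)) (killedStep_pow_single_eq_zero s i (Or.inl rfl))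
      (killedStep_pow_single_eq_zero s j (Or.inl rfl)) (M := M)
      fun x hx => killedStep_pow_single_eq_zero s i (Or.inr (by omega))
    rw [pow_succ', Module.End.mul_apply, h]
    have h2 := ih (j + 1) (by omega)
    have e : (killedStep s ^ (j + 1)) (Pi.single 1 1) =
        killedStep s ((killedStep s ^ j) (Pi.single 1 1)) := by
      rw [pow_succ', Module.End.mul_apply]
    rw [e] at h2
    rw [h2, show i + (j + 1) = i + 1 + j by ring]

theorem killedStep_sq_le {s : ℝ} (hs : -1 < s) (f : ℕ → ℝ) (x : ℕ) :
    killedStep s f x ^ 2 ≤ killedStep s (fun x => f x ^ 2) x := by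
  cases x with
  | zero => simp [killedStep_zero]
  | succ x =>
    rw [killedStep_succ, killedStep_succ]
    have h1 := quarter_le_upProb s (x + 1)
    have h2 := upProb_le hs (Nat.succ_ne_zero x)
    have h3 : 0 ≤ upProb s (x + 1) * (1 - upProb s (x + 1)) * (f (x + 2) - f x) ^ 2 :=
      mul_nonneg (mul_nonneg (by linarith) (by linarith)) (sq_nonneg _)
    nlinarith

/-- The probability of being at `1` at time `2 * j` is the squared norm of the `j`-th iterate in the
space weighted by `revMeas`, and the killed operator is a contraction there. The contraction follows
from `(K v) ^ 2 ≤ K (v ^ 2)`, self-adjointness and the fact that `K` does not increase the indicator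
of nonzero heights. -/
theorem antitone_killedExp_single {s : ℝ} (hs : -1 < s) :
    Antitone fun j : ℕ => killedExp s (2 * j) (Pi.single 1 1) := by
  refine antitone_nat_of_succ_le fun j => ?_
  set v : ℕ → ℝ := (killedStep s ^ j) (Pi.single 1 1) with hv
  have h1 := sum_killedStep_pow_mul hs j j (M := 2 * j + 3) (by omega)
  have h2 := sum_killedStep_pow_mul hs (j + 1) (j + 1) (M := 2 * j + 3) (by omega)
  have e1 : (killedStep s ^ (j + 1)) (Pi.single 1 1) = killedStep s v := by
    rw [pow_succ', Module.End.mul_apply]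
  rw [e1] at h2
  have e2 : j + 1 + (j + 1) = 2 * (j + 1) := by ring
  rw [e2] at h2
  rw [← two_mul] at h1
  rw [killedExp_apply, killedExp_apply, ← h1, ← h2]
  have h3 := sum_killedStep_mul_comm hs (f := fun x => v x ^ 2)
    (g := fun x => if x = 0 then 0 else 1)
    (by simp [hv, killedStep_pow_single_eq_zero]) (if_pos rfl) (M := 2 * j + 3)
    fun x hx => by simp [hv, killedStep_pow_single_eq_zero s j (Or.inr (by omega : j + 1 < x))]
  calc ∑ y ∈ Finset.range (2 * j + 3 + 1), revMeas s y * (killedStep s v (y + 1) *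
        killedStep s v (y + 1))
      ≤ ∑ y ∈ Finset.range (2 * j + 3 + 1), revMeas s y *
        (killedStep s (fun x => v x ^ 2) (y + 1) * if y + 1 = 0 then 0 else 1) := by
        refine Finset.sum_le_sum fun y _ => mul_le_mul_of_nonneg_left ?_ (revMeas_pos hs y).le
        rw [if_neg (Nat.succ_ne_zero y), mul_one, ← sq]
        exact killedStep_sq_le hs v (y + 1)
    _ = _ := h3
    _ ≤ _ := by
        refine Finset.sum_le_sum fun y _ => mul_le_mul_of_nonneg_left ?_ (revMeas_pos hs y).le
        rw [killedStep_survival, ← sq]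
        refine mul_le_of_le_one_right (sq_nonneg _) ?_
        simp only [Pi.sub_apply, Pi.smul_apply, smul_eq_mul, if_neg (Nat.succ_ne_zero y)]
        have h4 := upProb_le hs one_ne_zero
        have h5 : (0 : ℝ) ≤ (Pi.single 1 1 : ℕ → ℝ) (y + 1) :=
          (Pi.single_nonneg.2 zero_le_one : (0 : ℕ → ℝ) ≤ Pi.single 1 1) (y + 1)
        have := mul_nonneg (by linarith : 0 ≤ 1 - upProb s 1) h5
        linarith

/-- Parity: at time `n` the walk started from `1` sits at a height congruent to `n + 1` modulo `2`,
and `φ` vanishes at those heights. -/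
theorem killedExp_single_of_odd (s : ℝ) (n : ℕ) : ∀ φ : ℕ → ℝ,
    (∀ x, x % 2 = (n + 1) % 2 → φ x = 0) → killedExp s n φ = 0 := by
  induction n with
  | zero => intro φ h; rw [killedExp_zero]; exact h 1 rfl
  | succ n ih =>
    intro φ h
    rw [killedExp_succ]
    refine ih _ fun x hx => ?_
    cases x with
    | zero => exact killedStep_zero _ _
    | succ x =>
      rw [killedStep_succ, h (x + 2) (by omega), h x (by omega)]
      simp

theorem sub_le_rpow_neg_succ {κ x : ℝ} (hκ : 0 < κ) (hx : 0 < x) :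
    κ * (x + 1) ^ (-(κ + 1)) ≤ x ^ (-κ) - (x + 1) ^ (-κ) ∧
      x ^ (-κ) - (x + 1) ^ (-κ) ≤ κ * x ^ (-(κ + 1)) := by
  have hd : ∀ y ∈ Set.Icc x (x + 1),
      HasDerivWithinAt (fun y : ℝ => y ^ (-κ)) (-κ * y ^ (-κ - 1)) (Set.Icc x (x + 1)) y :=
    fun y hy => (Real.hasDerivAt_rpow_const (Or.inl (hx.trans_le hy.1).ne')).hasDerivWithinAt
  obtain ⟨y, hy, hy'⟩ := exists_hasDerivAt_eq_slope (fun y : ℝ => y ^ (-κ))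
    (fun y => -κ * y ^ (-κ - 1)) (by linarith : x < x + 1)
    (fun y hy => (hd y hy).continuousWithinAt)
    (fun y hy => Real.hasDerivAt_rpow_const (Or.inl (hx.trans hy.1).ne'))
  have e : -κ - 1 = -(κ + 1) := by ring
  rw [e] at hy'
  have h1 : x ^ (-κ) - (x + 1) ^ (-κ) = κ * y ^ (-(κ + 1)) := by
    have : x + 1 - x = 1 := by ring
    rw [this, div_one] at hy'
    linarith
  rw [h1]
  constructor
  · refine mul_le_mul_of_nonneg_left ?_ hκ.le
    exact Real.rpow_le_rpow_of_nonpos (hx.trans hy.1) hy.2.le (by linarith)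
  · refine mul_le_mul_of_nonneg_left ?_ hκ.le
    exact Real.rpow_le_rpow_of_nonpos hx hy.1.le (by linarith)

/-- The probability that the Bessel walk started at `0` first returns to `0` at time `2 * (j + 1)`
is regularly varying in `j`. -/
theorem exists_tendsto_returnTime {s : ℝ} (hs : -1 < s) : ∃ L > 0,
    Tendsto (fun j : ℕ => (j : ℝ) ^ ((s + 3) / 2) *
      ((1 - upProb s 1) * killedExp s (2 * j) (Pi.single 1 1))) atTop (𝓝 L) := by
  have hs1 : 0 < s + 1 := by linarith
  set κ : ℝ := (s + 1) / 2 with hκdef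
  have hκ : 0 < κ := by positivity
  obtain ⟨L, hL0, hL⟩ := exists_tendsto_survival hs
  rw [← hκdef] at hL
  have hq : 0 ≤ 1 - upProb s 1 := by linarith [upProb_le hs one_ne_zero]
  have hanti : Antitone fun j : ℕ => (1 - upProb s 1) * killedExp s (2 * j) (Pi.single 1 1) :=
    fun i j hij => mul_le_mul_of_nonneg_left (antitone_killedExp_single hs hij) hq
  set b : ℕ → ℝ := fun j => (1 - upProb s 1) * killedExp s (2 * j) (Pi.single 1 1) with hb
  -- Two steps are taken together because the odd-time increment vanishes by parity; block sums of
  -- `b` thus telescope to differences of survival probabilities.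
  have hbs : ∀ j, b j = survival s (2 * j) - survival s (2 * (j + 1)) := by
    intro j
    have e : 2 * (j + 1) = 2 * j + 1 + 1 := by ring
    rw [e, survival_succ, survival_succ, killedExp_single_of_odd s (2 * j + 1)]
    · simp only [hb]; ring
    · intro x hx
      rw [Pi.single_apply, if_neg (by omega)]
  have hsum : ∀ n m, n ≤ m → ∑ k ∈ Finset.Ico n m, b k = survival s (2 * n) - survival s (2 * m) := by
    intro n m hnm
    simp only [hbs]
    have := Finset.sum_Ico_sub (fun k => -survival s (2 * k)) hnm
    rw [← neg_sub_neg, ← this]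
    exact Finset.sum_congr rfl fun k _ => by ring
  have e3 : (s + 3) / 2 = κ + 1 := by rw [hκdef]; ring
  rw [e3]
  set A : ℝ := L * 2 ^ (-κ) with hA
  have hA0 : 0 < A := by positivity
  -- The survival probability at time `2 * n` is asymptotic to `A * n ^ (-κ)`, so its negative
  -- discrete derivative should be `κ * A * n ^ (-(κ + 1))`. This time the block constant is the
  -- same for every `ε`.
  refine exists_tendsto_of_antitone_of_sums hanti (by linarith) (c₀ := κ * A) (by positivity)
    fun ε hε => ⟨κ * A, le_rfl, ?_⟩
  have hL2 : ∀ᶠ n : ℕ in atTop, |survival s (2 * n) - A * (n : ℝ) ^ (-κ)| ≤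
      ε / 3 * (n : ℝ) ^ (-κ) := by
    have h1 : Tendsto (fun n : ℕ => 2 * n) atTop atTop :=
      tendsto_id.const_mul_atTop' (by norm_num)
    have h2 := ((hL.comp h1).const_mul (2 ^ (-κ))).sub_const A
    have e : (2 : ℝ) ^ (-κ) * L - A = 0 := by rw [hA]; ring
    rw [e] at h2
    have h3 := h2.abs
    rw [abs_zero] at h3
    filter_upwards [h3.eventually_le_const (by positivity : 0 < ε / 3), eventually_gt_atTop 0]
      with n hn hn0
    have hn' : (0 : ℝ) < n := by exact_mod_cast hn0
    simp only [Function.comp] at hn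
    push_cast at hn
    rw [Real.mul_rpow (by norm_num) hn'.le] at hn
    have h4 : 0 < (n : ℝ) ^ (-κ) := Real.rpow_pos_of_pos hn' _
    have e1 : survival s (2 * n) - A * (n : ℝ) ^ (-κ) = (n : ℝ) ^ (-κ) *
        (2 ^ (-κ) * (2 ^ κ * (n : ℝ) ^ κ * survival s (2 * n)) - A) := by
      have e5 : (n : ℝ) ^ (-κ) * (n : ℝ) ^ κ = 1 := by
        rw [← Real.rpow_add hn', neg_add_cancel, Real.rpow_zero]
      have e6 : (2 : ℝ) ^ (-κ) * 2 ^ κ = 1 := by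
        rw [← Real.rpow_add two_pos, neg_add_cancel, Real.rpow_zero]
      linear_combination (-((2 : ℝ) ^ (-κ) * 2 ^ κ * survival s (2 * n))) * e5 -
        survival s (2 * n) * e6
    rw [e1, abs_mul, abs_of_pos h4, mul_comm]
    exact mul_le_mul_of_nonneg_right hn h4.le
  obtain ⟨N, hN⟩ := eventually_atTop.1 hL2
  filter_upwards [eventually_ge_atTop N, eventually_gt_atTop 0,
    eventually_ge_atTop ⌈3 * (κ * A) / ε⌉₊] with n hnN hn0 hnε m hnm hm
  have hn' : (0 : ℝ) < n := by exact_mod_cast hn0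
  have hnm' : (n : ℝ) ≤ m := by exact_mod_cast hnm
  have hnε' : κ * A ≤ ε / 3 * n := by
    have := Nat.ceil_le.1 hnε
    rw [div_le_iff₀ hε] at this
    linarith
  rw [Finset.sum_sub_distrib, hsum n m hnm]
  have e4 : (1 : ℝ) - (κ + 1) = -κ := by ring
  rw [e4]
  have hpow : ∀ k : ℕ, n ≤ k → κ * ((k : ℝ) + 1) ^ (-(κ + 1)) ≤
        (k : ℝ) ^ (-κ) - ((k + 1 : ℕ) : ℝ) ^ (-κ) ∧
      (k : ℝ) ^ (-κ) - ((k + 1 : ℕ) : ℝ) ^ (-κ) ≤ κ * (k : ℝ) ^ (-(κ + 1)) := by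
    intro k hk
    push_cast
    exact sub_le_rpow_neg_succ hκ (hn'.trans_le (by exact_mod_cast hk))
  have htel : ∀ (F : ℕ → ℝ), ∑ k ∈ Finset.Ico n m, (F k - F (k + 1)) = F n - F m := by
    intro F
    have := Finset.sum_Ico_sub (fun k => -F k) hnm
    rw [← neg_sub_neg, ← this]
    exact Finset.sum_congr rfl fun k _ => by ring
  have hup : (n : ℝ) ^ (-κ) - (m : ℝ) ^ (-κ) ≤
      ∑ k ∈ Finset.Ico n m, κ * (k : ℝ) ^ (-(κ + 1)) := by
    rw [← htel fun k : ℕ => (k : ℝ) ^ (-κ)]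
    exact Finset.sum_le_sum fun k hk => (hpow k (Finset.mem_Ico.1 hk).1).2
  have hlow : ∑ k ∈ Finset.Ico n m, κ * (k : ℝ) ^ (-(κ + 1)) ≤
      (n : ℝ) ^ (-κ) - (m : ℝ) ^ (-κ) + κ * (n : ℝ) ^ (-(κ + 1)) := by
    have h1 := htel fun k : ℕ => κ * (k : ℝ) ^ (-(κ + 1))
    have h2 : ∑ k ∈ Finset.Ico n m, κ * ((k + 1 : ℕ) : ℝ) ^ (-(κ + 1)) ≤
        (n : ℝ) ^ (-κ) - (m : ℝ) ^ (-κ) := by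
      rw [← htel fun k : ℕ => (k : ℝ) ^ (-κ)]
      refine Finset.sum_le_sum fun k hk => ?_
      have := (hpow k (Finset.mem_Ico.1 hk).1).1
      push_cast at this ⊢
      exact this
    rw [Finset.sum_sub_distrib] at h1
    have h3 : 0 ≤ κ * (m : ℝ) ^ (-(κ + 1)) :=
      mul_nonneg hκ.le (Real.rpow_nonneg (Nat.cast_nonneg _) _)
    linarith
  have hsmall : κ * A * (n : ℝ) ^ (-(κ + 1)) ≤ ε / 3 * (n : ℝ) ^ (-κ) := by
    have e5 : (n : ℝ) ^ (-κ) = n * (n : ℝ) ^ (-(κ + 1)) := by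
      rw [neg_add', Real.rpow_sub hn', Real.rpow_one]; field_simp
    have e7 := mul_le_mul_of_nonneg_right hnε' (Real.rpow_nonneg hn'.le (-(κ + 1)))
    rw [e5]
    linarith
  have hs2 : ∑ k ∈ Finset.Ico n m, κ * A * (k : ℝ) ^ (-(κ + 1)) =
      A * ∑ k ∈ Finset.Ico n m, κ * (k : ℝ) ^ (-(κ + 1)) := by
    rw [Finset.mul_sum]; exact Finset.sum_congr rfl fun k _ => by ring
  rw [hs2]
  have hup' := mul_le_mul_of_nonneg_left hup hA0.le
  have hlow' := mul_le_mul_of_nonneg_left hlow hA0.le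
  have a1 := abs_le.1 (hN n hnN)
  have a2 := abs_le.1 (hN m (hnN.trans hnm))
  have a3 : ε / 3 * (m : ℝ) ^ (-κ) ≤ ε / 3 * (n : ℝ) ^ (-κ) :=
    mul_le_mul_of_nonneg_left (Real.rpow_le_rpow_of_nonpos hn' hnm' (by linarith)) (by positivity)
  have hnκ : 0 ≤ ε / 3 * (n : ℝ) ^ (-κ) := by positivity
  refine abs_le.2 ⟨?_, ?_⟩ <;> linarith [a1.1, a1.2, a2.1, a2.2]

end ReturnTime

/-! ### Fourier representation of random walks on `ℤ^d` -/

section Fourier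

open Topology

variable {d : ℕ}

/-- The averaging operator of the random walk which jumps by `σ i` with weight `w i`. -/
def stepOp {ι : Type*} [Fintype ι] (w : ι → ℝ) (σ : ι → Fin d → ℤ) :
    Module.End ℝ ((Fin d → ℤ) → ℝ) where
  toFun h x := ∑ i, w i * h (x + σ i)
  map_add' f g := by
    ext x
    simp [mul_add, Finset.sum_add_distrib]
  map_smul' c f := by
    ext x
    simp only [Pi.smul_apply, smul_eq_mul, RingHom.id_apply, Finset.mul_sum]
    exact Finset.sum_congr rfl fun i _ => by ring

theorem stepOp_apply {ι : Type*} [Fintype ι] (w : ι → ℝ) (σ : ι → Fin d → ℤ)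
    (h : (Fin d → ℤ) → ℝ) (x : Fin d → ℤ) : stepOp w σ h x = ∑ i, w i * h (x + σ i) := rfl

/-- The exponential `x ↦ exp ((lam + i θ) · x)`. -/
noncomputable def tiltedChar (lam θ : Fin d → ℝ) (x : Fin d → ℤ) : ℂ :=
  Complex.exp (∑ i, ((lam i : ℂ) + θ i * Complex.I) * x i)

theorem tiltedChar_add (lam θ : Fin d → ℝ) (x y : Fin d → ℤ) :
    tiltedChar lam θ (x + y) = tiltedChar lam θ x * tiltedChar lam θ y := by
  rw [tiltedChar, tiltedChar, tiltedChar, ← Complex.exp_add, ← Finset.sum_add_distrib]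
  congr 1
  refine Finset.sum_congr rfl fun i _ => ?_
  rw [Pi.add_apply]
  push_cast
  ring

theorem norm_tiltedChar (lam θ : Fin d → ℝ) (x : Fin d → ℤ) :
    ‖tiltedChar lam θ x‖ = Real.exp (∑ i, lam i * x i) := by
  rw [tiltedChar, Complex.norm_exp, Complex.re_sum]
  congr 1
  refine Finset.sum_congr rfl fun i _ => ?_
  simp

theorem continuous_tiltedChar (lam : Fin d → ℝ) (x : Fin d → ℤ) :
    Continuous fun θ => tiltedChar lam θ x := by
  unfold tiltedChar
  fun_prop

/-- The fundamental cube of the dual torus. -/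
def dualCube (d : ℕ) : Set (Fin d → ℝ) := Set.univ.pi fun _ => Set.Ioc (-Real.pi) Real.pi

theorem measurableSet_dualCube : MeasurableSet (dualCube d) :=
  MeasurableSet.univ_pi fun _ => measurableSet_Ioc

theorem abs_le_pi_of_mem_dualCube {θ : Fin d → ℝ} (h : θ ∈ dualCube d) (i : Fin d) :
    |θ i| ≤ Real.pi := by
  have := h i (Set.mem_univ i)
  exact abs_le.2 ⟨this.1.le, this.2⟩

theorem integrableOn_dualCube {f : (Fin d → ℝ) → ℂ} (hf : Continuous f) :
    IntegrableOn f (dualCube d) := by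
  have h1 : IsCompact (Set.univ.pi fun _ : Fin d => Set.Icc (-Real.pi) Real.pi) :=
    isCompact_univ_pi fun _ => isCompact_Icc
  exact (hf.continuousOn.integrableOn_compact h1).mono_set
    (Set.pi_mono fun _ _ => Set.Ioc_subset_Icc_self)

theorem integral_exp_int_mul (l : ℝ) (k : ℤ) :
    ∫ θ in Set.Ioc (-Real.pi) Real.pi, Complex.exp (((l : ℂ) + θ * Complex.I) * k) =
      if k = 0 then (2 * Real.pi : ℂ) else 0 := by
  rw [← intervalIntegral.integral_of_le (by linarith [Real.pi_pos])]
  split_ifs with hk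
  · simp [hk]; ring
  · have e : ∀ θ : ℝ, Complex.exp (((l : ℂ) + θ * Complex.I) * k) =
        Complex.exp (l * k) * Complex.exp ((k * Complex.I) * θ) := by
      intro θ
      rw [← Complex.exp_add]
      congr 1
      ring
    simp only [e]
    have hc : (k : ℂ) * Complex.I ≠ 0 := mul_ne_zero (by exact_mod_cast hk) Complex.I_ne_zero
    rw [intervalIntegral.integral_const_mul, integral_exp_mul_complex hc]
    have h2 : Complex.exp (k * Complex.I * Real.pi) =
        Complex.exp (k * Complex.I * (-Real.pi : ℝ)) := by
      rw [Complex.exp_eq_exp_iff_exists_int]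
      exact ⟨k, by push_cast; ring⟩
    rw [h2]
    simp

/-- Orthogonality of characters, coordinate by coordinate. The tilt is invisible: it only multiplies
integrals that vanish, and it equals `1` at `x = 0`. -/
theorem integral_tiltedChar (lam : Fin d → ℝ) (x : Fin d → ℤ) :
    ∫ θ in dualCube d, tiltedChar lam θ x = if x = 0 then (2 * Real.pi : ℂ) ^ d else 0 := by
  have h1 : ∀ θ : Fin d → ℝ, tiltedChar lam θ x =
      ∏ i, Complex.exp (((lam i : ℂ) + θ i * Complex.I) * x i) := fun θ => Complex.exp_sum _ _
  simp only [h1, dualCube]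
  rw [volume_pi, Measure.restrict_pi_pi,
    integral_fintype_prod_eq_prod (fun i (t : ℝ) => Complex.exp (((lam i : ℂ) + t * Complex.I) * x i))]
  simp only [integral_exp_int_mul]
  split_ifs with hx
  · simp [hx]
  · obtain ⟨i, hi⟩ := Function.ne_iff.1 hx
    exact Finset.prod_eq_zero (Finset.mem_univ i) (if_neg hi)

/-- The (tilted) characteristic function of a step. -/
noncomputable def stepSymbol {ι : Type*} [Fintype ι] (w : ι → ℝ) (σ : ι → Fin d → ℤ)
    (lam θ : Fin d → ℝ) : ℂ := ∑ i, w i * tiltedChar lam θ (σ i)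

theorem continuous_stepSymbol {ι : Type*} [Fintype ι] (w : ι → ℝ) (σ : ι → Fin d → ℤ)
    (lam : Fin d → ℝ) : Continuous (stepSymbol w σ lam) :=
  continuous_finsetSum _ fun i _ => continuous_const.mul (continuous_tiltedChar lam (σ i))

/-- Translation characters diagonalize the averaging operator. The left side does not involve `lam`,
so the tilt may be chosen afterwards; this replaces a shift of contour. -/
theorem stepOp_pow_single {ι : Type*} [Fintype ι] (w : ι → ℝ) (σ : ι → Fin d → ℤ)
    (lam : Fin d → ℝ) (b : Fin d → ℤ) (j : ℕ) (a : Fin d → ℤ) :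
    (((stepOp w σ ^ j) (Pi.single b 1) a : ℝ) : ℂ) = ((2 * Real.pi : ℂ) ^ d)⁻¹ *
      ∫ θ in dualCube d, stepSymbol w σ lam θ ^ j * tiltedChar lam θ (a - b) := by
  induction j generalizing a with
  | zero =>
    simp only [pow_zero, one_mul, Module.End.one_apply]
    rw [integral_tiltedChar, Pi.single_apply]
    have h2 : (2 * Real.pi : ℂ) ^ d ≠ 0 :=
      pow_ne_zero _ (mul_ne_zero two_ne_zero (by exact_mod_cast Real.pi_ne_zero))
    by_cases h : a = b
    · rw [if_pos h, if_pos (sub_eq_zero.2 h), inv_mul_cancel₀ h2, Complex.ofReal_one]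
    · rw [if_neg h, if_neg (sub_ne_zero.2 h), mul_zero, Complex.ofReal_zero]
  | succ j ih =>
    rw [pow_succ', Module.End.mul_apply, stepOp_apply]
    push_cast
    simp only [ih]
    have h1 : ∀ θ, stepSymbol w σ lam θ ^ (j + 1) * tiltedChar lam θ (a - b) =
        ∑ i, (w i : ℂ) * (stepSymbol w σ lam θ ^ j * tiltedChar lam θ (a + σ i - b)) := by
      intro θ
      rw [pow_succ]
      nth_rw 2 [stepSymbol]
      rw [Finset.mul_sum, Finset.sum_mul]
      refine Finset.sum_congr rfl fun i _ => ?_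
      rw [add_sub_right_comm, tiltedChar_add]
      ring
    simp only [h1]
    rw [integral_finsetSum, Finset.mul_sum]
    · refine Finset.sum_congr rfl fun i _ => ?_
      rw [integral_const_mul]
      ring
    · intro i _
      exact integrableOn_dualCube (continuous_const.mul
        (((continuous_stepSymbol w σ lam).pow j).mul (continuous_tiltedChar lam _)))

end Fourier

/-! ### A local limit theorem -/

section LocalLimit

open Topology

variable {d : ℕ}

theorem integral_exp_neg_mul_sum_sq (d : ℕ) {c : ℝ} (hc : 0 < c) :
    ∫ θ : Fin d → ℝ, Real.exp (-c * ∑ i, θ i ^ 2) = (Real.pi / c) ^ ((d : ℝ) / 2) := by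
  have h := GaussianFourier.integral_cexp_neg_mul_sum_add (ι := Fin d) (b := c) (by simpa using hc) 0
  have e : ∀ θ : Fin d → ℝ, Complex.exp (-c * ∑ i, (θ i : ℂ) ^ 2 +
      ∑ i, (0 : Fin d → ℂ) i * θ i) = ((Real.exp (-c * ∑ i, θ i ^ 2) : ℝ) : ℂ) := by
    intro θ; push_cast; simp
  simp only [e] at h
  rw [integral_complex_ofReal] at h
  apply Complex.ofReal_injective
  rw [h, Complex.ofReal_cpow (by positivity)]
  simp

theorem integrable_exp_neg_mul_sum_sq (d : ℕ) {c : ℝ} (hc : 0 < c) :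
    Integrable fun θ : Fin d → ℝ => Real.exp (-c * ∑ i, θ i ^ 2) := by
  refine Integrable.of_integral_ne_zero ?_
  rw [integral_exp_neg_mul_sum_sq d hc]
  positivity

/-- The density, up to the factor `exp (-|x|² / (4 σ))`, of the Gaussian law with characteristic
function `exp (-σ |θ|²)`. -/
noncomputable def gaussConst (d : ℕ) (σ : ℝ) : ℝ :=
  ((2 * Real.pi) ^ d)⁻¹ * (Real.pi / σ) ^ ((d : ℝ) / 2)

theorem integral_gaussian_mul_exp (d : ℕ) {σ : ℝ} (hσ : 0 < σ) (y : Fin d → ℝ) :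
    ((2 * Real.pi : ℂ) ^ d)⁻¹ * ∫ θ : Fin d → ℝ, ((Real.exp (-σ * ∑ i, θ i ^ 2) : ℝ) : ℂ) *
      Complex.exp (∑ i, θ i * Complex.I * y i) =
      ((gaussConst d σ * Real.exp (-(∑ i, y i ^ 2) / (4 * σ)) : ℝ) : ℂ) := by
  have h := GaussianFourier.integral_cexp_neg_mul_sum_add (ι := Fin d) (b := σ) (by simpa using hσ)
    fun i => Complex.I * y i
  have e : ∀ θ : Fin d → ℝ, Complex.exp (-σ * ∑ i, (θ i : ℂ) ^ 2 +
      ∑ i, (Complex.I * y i) * θ i) = ((Real.exp (-σ * ∑ i, θ i ^ 2) : ℝ) : ℂ) *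
        Complex.exp (∑ i, θ i * Complex.I * y i) := by
    intro θ
    push_cast
    rw [← Complex.exp_add]
    congr 2
    exact Finset.sum_congr rfl fun i _ => by ring
  simp only [e] at h
  rw [h, gaussConst]
  push_cast
  rw [Complex.ofReal_cpow (by positivity)]
  push_cast
  rw [Fintype.card_fin, mul_assoc]
  congr 4
  simp only [mul_pow, Complex.I_sq, neg_mul, one_mul, Finset.sum_neg_distrib]

/-- If the powers of `G` are dominated by Gaussians, and `P n` is the Fourier transform of the
`n`-th power of `G` (for each tilt `lam`), then `P n` has Gaussian scale and exponential tails. -/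
theorem exists_abs_le_of_fourier {G : (Fin d → ℝ) → (Fin d → ℝ) → ℂ} {P : ℕ → (Fin d → ℤ) → ℝ}
    {c C δ : ℝ} (hc : 0 < c) (hδ : 0 < δ)
    (hG : ∀ lam : Fin d → ℝ, ∑ i, lam i ^ 2 ≤ δ → ∀ θ ∈ dualCube d,
      ‖G lam θ‖ ≤ Real.exp (-c * ∑ i, θ i ^ 2 + C * ∑ i, lam i ^ 2))
    (hP : ∀ lam : Fin d → ℝ, ∑ i, lam i ^ 2 ≤ δ → ∀ n x, n ≠ 0 →
      (P n x : ℂ) = ((2 * Real.pi : ℂ) ^ d)⁻¹ *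
        ∫ θ in dualCube d, G lam θ ^ n * tiltedChar lam θ x) :
    ∃ K, ∀ n x, n ≠ 0 → |P n x| ≤ K * (n : ℝ) ^ (-((d : ℝ) / 2)) *
      Real.exp (-√δ * √(∑ i, (x i : ℝ) ^ 2) / √n) := by
  refine ⟨((2 * Real.pi) ^ d)⁻¹ * (Real.pi / c) ^ ((d : ℝ) / 2) * Real.exp (|C| * δ), fun n x hn => ?_⟩
  have hn' : (0 : ℝ) < n := by positivity
  set R : ℝ := √(∑ i, (x i : ℝ) ^ 2) with hR
  have hR2 : R ^ 2 = ∑ i, (x i : ℝ) ^ 2 := Real.sq_sqrt (Finset.sum_nonneg fun i _ => sq_nonneg _)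
  -- A tilt of length `√(δ / n)` opposite to `x` gains `exp (-√δ * |x| / √n)`, while over `n` steps
  -- it costs only the bounded factor `exp (|C| * δ)`.
  obtain ⟨lam, hlam, hlamx⟩ : ∃ lam : Fin d → ℝ, ∑ i, lam i ^ 2 ≤ δ / n ∧
      ∑ i, lam i * x i = -√δ * R / √n := by
    by_cases hR0 : R = 0
    · exact ⟨0, by simp; positivity, by simp [hR0]⟩
    · refine ⟨fun i => -√δ / (√n * R) * x i, le_of_eq ?_, ?_⟩
      · simp only [mul_pow, ← Finset.mul_sum, ← hR2, div_pow, neg_sq, Real.sq_sqrt hδ.le,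
          Real.sq_sqrt hn'.le]
        field_simp
      · simp only [mul_assoc, ← Finset.mul_sum]
        simp only [← pow_two, ← hR2]
        field_simp
  have hlamδ : ∑ i, lam i ^ 2 ≤ δ :=
    hlam.trans (div_le_self hδ.le (by exact_mod_cast Nat.one_le_iff_ne_zero.2 hn))
  have h1 : ‖((P n x : ℝ) : ℂ)‖ = |P n x| := by simp
  rw [← h1, hP lam hlamδ n x hn, norm_mul]
  have h2 : ‖((2 * Real.pi : ℂ) ^ d)⁻¹‖ = ((2 * Real.pi) ^ d)⁻¹ := by
    rw [norm_inv, norm_pow, norm_mul, Complex.norm_real, Real.norm_of_nonneg Real.pi_pos.le]; simp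
  have hcn : 0 < c * n := by positivity
  have h3 : ‖∫ θ in dualCube d, G lam θ ^ n * tiltedChar lam θ x‖ ≤
      ∫ θ : Fin d → ℝ, Real.exp (|C| * δ) * Real.exp (-√δ * R / √n) *
        Real.exp (-(c * n) * ∑ i, θ i ^ 2) := by
    have hint := ((integrable_exp_neg_mul_sum_sq d hcn).const_mul
      (Real.exp (|C| * δ) * Real.exp (-√δ * R / √n)))
    refine (norm_integral_le_of_norm_le hint.integrableOn ?_).trans
      (setIntegral_le_integral hint (ae_of_all _ fun θ => by positivity))
    refine (ae_restrict_iff' measurableSet_dualCube).2 (ae_of_all _ fun θ hθ => ?_)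
    rw [norm_mul, norm_pow, norm_tiltedChar, hlamx]
    have h4 : ‖G lam θ‖ ^ n ≤ Real.exp (|C| * δ) * Real.exp (-(c * n) * ∑ i, θ i ^ 2) := by
      refine (pow_le_pow_left₀ (norm_nonneg _) (hG lam hlamδ θ hθ) n).trans ?_
      rw [← Real.exp_nat_mul, ← Real.exp_add]
      refine Real.exp_le_exp.2 ?_
      have h5 : C * ∑ i, lam i ^ 2 ≤ |C| * (δ / n) :=
        (mul_le_mul_of_nonneg_right (le_abs_self C) (Finset.sum_nonneg fun i _ => sq_nonneg _)).trans
          (mul_le_mul_of_nonneg_left hlam (abs_nonneg C))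
      have h6 : n * (C * ∑ i, lam i ^ 2) ≤ |C| * δ := by
        calc n * (C * ∑ i, lam i ^ 2) ≤ n * (|C| * (δ / n)) := by gcongr
          _ = |C| * δ := by field_simp
      linarith
    calc ‖G lam θ‖ ^ n * Real.exp (-√δ * R / √n) ≤
        Real.exp (|C| * δ) * Real.exp (-(c * n) * ∑ i, θ i ^ 2) * Real.exp (-√δ * R / √n) := by
          gcongr
      _ = _ := by ring
  rw [h2]
  rw [integral_const_mul, integral_exp_neg_mul_sum_sq d hcn] at h3
  have h7 : (Real.pi / (c * n)) ^ ((d : ℝ) / 2) =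
      (Real.pi / c) ^ ((d : ℝ) / 2) * (n : ℝ) ^ (-((d : ℝ) / 2)) := by
    rw [← div_div, Real.div_rpow (by positivity) hn'.le, Real.rpow_neg hn'.le, div_eq_mul_inv]
  rw [h7] at h3
  calc _ ≤ ((2 * Real.pi) ^ d)⁻¹ * (Real.exp (|C| * δ) * Real.exp (-√δ * R / √n) *
        ((Real.pi / c) ^ ((d : ℝ) / 2) * (n : ℝ) ^ (-((d : ℝ) / 2)))) := by gcongr
    _ = _ := by ring

/-- The local limit theorem, uniformly in the endpoint. -/
theorem tendsto_fourier_sub_gaussian {G : (Fin d → ℝ) → ℂ} {P : ℕ → (Fin d → ℤ) → ℝ}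
    {c σ : ℝ} (hc : 0 < c) (hσ : 0 < σ) (hGc : Continuous G)
    (hG : ∀ θ ∈ dualCube d, ‖G θ‖ ≤ Real.exp (-c * ∑ i, θ i ^ 2))
    (hlim : ∀ θ, Tendsto (fun n : ℕ => G ((√n)⁻¹ • θ) ^ n) atTop
      (𝓝 ((Real.exp (-σ * ∑ i, θ i ^ 2) : ℝ) : ℂ)))
    (hP : ∀ n x, n ≠ 0 → (P n x : ℂ) = ((2 * Real.pi : ℂ) ^ d)⁻¹ *
      ∫ θ in dualCube d, G θ ^ n * tiltedChar 0 θ x) :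
    ∃ ε : ℕ → ℝ, Tendsto ε atTop (𝓝 0) ∧ ∀ (n : ℕ) (x : Fin d → ℤ), n ≠ 0 →
      |(n : ℝ) ^ ((d : ℝ) / 2) * P n x -
      gaussConst d σ * Real.exp (-(∑ i, (x i : ℝ) ^ 2) / (4 * σ * n))| ≤ ε n := by
  set g : ℕ → (Fin d → ℝ) → ℂ := fun n θ =>
    (dualCube d).indicator (fun θ => G θ ^ n) ((√n)⁻¹ • θ) with hg
  set γ : (Fin d → ℝ) → ℂ := fun θ => ((Real.exp (-σ * ∑ i, θ i ^ 2) : ℝ) : ℂ) with hγ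
  have hgm : ∀ n, Measurable (g n) := fun n =>
    ((hGc.pow n).measurable.indicator measurableSet_dualCube).comp (by fun_prop)
  have hγm : Continuous γ := by simp only [hγ]; fun_prop
  have hgb : ∀ n, n ≠ 0 → ∀ θ, ‖g n θ‖ ≤ Real.exp (-c * ∑ i, θ i ^ 2) := by
    intro n hn θ
    have hn' : (0 : ℝ) < n := by positivity
    by_cases h : (√n)⁻¹ • θ ∈ dualCube d
    · simp only [hg, Set.indicator_of_mem h, norm_pow]
      refine (pow_le_pow_left₀ (norm_nonneg _) (hG _ h) n).trans (le_of_eq ?_)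
      rw [← Real.exp_nat_mul]
      congr 1
      simp only [Pi.smul_apply, smul_eq_mul, mul_pow, ← Finset.mul_sum, inv_pow,
        Real.sq_sqrt hn'.le]
      field_simp
    · simp only [hg, Set.indicator_of_notMem h, norm_zero]
      positivity
  have hglim : ∀ θ, Tendsto (fun n => g n θ) atTop (𝓝 (γ θ)) := by
    intro θ
    refine (hlim θ).congr' ?_
    have h1 : Tendsto (fun n : ℕ => (√n)⁻¹ • θ) atTop (𝓝 0) := by
      have : Tendsto (fun n : ℕ => (√(n : ℝ))⁻¹) atTop (𝓝 0) :=
        tendsto_inv_atTop_zero.comp (Real.tendsto_sqrt_atTop.comp tendsto_natCast_atTop_atTop)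
      simpa using this.smul_const θ
    have h2 : dualCube d ∈ 𝓝 (0 : Fin d → ℝ) :=
      set_pi_mem_nhds Set.finite_univ fun i _ =>
        Ioc_mem_nhds (by simpa using Real.pi_pos) (by simpa using Real.pi_pos)
    filter_upwards [h1.eventually h2] with n hn
    simp only [hg]
    rw [Set.indicator_of_mem hn]
  have hγb : ∀ θ, ‖γ θ‖ = Real.exp (-σ * ∑ i, θ i ^ 2) := fun θ => by
    simp only [hγ, Complex.norm_real, Real.norm_eq_abs, Real.abs_exp]
  have hγi : Integrable γ := (integrable_exp_neg_mul_sum_sq d hσ).ofReal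
  have hgi : ∀ n, n ≠ 0 → Integrable (g n) := fun n hn =>
    (integrable_exp_neg_mul_sum_sq d hc).mono' (hgm n).aestronglyMeasurable
      (ae_of_all _ (hgb n hn))
  -- Convergence in `L¹` of the rescaled symbols is what gives uniformity: the endpoint enters only
  -- through a factor of modulus `1`.
  have hdct : Tendsto (fun n => ∫ θ, ‖g n θ - γ θ‖) atTop (𝓝 0) := by
    have h0 : ∫ _ : Fin d → ℝ, (0 : ℝ) = 0 := integral_zero _ _
    rw [← h0]
    refine tendsto_integral_filter_of_dominated_convergence
      (fun θ : Fin d → ℝ => Real.exp (-c * ∑ i, θ i ^ 2) + Real.exp (-σ * ∑ i, θ i ^ 2)) ?_ ?_ ?_ ?_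
    · exact Eventually.of_forall fun n =>
        ((hgm n).sub hγm.measurable).norm.aestronglyMeasurable
    · filter_upwards [eventually_ne_atTop 0] with n hn
      refine ae_of_all _ fun θ => ?_
      rw [norm_norm, ← hγb]
      exact (norm_sub_le _ _).trans (add_le_add (hgb n hn θ) le_rfl)
    · exact (integrable_exp_neg_mul_sum_sq d hc).add (integrable_exp_neg_mul_sum_sq d hσ)
    · refine ae_of_all _ fun θ => ?_
      simpa using ((hglim θ).sub_const (γ θ)).norm
  refine ⟨fun n => ((2 * Real.pi) ^ d)⁻¹ * ∫ θ, ‖g n θ - γ θ‖, by simpa using hdct.const_mul _,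
    fun n x hn => ?_⟩
  have hn' : (0 : ℝ) < n := by positivity
  have hsq : 0 < √(n : ℝ) := Real.sqrt_pos.2 hn'
  set χ : (Fin d → ℝ) → ℂ := fun θ => Complex.exp (∑ i, θ i * Complex.I * ((x i / √n : ℝ) : ℂ))
    with hχ
  have hχc : Continuous χ := by simp only [hχ]; fun_prop
  have hχn : ∀ θ, ‖χ θ‖ = 1 := by
    intro θ
    simp only [hχ, Complex.norm_exp, Complex.re_sum]
    simp
  have h1 : (((n : ℝ) ^ ((d : ℝ) / 2) * P n x : ℝ) : ℂ) =
      ((2 * Real.pi : ℂ) ^ d)⁻¹ * ∫ θ, g n θ * χ θ := by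
    have h2 : ∀ θ, g n θ * χ θ = (dualCube d).indicator
        (fun θ => G θ ^ n * tiltedChar 0 θ x) ((√n)⁻¹ • θ) := by
      intro θ
      by_cases h : (√n)⁻¹ • θ ∈ dualCube d
      · simp only [hg, Set.indicator_of_mem h]
        congr 1
        simp only [hχ]
        rw [tiltedChar]
        congr 1
        refine Finset.sum_congr rfl fun i _ => ?_
        simp only [Pi.zero_apply, Pi.smul_apply, smul_eq_mul]
        push_cast
        ring
      · simp only [hg, Set.indicator_of_notMem h, zero_mul]
    simp only [h2]
    rw [Measure.integral_comp_smul_of_nonneg volume _ _ (hR := by positivity),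
      integral_indicator measurableSet_dualCube]
    have e : ((√(n : ℝ))⁻¹ ^ Module.finrank ℝ (Fin d → ℝ))⁻¹ = (n : ℝ) ^ ((d : ℝ) / 2) := by
      rw [Module.finrank_fin_fun, inv_pow, inv_inv, Real.sqrt_eq_rpow, ← Real.rpow_natCast,
        ← Real.rpow_mul hn'.le]
      congr 1
      ring
    rw [e, Complex.ofReal_mul, hP n x hn, Complex.real_smul]
    ring
  have h3 := integral_gaussian_mul_exp d hσ fun i => x i / √n
  have h4 : -(∑ i, ((x i : ℝ) / √n) ^ 2) / (4 * σ) = -(∑ i, (x i : ℝ) ^ 2) / (4 * σ * n) := by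
    simp only [div_pow, Real.sq_sqrt hn'.le, ← Finset.sum_div]
    field_simp
  rw [h4] at h3
  have h5 : ∀ z : ℝ, |z| = ‖(z : ℂ)‖ := fun z => by simp
  rw [h5, Complex.ofReal_sub, h1, ← h3, ← mul_sub, ← integral_sub, norm_mul]
  · have h2 : ‖((2 * Real.pi : ℂ) ^ d)⁻¹‖ = ((2 * Real.pi) ^ d)⁻¹ := by
      rw [norm_inv, norm_pow, norm_mul, Complex.norm_real, Real.norm_of_nonneg Real.pi_pos.le]; simp
    rw [h2]
    refine mul_le_mul_of_nonneg_left ?_ (by positivity)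
    refine (norm_integral_le_integral_norm _).trans (le_of_eq ?_)
    congr 1
    ext θ
    rw [← sub_mul, norm_mul, hχn, mul_one]
  · exact (hgi n hn).mul_bdd (c := 1) hχc.aestronglyMeasurable (ae_of_all _ fun θ => (hχn θ).le)
  · exact hγi.mul_bdd (c := 1) hχc.aestronglyMeasurable (ae_of_all _ fun θ => (hχn θ).le)

end LocalLimit

/-! ### Sums of a regularly varying sequence against a local limit -/

section SumAsymptotics

open Topology

/-- Writing the series as an integral makes rescaling of the index a change of variables and allows
dominated convergence. -/
theorem integral_comp_natFloor {a : ℕ → ℝ} (ha : Summable a) :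
    ∫ y in Set.Ioi (0 : ℝ), a ⌊y⌋₊ = ∑' j, a j := by
  have hU : Set.Ici (0 : ℝ) = ⋃ j : ℕ, Set.Ico (j : ℝ) (j + 1) := by
    ext y
    simp only [Set.mem_Ici, Set.mem_iUnion, Set.mem_Ico]
    exact ⟨fun h => ⟨⌊y⌋₊, Nat.floor_le h, Nat.lt_floor_add_one y⟩,
      fun ⟨j, h, _⟩ => (Nat.cast_nonneg j).trans h⟩
  have hfl : ∀ j : ℕ, ∀ y ∈ Set.Ico (j : ℝ) (j + 1), ⌊y⌋₊ = j := fun j y hy =>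
    (Nat.floor_eq_iff ((Nat.cast_nonneg j).trans hy.1)).2 hy
  have hd : Pairwise (Function.onFun Disjoint fun j : ℕ => Set.Ico (j : ℝ) (j + 1)) := by
    intro i j hij
    refine Set.disjoint_left.2 fun y hi hj => hij ?_
    rw [← hfl i y hi, hfl j y hj]
  have hj : ∀ j : ℕ, ∀ b : ℕ → ℝ, ∫ y in Set.Ico (j : ℝ) (j + 1), b ⌊y⌋₊ = b j := by
    intro j b
    rw [setIntegral_congr_fun measurableSet_Ico fun y hy => by rw [hfl j y hy]]
    simp
  rw [← integral_Ici_eq_integral_Ioi, hU, integral_iUnion (fun _ => measurableSet_Ico) hd]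
  · simp only [hj]
  · refine integrableOn_iUnion_of_summable_integral_norm (fun j => ?_) ?_
    · refine (integrableOn_const (C := a j) (by simp)).congr_fun (fun y hy => ?_) measurableSet_Ico
      rw [hfl j y hy]
    · simp only [hj _ fun j => ‖a j‖]
      exact ha.norm

theorem exists_rpow_mul_exp_neg_sqrt_le (a : ℝ) (ha : 0 ≤ a) {c : ℝ} (hc : 0 < c) :
    ∃ B, 0 ≤ B ∧ ∀ w, 0 ≤ w → w ^ a * Real.exp (-c * √w) ≤ B := by
  set N := ⌈a⌉₊
  refine ⟨1 + (2 * N).factorial / c ^ (2 * N), by positivity, fun w hw => ?_⟩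
  have hB : 0 ≤ (2 * N).factorial / c ^ (2 * N) := by positivity
  have hexp : Real.exp (-c * √w) ≤ 1 := Real.exp_le_one_iff.2 (by
    have := mul_nonneg hc.le (Real.sqrt_nonneg w)
    linarith)
  rcases le_total w 1 with h | h
  · have h1 := Real.rpow_le_one hw h ha
    calc w ^ a * Real.exp (-c * √w) ≤ 1 * 1 := by gcongr
      _ ≤ _ := by linarith
  · have h1 : w ^ a ≤ w ^ N := by
      rw [← Real.rpow_natCast]
      exact Real.rpow_le_rpow_of_exponent_le h (Nat.le_ceil a)
    have h2 := Real.pow_div_factorial_le_exp (c * √w) (by positivity) (2 * N)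
    have h3 : (c * √w) ^ (2 * N) = c ^ (2 * N) * w ^ N := by
      rw [mul_pow, pow_mul √w, Real.sq_sqrt hw]
    rw [h3] at h2
    have h4 : w ^ N ≤ (2 * N).factorial / c ^ (2 * N) * Real.exp (c * √w) := by
      rw [div_le_iff₀ (by positivity)] at h2
      rw [div_mul_eq_mul_div, le_div_iff₀ (by positivity)]
      linarith
    calc w ^ a * Real.exp (-c * √w) ≤
        (2 * N).factorial / c ^ (2 * N) * Real.exp (c * √w) * Real.exp (-c * √w) := by
          gcongr; exact h1.trans h4
      _ = (2 * N).factorial / c ^ (2 * N) := by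
          rw [mul_assoc, ← Real.exp_add, neg_mul, add_neg_cancel, Real.exp_zero, mul_one]
      _ ≤ _ := by linarith

theorem integrableOn_ite_rpow_neg {a : ℝ} (ha : 1 < a) (B : ℝ) :
    IntegrableOn (fun u : ℝ => if u ≤ 1 then B else u ^ (-a)) (Set.Ioi 0) := by
  rw [← Set.Ioc_union_Ioi_eq_Ioi zero_le_one]
  refine IntegrableOn.union ?_ ?_
  · refine (integrableOn_const (C := B) (by simp)).congr_fun (fun y hy => ?_) measurableSet_Ioc
    rw [if_pos hy.2]
  · refine (integrableOn_Ioi_rpow_of_lt (a := -a) (by linarith) one_pos).congr_fun (fun y hy => ?_)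
      measurableSet_Ioi
    rw [if_neg (not_le.2 hy)]

/-- With `j = ⌊u * R ^ 2⌋` the summand is of order `R ^ (-2 * (κ + 1 + δ))` and the change of
variables contributes `R ^ 2`, leaving the exponent `2 * δ + 2 * κ`. The regular variation of `t`
and the local limit give the pointwise limit in `u`. Domination comes from the exponential tail for
small `u` and from the integrable power `u ^ (-(κ + 1 + δ))` for large `u`. -/
theorem tendsto_tsum_of_local_limit {X : Type*} {l : Filter X} [l.IsCountablyGenerated]
    {R : X → ℝ} (hR : Tendsto R l atTop) {t : ℕ → ℝ} {P : ℕ → X → ℝ} {κ δ L A ς C c : ℝ}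
    (hκ : 0 < κ) (hδ : 0 ≤ δ) (hc : 0 < c) {α : ℕ} (hα : α ≠ 0) {ε : ℕ → ℝ}
    (ht : Tendsto (fun j : ℕ => ((α * j + 1 : ℕ) : ℝ) ^ (κ + 1) * t j) atTop (𝓝 L))
    (hPb : ∀ (n : ℕ) x, n ≠ 0 → |P n x| ≤ C * (n : ℝ) ^ (-δ) * Real.exp (-c * R x / √n))
    (hε : Tendsto ε atTop (𝓝 0))
    (hPl : ∀ (n : ℕ) x, n ≠ 0 →
      |(n : ℝ) ^ δ * P n x - A * Real.exp (-(R x) ^ 2 / (4 * ς * n))| ≤ ε n) :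
    Tendsto (fun x => R x ^ (2 * δ + 2 * κ) * ∑' j, t j * P (α * j + 1) x) l
      (𝓝 (∫ u in Set.Ioi (0 : ℝ), (α * u) ^ (-(κ + 1 + δ)) *
        (L * (A * Real.exp (-(1 / (4 * ς) * (α * u)⁻¹)))))) := by
  set a := κ + 1 + δ with ha
  have ha1 : 1 < a := by linarith
  have hα1 : (1 : ℝ) ≤ α := by exact_mod_cast Nat.one_le_iff_ne_zero.2 hα
  obtain ⟨B, hB0, hB⟩ := exists_rpow_mul_exp_neg_sqrt_le a (by linarith) hc
  obtain ⟨K, hK⟩ := ht.abs.bddAbove_range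
  have hK' : ∀ j : ℕ, |((α * j + 1 : ℕ) : ℝ) ^ (κ + 1) * t j| ≤ K := fun j =>
    hK (Set.mem_range_self j)
  have hK0 : 0 ≤ K := (abs_nonneg _).trans (hK' 0)
  have hRpos : ∀ᶠ x in l, 0 < R x := hR.eventually_gt_atTop 0
  have hbd : ∀ x, 0 < R x → ∀ j : ℕ, |t j * P (α * j + 1) x| ≤
      K * (C * (((α * j + 1 : ℕ) : ℝ) ^ (-a) * Real.exp (-c * R x / √((α * j + 1 : ℕ) : ℝ)))) := by
    intro x hx j
    set n := α * j + 1 with hn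
    have hn' : (0 : ℝ) < n := by positivity
    have e1 : t j = (n : ℝ) ^ (-(κ + 1)) * ((n : ℝ) ^ (κ + 1) * t j) := by
      rw [← mul_assoc, ← Real.rpow_add hn', neg_add_cancel, Real.rpow_zero, one_mul]
    have e2 : (n : ℝ) ^ (-a) = (n : ℝ) ^ (-(κ + 1)) * (n : ℝ) ^ (-δ) := by
      rw [← Real.rpow_add hn']; congr 1; rw [ha]; ring
    have h1 := hPb n x (by omega)
    have h2 : |t j| ≤ (n : ℝ) ^ (-(κ + 1)) * K := by
      rw [e1, abs_mul, abs_of_pos (Real.rpow_pos_of_pos hn' _)]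
      exact mul_le_mul_of_nonneg_left (hK' j) (by positivity)
    rw [abs_mul, e2]
    calc _ ≤ (n : ℝ) ^ (-(κ + 1)) * K * (C * (n : ℝ) ^ (-δ) * Real.exp (-c * R x / √n)) := by
          gcongr
      _ = _ := by ring
  have hC0 : (∃ x, 0 < R x) → 0 ≤ C := by
    rintro ⟨x, hx⟩
    have h1 := (abs_nonneg _).trans (hPb 1 x one_ne_zero)
    simp only [Nat.cast_one, Real.one_rpow, mul_one] at h1
    exact nonneg_of_mul_nonneg_left h1 (Real.exp_pos _)
  have hsum : ∀ x, 0 < R x → Summable fun j => t j * P (α * j + 1) x := by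
    intro x hx
    have hC := hC0 ⟨x, hx⟩
    have h1 : Summable fun j : ℕ => K * (C * ((j + 1 : ℕ) : ℝ) ^ (-a)) :=
      ((((summable_nat_add_iff 1).2 (Real.summable_nat_rpow.2 (by linarith : -a < -1))).mul_left
        C).mul_left K)
    refine h1.of_norm_bounded fun j => (hbd x hx j).trans ?_
    have h2 : ((α * j + 1 : ℕ) : ℝ) ^ (-a) ≤ ((j + 1 : ℕ) : ℝ) ^ (-a) := by
      refine Real.rpow_le_rpow_of_nonpos (by positivity) ?_ (by linarith)
      have : 1 * j ≤ α * j := Nat.mul_le_mul_right j (Nat.one_le_iff_ne_zero.2 hα)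
      exact_mod_cast (by omega : j + 1 ≤ α * j + 1)
    have h3 : Real.exp (-c * R x / √((α * j + 1 : ℕ) : ℝ)) ≤ 1 := by
      refine Real.exp_le_one_iff.2 (div_nonpos_of_nonpos_of_nonneg ?_ (Real.sqrt_nonneg _))
      have := mul_pos hc hx
      linarith
    calc _ ≤ K * (C * (((j + 1 : ℕ) : ℝ) ^ (-a) * 1)) := by gcongr
      _ = _ := by rw [mul_one]
  have hrw : ∀ᶠ x in l, ∫ u in Set.Ioi (0 : ℝ), (R x ^ 2) ^ a *
      (t ⌊u * R x ^ 2⌋₊ * P (α * ⌊u * R x ^ 2⌋₊ + 1) x) =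
      R x ^ (2 * δ + 2 * κ) * ∑' j, t j * P (α * j + 1) x := by
    filter_upwards [hRpos] with x hx
    have hx2 : 0 < R x ^ 2 := by positivity
    rw [integral_const_mul]
    have h1 := integral_comp_mul_right_Ioi (fun y => t ⌊y⌋₊ * P (α * ⌊y⌋₊ + 1) x) 0 hx2
    rw [h1, zero_mul, integral_comp_natFloor (hsum x hx), smul_eq_mul, ← mul_assoc]
    congr 1
    rw [← Real.rpow_natCast, ← Real.rpow_mul hx.le, ← Real.rpow_neg hx.le, ← Real.rpow_add hx]
    congr 1
    rw [ha]; push_cast; ring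
  refine Tendsto.congr' hrw ?_
  refine tendsto_integral_filter_of_dominated_convergence
    (fun u => K * (C * if u ≤ 1 then B else u ^ (-a))) ?_ ?_ ?_ ?_
  · refine Eventually.of_forall fun x => Measurable.aestronglyMeasurable ?_
    have h1 : Measurable fun u : ℝ => ⌊u * R x ^ 2⌋₊ := by fun_prop
    exact measurable_const.mul
      ((measurable_of_countable fun j : ℕ => t j * P (α * j + 1) x).comp h1)
  · filter_upwards [hRpos] with x hx
    have hC := hC0 ⟨x, hx⟩
    refine (ae_restrict_iff' measurableSet_Ioi).2 (ae_of_all _ fun u (hu : 0 < u) => ?_)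
    set j := ⌊u * R x ^ 2⌋₊ with hj
    set n := α * j + 1 with hn
    have hn' : (0 : ℝ) < n := by positivity
    have hx2 : 0 < R x ^ 2 := by positivity
    have hnu : u * R x ^ 2 ≤ n := by
      refine (Nat.lt_floor_add_one (u * R x ^ 2)).le.trans ?_
      have : 1 * j ≤ α * j := Nat.mul_le_mul_right j (Nat.one_le_iff_ne_zero.2 hα)
      exact_mod_cast (by omega : j + 1 ≤ n)
    set w := R x ^ 2 / n with hw
    have hw0 : 0 < w := by positivity
    have hwu : w ≤ u⁻¹ := by
      rw [hw, div_le_iff₀ hn', inv_mul_eq_div, le_div_iff₀ hu]; linarith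
    have hexp : Real.exp (-c * R x / √n) = Real.exp (-c * √w) := by
      rw [hw, Real.sqrt_div hx2.le, Real.sqrt_sq hx.le, mul_div_assoc]
    have h1 : w ^ a * Real.exp (-c * √w) ≤ if u ≤ 1 then B else u ^ (-a) := by
      split_ifs with h
      · exact hB w hw0.le
      · have h2 : Real.exp (-c * √w) ≤ 1 := Real.exp_le_one_iff.2 (by
          have := mul_nonneg hc.le (Real.sqrt_nonneg w)
          linarith)
        calc _ ≤ (u⁻¹) ^ a * 1 := by gcongr
          _ = _ := by rw [mul_one, Real.inv_rpow hu.le, Real.rpow_neg hu.le]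
    have h3 : (R x ^ 2) ^ a * (n : ℝ) ^ (-a) = w ^ a := by
      rw [hw, Real.div_rpow hx2.le hn'.le, Real.rpow_neg hn'.le, div_eq_mul_inv]
    have h4 := hbd x hx j
    rw [← hn, hexp] at h4
    rw [Real.norm_eq_abs, abs_mul, abs_of_pos (Real.rpow_pos_of_pos hx2 a)]
    calc _ ≤ (R x ^ 2) ^ a * (K * (C * ((n : ℝ) ^ (-a) * Real.exp (-c * √w)))) := by gcongr
      _ = K * (C * ((R x ^ 2) ^ a * (n : ℝ) ^ (-a) * Real.exp (-c * √w))) := by ring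
      _ ≤ _ := by rw [h3]; gcongr
  · exact ((integrableOn_ite_rpow_neg ha1 B).const_mul C).const_mul K
  · refine (ae_restrict_iff' measurableSet_Ioi).2 (ae_of_all _ fun u (hu : 0 < u) => ?_)
    have hR2 : Tendsto (fun x => R x ^ 2) l atTop := (tendsto_pow_atTop two_ne_zero).comp hR
    have hj : Tendsto (fun x => ⌊u * R x ^ 2⌋₊) l atTop :=
      tendsto_nat_floor_atTop.comp (hR2.const_mul_atTop hu)
    have hn : Tendsto (fun x => α * ⌊u * R x ^ 2⌋₊ + 1) l atTop :=
      tendsto_atTop_mono (fun x => by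
        have : 1 * ⌊u * R x ^ 2⌋₊ ≤ α * ⌊u * R x ^ 2⌋₊ :=
          Nat.mul_le_mul_right _ (Nat.one_le_iff_ne_zero.2 hα)
        omega) hj
    have hlimn : Tendsto (fun x => ((α * ⌊u * R x ^ 2⌋₊ + 1 : ℕ) : ℝ) / R x ^ 2) l
        (𝓝 (α * u)) := by
      have h1 := ((tendsto_nat_floor_mul_div_atTop hu.le).comp hR2).const_mul (α : ℝ)
      have h2 := h1.add (tendsto_inv_atTop_zero.comp hR2)
      rw [add_zero] at h2
      refine h2.congr fun x => ?_
      simp only [Function.comp]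
      push_cast
      ring
    have hαu : 0 < α * u := by positivity
    have hT := ht.comp hj
    have hG : Tendsto (fun x => A * Real.exp (-(R x) ^ 2 /
        (4 * ς * ((α * ⌊u * R x ^ 2⌋₊ + 1 : ℕ) : ℝ)))) l
        (𝓝 (A * Real.exp (-(1 / (4 * ς) * (α * u)⁻¹)))) := by
      refine ((Real.continuous_exp.tendsto _).comp
        ((hlimn.inv₀ hαu.ne').const_mul (1 / (4 * ς))).neg).const_mul A |>.congr fun x => ?_
      simp only [Function.comp]
      congr 2
      rw [inv_div, div_mul_div_comm, one_mul, neg_div]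
    have hP : Tendsto (fun x => ((α * ⌊u * R x ^ 2⌋₊ + 1 : ℕ) : ℝ) ^ δ *
        P (α * ⌊u * R x ^ 2⌋₊ + 1) x) l (𝓝 (A * Real.exp (-(1 / (4 * ς) * (α * u)⁻¹)))) := by
      have h1 : Tendsto (fun x => ((α * ⌊u * R x ^ 2⌋₊ + 1 : ℕ) : ℝ) ^ δ *
          P (α * ⌊u * R x ^ 2⌋₊ + 1) x - A * Real.exp (-(R x) ^ 2 /
            (4 * ς * ((α * ⌊u * R x ^ 2⌋₊ + 1 : ℕ) : ℝ)))) l (𝓝 0) :=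
        squeeze_zero_norm (fun x => hPl _ x (Nat.succ_ne_zero _)) (hε.comp hn)
      simpa using h1.add hG
    have hW := hlimn.rpow_const (p := -a) (Or.inl hαu.ne')
    refine (hW.mul (hT.mul hP)).congr' ?_
    filter_upwards [hRpos] with x hx
    simp only [Function.comp]
    set n := α * ⌊u * R x ^ 2⌋₊ + 1
    have hn' : (0 : ℝ) < n := by positivity
    have hx2 : 0 < R x ^ 2 := by positivity
    have e1 : ((n : ℝ) / R x ^ 2) ^ (-a) * (n : ℝ) ^ (κ + 1) * (n : ℝ) ^ δ = (R x ^ 2) ^ a := by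
      rw [Real.div_rpow hn'.le hx2.le, Real.rpow_neg hx2.le, div_inv_eq_mul]
      have e2 : (n : ℝ) ^ (-a) * ((n : ℝ) ^ (κ + 1) * (n : ℝ) ^ δ) = 1 := by
        rw [← Real.rpow_add hn', ← Real.rpow_add hn', ← ha, neg_add_cancel, Real.rpow_zero]
      linear_combination (R x ^ 2) ^ a * e2
    rw [← e1]
    ring

theorem integral_rpow_mul_exp_pos {a L A b α : ℝ} (ha : 1 < a) (hL : 0 < L) (hA : 0 < A)
    (hα : 0 < α) (hb : 0 < b) :
    0 < ∫ u in Set.Ioi (0 : ℝ), (α * u) ^ (-a) * (L * (A * Real.exp (-(b * (α * u)⁻¹)))) := by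
  have hpos : ∀ u ∈ Set.Ioi (0 : ℝ),
      0 < (α * u) ^ (-a) * (L * (A * Real.exp (-(b * (α * u)⁻¹)))) := by
    intro u hu
    have : 0 < α * u := mul_pos hα hu
    positivity
  obtain ⟨B, hB0, hB⟩ := exists_rpow_mul_exp_neg_sqrt_le (a / 2) (by linarith) hb
  have hint : IntegrableOn (fun u : ℝ => (α * u) ^ (-a) *
      (L * (A * Real.exp (-(b * (α * u)⁻¹))))) (Set.Ioi 0) := by
    have h1 := (integrableOn_ite_rpow_neg ha B).const_mul (L * A * (1 + α ^ (-a)))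
    refine h1.mono' (Measurable.aestronglyMeasurable (by fun_prop)) ?_
    refine (ae_restrict_iff' measurableSet_Ioi).2 (ae_of_all _ fun u hu => ?_)
    rw [Real.norm_of_nonneg (hpos u hu).le]
    have hu : 0 < u := hu
    have hαu : 0 < α * u := mul_pos hα hu
    have hαa : 0 < α ^ (-a) := Real.rpow_pos_of_pos hα _
    have h2 : (α * u) ^ (-a) * Real.exp (-(b * (α * u)⁻¹)) ≤
        (1 + α ^ (-a)) * if u ≤ 1 then B else u ^ (-a) := by
      split_ifs with h
      · have h3 := hB ((α * u)⁻¹ ^ 2) (by positivity)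
        rw [Real.sqrt_sq (by positivity), ← Real.rpow_natCast, ← Real.rpow_mul (by positivity),
          Real.inv_rpow hαu.le, ← Real.rpow_neg hαu.le, neg_mul] at h3
        have e : -(((2 : ℕ) : ℝ) * (a / 2)) = -a := by push_cast; ring
        rw [e] at h3
        have := mul_nonneg hαa.le hB0
        linarith
      · have h3 : Real.exp (-(b * (α * u)⁻¹)) ≤ 1 := Real.exp_le_one_iff.2 (by
          have : 0 < b * (α * u)⁻¹ := by positivity
          linarith)
        have hua : 0 < u ^ (-a) := Real.rpow_pos_of_pos hu _
        rw [Real.mul_rpow hα.le hu.le]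
        have h4 := mul_le_of_le_one_right (mul_pos hαa hua).le h3
        linarith
    calc _ = L * A * ((α * u) ^ (-a) * Real.exp (-(b * (α * u)⁻¹))) := by ring
      _ ≤ L * A * ((1 + α ^ (-a)) * if u ≤ 1 then B else u ^ (-a)) := by gcongr
      _ = _ := by ring
  rw [setIntegral_pos_iff_support_of_nonneg_ae]
  · refine lt_of_lt_of_le ?_ (measure_mono (s := Set.Ioi (0 : ℝ)) fun u hu =>
      ⟨Function.mem_support.2 (hpos u hu).ne', hu⟩)
    rw [Real.volume_Ioi]
    exact ENNReal.zero_lt_top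
  · exact (ae_restrict_iff' measurableSet_Ioi).2 (ae_of_all _ fun u hu => (hpos u hu).le)
  · exact hint

end SumAsymptotics

/-! ### The horizontal walks -/

section Horizontal

open Topology

variable {d : ℕ}

theorem cosh_le_one_add_sq {x : ℝ} (hx : x ^ 2 ≤ 1) : Real.cosh x ≤ 1 + x ^ 2 := by
  refine (Real.cosh_le_exp_half_sq x).trans ?_
  have h0 : 0 ≤ x ^ 2 / 2 := by positivity
  have h1 : |x ^ 2 / 2| ≤ 1 := by rw [abs_of_nonneg h0]; linarith
  have h2 := (abs_le.1 (Real.abs_exp_sub_one_le h1)).2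
  rw [abs_of_nonneg h0] at h2
  linarith

theorem norm_cosh_add_mul_I_le (l t : ℝ) : ‖Complex.cosh (l + t * Complex.I)‖ ≤ Real.cosh l := by
  rw [Complex.cosh, norm_div, Complex.norm_ofNat, Real.cosh_eq]
  refine div_le_div_of_nonneg_right ((norm_add_le _ _).trans (le_of_eq ?_)) two_pos.le
  rw [Complex.norm_exp, Complex.norm_exp]
  simp

theorem re_cosh_add_mul_I (l t : ℝ) :
    (Complex.cosh (l + t * Complex.I)).re = Real.cosh l * Real.cos t := by
  rw [Complex.cosh_add, Complex.cosh_mul_I, Complex.sinh_mul_I]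
  simp [Complex.cosh_ofReal_re, Complex.sinh_ofReal_re, Complex.cos_ofReal_re,
    Complex.sin_ofReal_re, Complex.cosh_ofReal_im, Complex.sinh_ofReal_im, Complex.cos_ofReal_im,
    Complex.sin_ofReal_im]

theorem im_cosh_add_mul_I (l t : ℝ) :
    (Complex.cosh (l + t * Complex.I)).im = Real.sinh l * Real.sin t := by
  rw [Complex.cosh_add, Complex.cosh_mul_I, Complex.sinh_mul_I]
  simp [Complex.cosh_ofReal_re, Complex.sinh_ofReal_re, Complex.cos_ofReal_re,
    Complex.sin_ofReal_re, Complex.cosh_ofReal_im, Complex.sinh_ofReal_im, Complex.cos_ofReal_im,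
    Complex.sin_ofReal_im]

theorem cosh_mul_cos_le {l t : ℝ} (hl : l ^ 2 ≤ 1) (ht : |t| ≤ Real.pi) :
    Real.cosh l * Real.cos t ≤ 1 - 2 / Real.pi ^ 2 * t ^ 2 + l ^ 2 := by
  have h1 := Real.cos_le_one_sub_mul_cos_sq ht
  have h2 := cosh_le_one_add_sq hl
  have h3 := Real.one_le_cosh l
  have h4 := Real.cos_le_one t
  nlinarith

theorem tendsto_natCast_mul_cos_sub_one (t : ℝ) :
    Tendsto (fun n : ℕ => n * (Real.cos ((√n)⁻¹ * t) - 1)) atTop (𝓝 (-(t ^ 2 / 2))) := by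
  have h1 : Tendsto (fun n : ℕ => (√(n : ℝ))⁻¹ * t) atTop (𝓝 0) := by
    have : Tendsto (fun n : ℕ => (√(n : ℝ))⁻¹) atTop (𝓝 0) :=
      tendsto_inv_atTop_zero.comp (Real.tendsto_sqrt_atTop.comp tendsto_natCast_atTop_atTop)
    simpa using this.mul_const t
  have h2 : Tendsto (fun n : ℕ => t ^ 4 * (5 / 96) * (n : ℝ)⁻¹) atTop (𝓝 0) := by
    simpa using (tendsto_inv_atTop_zero.comp
      (tendsto_natCast_atTop_atTop (R := ℝ))).const_mul (t ^ 4 * (5 / 96))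
  rw [tendsto_iff_norm_sub_tendsto_zero]
  refine squeeze_zero' (Eventually.of_forall fun _ => norm_nonneg _) ?_ h2
  have h3 := h1.abs
  rw [abs_zero] at h3
  filter_upwards [h3.eventually_le_const one_pos, eventually_gt_atTop 0] with n hn hn0
  have hn' : (0 : ℝ) < n := by exact_mod_cast hn0
  have h4 := Real.cos_bound hn
  have h5 : ((√(n : ℝ))⁻¹ * t) ^ 2 = t ^ 2 / n := by
    rw [mul_pow, inv_pow, Real.sq_sqrt hn'.le, inv_mul_eq_div]
  have h6 : |(√(n : ℝ))⁻¹ * t| ^ 4 = t ^ 4 / n ^ 2 := by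
    rw [show 4 = 2 * 2 from rfl, pow_mul, sq_abs, h5]; ring
  rw [h5, h6] at h4
  have e : (n : ℝ) * (Real.cos ((√n)⁻¹ * t) - 1) - -(t ^ 2 / 2) =
      n * (Real.cos ((√n)⁻¹ * t) - (1 - t ^ 2 / n / 2)) := by
    field_simp
    ring
  rw [Real.norm_eq_abs, e, abs_mul, abs_of_pos hn']
  calc _ ≤ (n : ℝ) * (t ^ 4 / n ^ 2 * (5 / 96)) := by gcongr
    _ = _ := by field_simp

/-- The steps of the simple random walk on `ℤ^d`. -/
def nnStep (d : ℕ) : Fin d ⊕ Fin d → Fin d → ℤ :=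
  Sum.elim (fun i => Pi.single i 1) fun i => -Pi.single i 1

/-- The averaging operator of the simple random walk on `ℤ^d`. -/
noncomputable def nnOp (d : ℕ) : Module.End ℝ ((Fin d → ℤ) → ℝ) :=
  stepOp (fun _ => (2 * d : ℝ)⁻¹) (nnStep d)

/-- The characteristic function of the simple random walk on `ℤ^d`. -/
noncomputable def nnSymbol (lam θ : Fin d → ℝ) : ℂ :=
  stepSymbol (fun _ => (2 * d : ℝ)⁻¹) (nnStep d) lam θ

theorem tiltedChar_single (lam θ : Fin d → ℝ) (i : Fin d) :
    tiltedChar lam θ (Pi.single i 1) = Complex.exp (lam i + θ i * Complex.I) := by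
  rw [tiltedChar, Finset.sum_eq_single i]
  · simp
  · intro j _ hj
    simp [hj]
  · simp

theorem tiltedChar_neg_single (lam θ : Fin d → ℝ) (i : Fin d) :
    tiltedChar lam θ (-Pi.single i 1) = Complex.exp (-(lam i + θ i * Complex.I)) := by
  rw [tiltedChar, Finset.sum_eq_single i]
  · simp
  · intro j _ hj
    simp [hj]
  · simp

theorem nnSymbol_eq (lam θ : Fin d → ℝ) :
    nnSymbol lam θ = (d : ℂ)⁻¹ * ∑ i, Complex.cosh (lam i + θ i * Complex.I) := by
  rw [nnSymbol, stepSymbol, Fintype.sum_sum_type, ← Finset.sum_add_distrib, Finset.mul_sum]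
  refine Finset.sum_congr rfl fun i _ => ?_
  simp only [nnStep, Sum.elim_inl, Sum.elim_inr]
  rw [tiltedChar_single, tiltedChar_neg_single, Complex.cosh]
  push_cast
  rw [mul_inv]
  ring

theorem nnSymbol_zero (θ : Fin d → ℝ) :
    nnSymbol 0 θ = (((d : ℝ)⁻¹ * ∑ i, Real.cos (θ i) : ℝ) : ℂ) := by
  rw [nnSymbol_eq]
  push_cast
  congr 1
  refine Finset.sum_congr rfl fun i _ => ?_
  rw [Pi.zero_apply, Complex.ofReal_zero, zero_add, Complex.cosh_mul_I]

theorem inv_mul_sum_le [NeZero d] {f : Fin d → ℝ} {c : ℝ} (h : ∀ k, f k ≤ c) :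
    (d : ℝ)⁻¹ * ∑ i, f i ≤ c := by
  have hd : (0 : ℝ) < d := by exact_mod_cast NeZero.pos d
  rw [inv_mul_le_iff₀ hd]
  simpa using Finset.sum_le_sum (s := Finset.univ) fun k _ => h k

theorem sq_le_of_sum_sq_le {lam : Fin d → ℝ} {δ : ℝ} (h : ∑ i, lam i ^ 2 ≤ δ) (i : Fin d) :
    lam i ^ 2 ≤ δ :=
  (Finset.single_le_sum (f := fun k => lam k ^ 2) (fun _ _ => sq_nonneg _)
    (Finset.mem_univ i)).trans h

theorem norm_nnSymbol_le [NeZero d] {lam : Fin d → ℝ} {δ : ℝ} (hδ : δ ≤ 1)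
    (h : ∑ i, lam i ^ 2 ≤ δ) (θ : Fin d → ℝ) : ‖nnSymbol lam θ‖ ≤ 1 + δ := by
  have hd : (0 : ℝ) < d := by exact_mod_cast NeZero.pos d
  rw [nnSymbol_eq, norm_mul, norm_inv, Complex.norm_natCast]
  have h1 : ‖∑ i, Complex.cosh (lam i + θ i * Complex.I)‖ ≤ ∑ i, Real.cosh (lam i) :=
    (norm_sum_le _ _).trans (Finset.sum_le_sum fun i _ => norm_cosh_add_mul_I_le _ _)
  refine (mul_le_mul_of_nonneg_left h1 (by positivity)).trans (inv_mul_sum_le fun i => ?_)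
  have h2 := sq_le_of_sum_sq_le h i
  have h3 := cosh_le_one_add_sq (h2.trans hδ)
  linarith

theorem re_nnSymbol_le [NeZero d] {lam θ : Fin d → ℝ} (h : ∑ i, lam i ^ 2 ≤ 1)
    (hθ : θ ∈ dualCube d) : (nnSymbol lam θ).re ≤
      1 - 2 / (d * Real.pi ^ 2) * ∑ i, θ i ^ 2 + (d : ℝ)⁻¹ * ∑ i, lam i ^ 2 := by
  have hd : (0 : ℝ) < d := by exact_mod_cast NeZero.pos d
  have e : nnSymbol lam θ =
      ((d : ℝ)⁻¹ : ℝ) * ∑ i, Complex.cosh (lam i + θ i * Complex.I) := by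
    rw [nnSymbol_eq]; push_cast; rfl
  rw [e, Complex.re_ofReal_mul, Complex.re_sum]
  have h1 : ∑ i, (Complex.cosh (lam i + θ i * Complex.I)).re ≤
      ∑ i, (1 - 2 / Real.pi ^ 2 * θ i ^ 2 + lam i ^ 2) :=
    Finset.sum_le_sum fun i _ => by
      rw [re_cosh_add_mul_I]
      exact cosh_mul_cos_le (sq_le_of_sum_sq_le h i) (abs_le_pi_of_mem_dualCube hθ i)
  refine (mul_le_mul_of_nonneg_left h1 (by positivity)).trans (le_of_eq ?_)
  rw [Finset.sum_add_distrib, Finset.sum_sub_distrib, ← Finset.mul_sum]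
  simp only [Finset.sum_const, Finset.card_univ, Fintype.card_fin, nsmul_eq_mul, mul_one]
  field_simp

/-- The characteristic function of the horizontal displacement between two vertical moves. -/
noncomputable def geomSymbol (v : ℝ) (lam θ : Fin d → ℝ) : ℂ :=
  v / (1 - (1 - v) * nnSymbol lam θ)

/-- The law of the horizontal displacement until the `n`-th vertical move. -/
noncomputable def geomWalk (d : ℕ) (v : ℝ) (n : ℕ) (x : Fin d → ℤ) : ℝ :=
  ∑' j, ((j + (n - 1)).choose (n - 1) : ℝ) * v ^ n * (1 - v) ^ j *
    (nnOp d ^ j) (Pi.single 0 1) x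

variable {v : ℝ}

theorem nnOp_pow_single (b a : Fin d → ℤ) (j : ℕ) (lam : Fin d → ℝ) :
    (((nnOp d ^ j) (Pi.single b 1) a : ℝ) : ℂ) = ((2 * Real.pi : ℂ) ^ d)⁻¹ *
      ∫ θ in dualCube d, nnSymbol lam θ ^ j * tiltedChar lam θ (a - b) :=
  stepOp_pow_single _ _ _ _ _ _

theorem nnOp_pow_single_eq_sub (b a : Fin d → ℤ) (j : ℕ) :
    (nnOp d ^ j) (Pi.single b 1) a = (nnOp d ^ j) (Pi.single 0 1) (a - b) := by
  apply Complex.ofReal_injective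
  rw [nnOp_pow_single b a j 0, nnOp_pow_single 0 (a - b) j 0, sub_zero]

theorem continuous_nnSymbol (lam : Fin d → ℝ) : Continuous (nnSymbol lam) :=
  continuous_stepSymbol _ _ _

theorem one_sub_mul_lt_one (hv0 : 0 < v) : (1 - v) * (1 + v / 2) < 1 := by nlinarith

theorem norm_mul_nnSymbol_le [NeZero d] (hv0 : 0 < v) (hv1 : v < 1) {lam : Fin d → ℝ}
    (h : ∑ i, lam i ^ 2 ≤ v / 2) (θ : Fin d → ℝ) :
    ‖(1 - v : ℂ) * nnSymbol lam θ‖ ≤ (1 - v) * (1 + v / 2) := by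
  have h1 : ‖(1 - v : ℂ)‖ = 1 - v := by
    rw [← Complex.ofReal_one, ← Complex.ofReal_sub, Complex.norm_real,
      Real.norm_of_nonneg (by linarith)]
  rw [norm_mul, h1]
  exact mul_le_mul_of_nonneg_left (norm_nnSymbol_le (by linarith) h θ) (by linarith)

/-- The number of horizontal moves before the `(m + 1)`-st vertical one is negative binomial, and `∑
j, (j + m).choose m * z ^ j = (1 - z) ^ (-(m + 1))`. For a small tilt `(1 - v) * nnSymbol` stays in
a disc of radius less than `1`, which permits summation under the integral. -/
theorem hasSum_geomWalk_fourier [NeZero d] (hv0 : 0 < v) (hv1 : v < 1) {lam : Fin d → ℝ}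
    (h : ∑ i, lam i ^ 2 ≤ v / 2) (m : ℕ) (x : Fin d → ℤ) :
    HasSum (fun j : ℕ => ((((j + m).choose m : ℝ) * v ^ (m + 1) * (1 - v) ^ j *
      (nnOp d ^ j) (Pi.single 0 1) x : ℝ) : ℂ)) (((2 * Real.pi : ℂ) ^ d)⁻¹ *
        ∫ θ in dualCube d, geomSymbol v lam θ ^ (m + 1) * tiltedChar lam θ x) := by
  set ρ := (1 - v) * (1 + v / 2) with hρ
  have hρ1 : ρ < 1 := one_sub_mul_lt_one hv0
  have hρ0 : 0 ≤ ρ := mul_nonneg (by linarith) (by linarith)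
  have hρn : ‖ρ‖ < 1 := by rwa [Real.norm_of_nonneg hρ0]
  have hsymb := norm_mul_nnSymbol_le hv0 hv1 h
  set F : ℕ → (Fin d → ℝ) → ℂ := fun j θ => ((j + m).choose m : ℂ) *
    ((1 - v) * nnSymbol lam θ) ^ j * (v ^ (m + 1) * tiltedChar lam θ x) with hF
  have hFc : ∀ j, Continuous (F j) := fun j =>
    (continuous_const.mul ((continuous_const.mul (continuous_nnSymbol lam)).pow j)).mul
      (continuous_const.mul (continuous_tiltedChar lam x))
  have hfin : volume (dualCube d) ≠ ⊤ := by
    rw [dualCube, Real.volume_pi_Ioc]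
    exact ENNReal.prod_ne_top fun i _ => ENNReal.ofReal_ne_top
  have key : HasSum (fun j => ∫ θ in dualCube d, F j θ)
      (∫ θ in dualCube d, geomSymbol v lam θ ^ (m + 1) * tiltedChar lam θ x) := by
    refine hasSum_integral_of_dominated_convergence (fun j _ => ((j + m).choose m : ℝ) * ρ ^ j *
      (v ^ (m + 1) * Real.exp (∑ i, lam i * x i))) (fun j => (hFc j).aestronglyMeasurable)
      (fun j => ae_of_all _ fun θ => ?_) (ae_of_all _ fun θ => ?_) ?_ (ae_of_all _ fun θ => ?_)
    · simp only [hF, norm_mul, norm_pow, Complex.norm_natCast, norm_tiltedChar, Complex.norm_real,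
        Real.norm_of_nonneg hv0.le]
      rw [← norm_mul]
      gcongr
      exact hsymb θ
    · exact (summable_choose_mul_geometric_of_norm_lt_one m hρn).mul_right _
    · exact integrableOn_const hfin
    · have h1 := hasSum_choose_mul_geometric_of_norm_lt_one m ((hsymb θ).trans_lt hρ1)
      have h2 := h1.mul_right (v ^ (m + 1) * tiltedChar lam θ x)
      have e : 1 / (1 - (1 - v) * nnSymbol lam θ) ^ (m + 1) * (v ^ (m + 1) * tiltedChar lam θ x) =
          geomSymbol v lam θ ^ (m + 1) * tiltedChar lam θ x := by
        rw [geomSymbol, div_pow]; ring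
      rw [← e]
      exact h2
  refine HasSum.congr_fun (key.mul_left (((2 * Real.pi : ℂ) ^ d)⁻¹)) fun j => ?_
  simp only [hF]
  push_cast
  rw [nnOp_pow_single 0 x j lam, sub_zero, ← integral_const_mul, ← integral_const_mul,
    ← integral_const_mul]
  congr 1
  ext θ
  rw [mul_pow (1 - (v : ℂ))]
  ring

theorem summable_geomWalk [NeZero d] (hv0 : 0 < v) (hv1 : v < 1) (m : ℕ) (x : Fin d → ℤ) :
    Summable fun j : ℕ => ((j + m).choose m : ℝ) * v ^ (m + 1) * (1 - v) ^ j *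
      (nnOp d ^ j) (Pi.single 0 1) x :=
  Complex.summable_ofReal.1
    (hasSum_geomWalk_fourier hv0 hv1 (lam := 0) (by simp; linarith) m x).summable

theorem geomWalk_eq_fourier [NeZero d] (hv0 : 0 < v) (hv1 : v < 1) {lam : Fin d → ℝ}
    (h : ∑ i, lam i ^ 2 ≤ v / 2) (n : ℕ) (x : Fin d → ℤ) (hn : n ≠ 0) :
    (geomWalk d v n x : ℂ) = ((2 * Real.pi : ℂ) ^ d)⁻¹ *
      ∫ θ in dualCube d, geomSymbol v lam θ ^ n * tiltedChar lam θ x := by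
  obtain ⟨m, rfl⟩ := Nat.exists_eq_succ_of_ne_zero hn
  rw [← (hasSum_geomWalk_fourier hv0 hv1 h m x).tsum_eq, ← Complex.ofReal_tsum]
  rfl

theorem geomSymbol_zero (v : ℝ) (θ : Fin d → ℝ) : geomSymbol v 0 θ =
    ((v / (1 - (1 - v) * ((d : ℝ)⁻¹ * ∑ i, Real.cos (θ i))) : ℝ) : ℂ) := by
  rw [geomSymbol, nnSymbol_zero]
  push_cast
  rfl

theorem one_sub_mul_nnSymbol_ne_zero [NeZero d] (hv0 : 0 < v) (hv1 : v < 1) {lam : Fin d → ℝ}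
    (h : ∑ i, lam i ^ 2 ≤ v / 2) (θ : Fin d → ℝ) : (1 - (1 - v) * nnSymbol lam θ : ℂ) ≠ 0 := by
  intro h0
  have h1 := norm_mul_nnSymbol_le hv0 hv1 h θ
  rw [← sub_eq_zero.1 h0, norm_one] at h1
  linarith [one_sub_mul_lt_one hv0]

theorem continuous_geomSymbol [NeZero d] (hv0 : 0 < v) (hv1 : v < 1) :
    Continuous (geomSymbol (d := d) v 0) :=
  continuous_const.div (continuous_const.sub (continuous_const.mul (continuous_nnSymbol 0)))
    (one_sub_mul_nnSymbol_ne_zero hv0 hv1 (by simp; linarith))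

/-- Only an upper bound for the real part of `nnSymbol` is needed to bound the denominator below. So
the value `-1` taken by the simple random walk at the corner of the cube, which reflects its
periodicity, is harmless for the geometric mixture. -/
theorem exists_norm_geomSymbol_le [NeZero d] (hv0 : 0 < v) (hv1 : v < 1) :
    ∃ c > 0, ∃ C, ∀ lam : Fin d → ℝ, ∑ i, lam i ^ 2 ≤ v / 2 → ∀ θ ∈ dualCube d,
      ‖geomSymbol v lam θ‖ ≤ Real.exp (-c * ∑ i, θ i ^ 2 + C * ∑ i, lam i ^ 2) := by
  have hd : (1 : ℝ) ≤ d := by exact_mod_cast NeZero.one_le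
  -- The denominator is at least `v * (1 + α) * (1 - β)` with `α = q * ∑ i, θ i ^ 2`. On the cube `1
  -- + α ≤ M`, which is what turns `1 + α` into an exponential with rate `q / M`.
  set q := (1 - v) * (2 / (d * Real.pi ^ 2)) / v with hq
  have hq0 : 0 < q := by
    have : 0 < 1 - v := by linarith
    have := Real.pi_pos
    positivity
  set M := 1 + q * (d * Real.pi ^ 2) with hM
  have hM0 : 0 < M := by have := Real.pi_pos; positivity
  refine ⟨q / M, by positivity, 2 / v, fun lam h θ hθ => ?_⟩
  set T := ∑ i, θ i ^ 2 with hT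
  set Λ := ∑ i, lam i ^ 2 with hΛ
  have hT0 : 0 ≤ T := Finset.sum_nonneg fun i _ => sq_nonneg _
  have hΛ0 : 0 ≤ Λ := Finset.sum_nonneg fun i _ => sq_nonneg _
  have hTM : T ≤ d * Real.pi ^ 2 := by
    have : T ≤ ∑ _i : Fin d, Real.pi ^ 2 := Finset.sum_le_sum fun i _ => by
      have := abs_le_pi_of_mem_dualCube hθ i
      rw [← sq_abs]
      gcongr
    simpa using this
  have hre := re_nnSymbol_le (by linarith : ∑ i, lam i ^ 2 ≤ 1) hθ
  rw [← hT, ← hΛ] at hre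
  have hdΛ : (d : ℝ)⁻¹ * Λ ≤ Λ := mul_le_of_le_one_left hΛ0 (inv_le_one_of_one_le₀ hd)
  set α := q * T with hα
  set β := Λ / v with hβ
  have hα0 : 0 ≤ α := by positivity
  have hβ0 : 0 ≤ β := by positivity
  have hβ1 : β ≤ 1 / 2 := by rw [hβ, div_le_iff₀ hv0]; linarith
  have hden : v * ((1 + α) * (1 - β)) ≤ ‖(1 - (1 - v) * nnSymbol lam θ : ℂ)‖ := by
    refine le_trans ?_ (Complex.re_le_norm _)
    have e : (1 - (1 - v) * nnSymbol lam θ : ℂ).re = 1 - (1 - v) * (nnSymbol lam θ).re := by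
      rw [← Complex.ofReal_one, ← Complex.ofReal_sub, Complex.sub_re, Complex.re_ofReal_mul,
        Complex.ofReal_re]
    rw [e]
    have h1 : (1 - v) * (nnSymbol lam θ).re ≤
        (1 - v) * (1 - 2 / (d * Real.pi ^ 2) * T + Λ) :=
      mul_le_mul_of_nonneg_left (by linarith) (by linarith)
    have h2 : v * α = (1 - v) * (2 / (d * Real.pi ^ 2)) * T := by rw [hα, hq]; field_simp
    have h3 : v * β = Λ := by rw [hβ]; field_simp
    have h4 : 0 ≤ v * (α * β) := by positivity
    have h5 : (1 - v) * Λ ≤ Λ := by nlinarith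
    nlinarith
  have hα1 : Real.exp (q / M * T) ≤ 1 + α := by
    have h1 : α / M ≤ α / (1 + α) := by
      refine div_le_div_of_nonneg_left hα0 (by positivity) ?_
      rw [hM, hα]
      gcongr
    have h2 := Real.add_one_le_exp (-(α / (1 + α)))
    have h3 : -(α / (1 + α)) + 1 = (1 + α)⁻¹ := by field_simp; ring
    rw [h3, Real.exp_neg] at h2
    have h4 := (inv_le_inv₀ (by positivity) (Real.exp_pos _)).1 h2
    refine le_trans (Real.exp_le_exp.2 ?_) h4
    rw [div_mul_eq_mul_div]
    exact h1
  have hβ2 : Real.exp (-(2 * β)) ≤ 1 - β := by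
    have h2 := Real.add_one_le_exp (2 * β)
    rw [Real.exp_neg, inv_le_comm₀ (Real.exp_pos _) (by linarith)]
    refine le_trans ?_ h2
    rw [inv_le_iff_one_le_mul₀ (by linarith)]
    nlinarith
  have hexp : Real.exp (q / M * T) * Real.exp (-(2 * β)) ≤ (1 + α) * (1 - β) := by gcongr
  rw [geomSymbol, norm_div, Complex.norm_real, Real.norm_of_nonneg hv0.le]
  have hpos : 0 < v * ((1 + α) * (1 - β)) :=
    mul_pos hv0 (mul_pos (by linarith) (by linarith))
  refine (div_le_div_of_nonneg_left hv0.le hpos hden).trans ?_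
  rw [div_mul_cancel_left₀ hv0.ne']
  have e : -(q / M) * T + 2 / v * Λ = -(q / M * T + -(2 * β)) := by rw [hβ]; ring
  rw [e, Real.exp_neg, Real.exp_add]
  exact inv_anti₀ (by positivity) hexp

theorem tendsto_geomSymbol_pow [NeZero d] (hv0 : 0 < v) (θ : Fin d → ℝ) :
    Tendsto (fun n : ℕ => geomSymbol v 0 ((√n)⁻¹ • θ) ^ n) atTop
      (𝓝 ((Real.exp (-((1 - v) / (2 * d * v)) * ∑ i, θ i ^ 2) : ℝ) : ℂ)) := by
  have hd : (d : ℝ) ≠ 0 := by exact_mod_cast NeZero.ne d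
  set f : ℕ → ℝ := fun n => (d : ℝ)⁻¹ * ∑ i, Real.cos ((√n)⁻¹ * θ i) with hf
  have hnf : Tendsto (fun n : ℕ => n * (f n - 1)) atTop
      (𝓝 ((d : ℝ)⁻¹ * ∑ i, -(θ i ^ 2 / 2))) := by
    refine ((tendsto_finsetSum Finset.univ fun i _ =>
      tendsto_natCast_mul_cos_sub_one (θ i)).const_mul (d : ℝ)⁻¹).congr fun n => ?_
    simp only [hf]
    rw [← Finset.mul_sum, Finset.sum_sub_distrib]
    simp only [Finset.sum_const, Finset.card_univ, Fintype.card_fin, nsmul_eq_mul, mul_one]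
    field_simp
  have hf1 : Tendsto f atTop (𝓝 1) := by
    have h1 := hnf.mul (tendsto_inv_atTop_zero.comp (tendsto_natCast_atTop_atTop (R := ℝ)))
    rw [mul_zero] at h1
    have h2 := h1.add_const 1
    rw [zero_add] at h2
    refine h2.congr' ?_
    filter_upwards [eventually_ne_atTop 0] with n hn
    have : (n : ℝ) ≠ 0 := by exact_mod_cast hn
    simp only [Function.comp]
    field_simp
    ring
  have hden : Tendsto (fun n => 1 - (1 - v) * f n) atTop (𝓝 v) := by
    have := (hf1.const_mul (1 - v)).const_sub 1
    simpa using this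
  have hlim : Tendsto (fun n : ℕ => n * (v / (1 - (1 - v) * f n) - 1)) atTop
      (𝓝 (-((1 - v) / (2 * d * v)) * ∑ i, θ i ^ 2)) := by
    have h1 := ((hnf.const_mul (1 - v)).div hden hv0.ne')
    have e : (1 - v) * ((d : ℝ)⁻¹ * ∑ i, -(θ i ^ 2 / 2)) / v =
        -((1 - v) / (2 * d * v)) * ∑ i, θ i ^ 2 := by
      rw [Finset.sum_neg_distrib, ← Finset.sum_div]
      field_simp
    rw [e] at h1
    refine h1.congr' ?_
    filter_upwards [hden.eventually_ne hv0.ne'] with n hn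
    simp only [Pi.div_apply]
    field_simp
    ring
  have h2 := Real.tendsto_one_add_pow_exp_of_tendsto hlim
  refine ((Complex.continuous_ofReal.tendsto _).comp h2).congr fun n => ?_
  simp only [Function.comp]
  rw [geomSymbol_zero, ← Complex.ofReal_pow]
  simp only [Pi.smul_apply, smul_eq_mul, hf]
  congr 2
  ring

end Horizontal

/-! ### Return-time series for the two horizontal walks. -/

section HorizontalSums

open Topology

variable {d : ℕ}

theorem gaussConst_pos (d : ℕ) {σ : ℝ} (hσ : 0 < σ) : 0 < gaussConst d σ := by
  have := Real.pi_pos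
  unfold gaussConst
  positivity

theorem exists_tendsto_tsum_of_fourier {G : (Fin d → ℝ) → (Fin d → ℝ) → ℂ}
    {P : ℕ → (Fin d → ℤ) → ℝ} {c C δ σ : ℝ} (hc : 0 < c) (hδ : 0 < δ) (hσ : 0 < σ)
    (hGc : Continuous (G 0))
    (hG : ∀ lam : Fin d → ℝ, ∑ i, lam i ^ 2 ≤ δ → ∀ θ ∈ dualCube d,
      ‖G lam θ‖ ≤ Real.exp (-c * ∑ i, θ i ^ 2 + C * ∑ i, lam i ^ 2))
    (hlim : ∀ θ, Tendsto (fun n : ℕ => G 0 ((√n)⁻¹ • θ) ^ n) atTop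
      (𝓝 ((Real.exp (-σ * ∑ i, θ i ^ 2) : ℝ) : ℂ)))
    (hP : ∀ lam : Fin d → ℝ, ∑ i, lam i ^ 2 ≤ δ → ∀ n x, n ≠ 0 →
      (P n x : ℂ) = ((2 * Real.pi : ℂ) ^ d)⁻¹ *
        ∫ θ in dualCube d, G lam θ ^ n * tiltedChar lam θ x)
    {t : ℕ → ℝ} {κ L : ℝ} (hκ : 0 < κ) (hL : 0 < L)
    (ht : Tendsto (fun j : ℕ => (j : ℝ) ^ (κ + 1) * t j) atTop (𝓝 L))
    {α : ℕ} (hα : α ≠ 0) {X : Type*} {l : Filter X} [l.IsCountablyGenerated]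
    {x : X → Fin d → ℤ} (hx : Tendsto (fun p => √(∑ i, (x p i : ℝ) ^ 2)) l atTop) :
    ∃ A > 0, Tendsto (fun p => √(∑ i, (x p i : ℝ) ^ 2) ^ ((d : ℝ) + 2 * κ) *
      ∑' j, t j * P (α * j + 1) (x p)) l (𝓝 A) := by
  obtain ⟨K, hK⟩ := exists_abs_le_of_fourier hc hδ hG hP
  have h0 : ∑ i, (0 : Fin d → ℝ) i ^ 2 ≤ δ := by simpa using hδ.le
  obtain ⟨ε, hε, hPl⟩ := tendsto_fourier_sub_gaussian hc hσ hGc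
    (fun θ hθ => by simpa using hG 0 h0 θ hθ) hlim (hP 0 h0)
  have hα' : (0 : ℝ) < α := by positivity
  -- The weights are renormalized by the actual number `α * j + 1` of horizontal steps, at the price
  -- of a factor `α ^ (κ + 1)`.
  have ht' : Tendsto (fun j : ℕ => ((α * j + 1 : ℕ) : ℝ) ^ (κ + 1) * t j) atTop
      (𝓝 ((α : ℝ) ^ (κ + 1) * L)) := by
    have h1 : Tendsto (fun j : ℕ => (α : ℝ) + (j : ℝ)⁻¹) atTop (𝓝 α) := by
      simpa using (tendsto_inv_atTop_zero.comp
        (tendsto_natCast_atTop_atTop (R := ℝ))).const_add (α : ℝ)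
    refine ((h1.rpow_const (p := κ + 1) (Or.inl hα'.ne')).mul ht).congr' ?_
    filter_upwards [eventually_gt_atTop 0] with j hj
    have hj' : (0 : ℝ) < j := by exact_mod_cast hj
    rw [← mul_assoc, ← Real.mul_rpow (by positivity) hj'.le]
    congr 2
    push_cast
    field_simp
  have hsq : ∀ y : Fin d → ℤ, √(∑ i, (y i : ℝ) ^ 2) ^ 2 = ∑ i, (y i : ℝ) ^ 2 := fun y =>
    Real.sq_sqrt (Finset.sum_nonneg fun i _ => sq_nonneg _)
  have key := tendsto_tsum_of_local_limit (P := fun n p => P n (x p)) (ς := σ) hx hκ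
    (by positivity : (0 : ℝ) ≤ (d : ℝ) / 2) (Real.sqrt_pos.2 hδ) hα ht'
    (fun n p hn => hK n (x p) hn) hε (fun n p hn => by rw [hsq]; exact hPl n (x p) hn)
  refine ⟨_, integral_rpow_mul_exp_pos ?_ ?_ (gaussConst_pos d hσ) hα' ?_,
    by rwa [mul_div_cancel₀ _ (two_ne_zero' ℝ)] at key⟩
  · have : (0 : ℝ) ≤ (d : ℝ) / 2 := by positivity
    linarith
  · positivity
  · positivity

theorem exists_tendsto_tsum_geomWalk [NeZero d] {v : ℝ} (hv0 : 0 < v) (hv1 : v < 1)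
    {t : ℕ → ℝ} {κ L : ℝ} (hκ : 0 < κ) (hL : 0 < L)
    (ht : Tendsto (fun j : ℕ => (j : ℝ) ^ (κ + 1) * t j) atTop (𝓝 L))
    {X : Type*} {l : Filter X} [l.IsCountablyGenerated]
    {x : X → Fin d → ℤ} (hx : Tendsto (fun p => √(∑ i, (x p i : ℝ) ^ 2)) l atTop) :
    ∃ A > 0, Tendsto (fun p => √(∑ i, (x p i : ℝ) ^ 2) ^ ((d : ℝ) + 2 * κ) *
      ∑' j, t j * geomWalk d v (2 * j + 1) (x p)) l (𝓝 A) := by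
  obtain ⟨c, hc, C, hC⟩ := exists_norm_geomSymbol_le (d := d) hv0 hv1
  have hd : (0 : ℝ) < d := by exact_mod_cast NeZero.pos d
  have : 0 < 1 - v := by linarith
  exact exists_tendsto_tsum_of_fourier hc (by positivity : 0 < v / 2)
    (by positivity : 0 < (1 - v) / (2 * d * v)) (continuous_geomSymbol hv0 hv1) hC
    (tendsto_geomSymbol_pow hv0) (fun lam h n x hn => geomWalk_eq_fourier hv0 hv1 h n x hn)
    hκ hL ht two_ne_zero hx

/-- The averaging operator of the lazy simple random walk on `ℤ`. -/
noncomputable def lazyOp : Module.End ℝ ((Fin 1 → ℤ) → ℝ) :=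
  stepOp (ι := Fin 3) ![1 / 4, 1 / 2, 1 / 4] ![1, 0, -1]

/-- The characteristic function of the lazy simple random walk on `ℤ`. -/
noncomputable def lazySymbol (lam θ : Fin 1 → ℝ) : ℂ :=
  stepSymbol (ι := Fin 3) ![1 / 4, 1 / 2, 1 / 4] ![1, 0, -1] lam θ

theorem lazyOp_apply (h : (Fin 1 → ℤ) → ℝ) (x : Fin 1 → ℤ) :
    lazyOp h x = 1 / 4 * h (x + 1) + 1 / 2 * h x + 1 / 4 * h (x - 1) := by
  rw [lazyOp, stepOp_apply, Fin.sum_univ_three]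
  simp [sub_eq_add_neg]

theorem lazySymbol_eq (lam θ : Fin 1 → ℝ) :
    lazySymbol lam θ = (1 + Complex.cosh (lam 0 + θ 0 * Complex.I)) / 2 := by
  rw [lazySymbol, stepSymbol, Fin.sum_univ_three, Complex.cosh]
  simp [tiltedChar]
  ring

/-- From `1 + cosh z = 2 * cosh (z / 2) ^ 2` one has `|1 + cosh (l + i t)| = cosh l + cos t`.
Laziness thus makes the untilted symbol nonnegative, with no second point of modulus `1` at `π`. -/
theorem norm_lazySymbol (lam θ : Fin 1 → ℝ) :
    ‖lazySymbol lam θ‖ = (Real.cos (θ 0) + Real.cosh (lam 0)) / 2 := by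
  rw [lazySymbol_eq, norm_div, Complex.norm_ofNat]
  congr 1
  have h0 : 0 ≤ Real.cos (θ 0) + Real.cosh (lam 0) := by
    linarith [Real.neg_one_le_cos (θ 0), Real.one_le_cosh (lam 0)]
  rw [← Real.sqrt_sq h0, Complex.norm_def, Complex.normSq_apply, Complex.add_re, Complex.add_im,
    re_cosh_add_mul_I, im_cosh_add_mul_I, Complex.one_re, Complex.one_im]
  congr 1
  have h1 := Real.cosh_sq (lam 0)
  have h2 := Real.sin_sq_add_cos_sq (θ 0)
  linear_combination (-Real.sin (θ 0) ^ 2 ) * h1 + (Real.cosh (lam 0) ^ 2 - 1) * h2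

theorem norm_lazySymbol_le {lam θ : Fin 1 → ℝ} (h : ∑ i, lam i ^ 2 ≤ 1) (hθ : θ ∈ dualCube 1) :
    ‖lazySymbol lam θ‖ ≤
      Real.exp (-(1 / Real.pi ^ 2) * ∑ i, θ i ^ 2 + 1 / 2 * ∑ i, lam i ^ 2) := by
  rw [norm_lazySymbol]
  simp only [Fin.sum_univ_one] at h ⊢
  refine le_trans ?_ (Real.add_one_le_exp _)
  have h1 := Real.cos_le_one_sub_mul_cos_sq (abs_le_pi_of_mem_dualCube hθ 0)
  have h2 := cosh_le_one_add_sq h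
  rw [div_mul_eq_mul_div] at h1
  rw [neg_mul, div_mul_eq_mul_div, one_mul]
  have h3 : 2 * θ 0 ^ 2 / Real.pi ^ 2 = 2 * (θ 0 ^ 2 / Real.pi ^ 2) := by ring
  linarith

theorem tendsto_lazySymbol_pow (θ : Fin 1 → ℝ) :
    Tendsto (fun n : ℕ => lazySymbol 0 ((√n)⁻¹ • θ) ^ n) atTop
      (𝓝 ((Real.exp (-(1 / 4) * ∑ i, θ i ^ 2) : ℝ) : ℂ)) := by
  have h1 := (tendsto_natCast_mul_cos_sub_one (θ 0)).const_mul (1 / 2)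
  have e : 1 / 2 * -(θ 0 ^ 2 / 2) = -(1 / 4) * ∑ i, θ i ^ 2 := by
    rw [Fin.sum_univ_one]; ring
  rw [e] at h1
  have h2 := Real.tendsto_one_add_pow_exp_of_tendsto
    (g := fun n : ℕ => 1 / 2 * (Real.cos ((√n)⁻¹ * θ 0) - 1)) (h1.congr fun n => by ring)
  refine ((Complex.continuous_ofReal.tendsto _).comp h2).congr fun n => ?_
  simp only [Function.comp]
  rw [lazySymbol_eq]
  simp only [Pi.zero_apply, Pi.smul_apply, smul_eq_mul, Complex.ofReal_zero, zero_add,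
    Complex.cosh_mul_I]
  push_cast
  congr 1
  ring

theorem exists_tendsto_tsum_lazyOp {t : ℕ → ℝ} {κ L : ℝ} (hκ : 0 < κ) (hL : 0 < L)
    (ht : Tendsto (fun j : ℕ => (j : ℝ) ^ (κ + 1) * t j) atTop (𝓝 L))
    {X : Type*} {l : Filter X} [l.IsCountablyGenerated]
    {x : X → Fin 1 → ℤ} (hx : Tendsto (fun p => √(∑ i, (x p i : ℝ) ^ 2)) l atTop) :
    ∃ A > 0, Tendsto (fun p => √(∑ i, (x p i : ℝ) ^ 2) ^ ((1 : ℕ) + 2 * κ) *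
      ∑' j, t j * (lazyOp ^ (1 * j + 1)) (Pi.single 0 1) (x p)) l (𝓝 A) := by
  have := Real.pi_pos
  refine exists_tendsto_tsum_of_fourier (G := lazySymbol)
    (P := fun n => (lazyOp ^ n) (Pi.single 0 1))
    (by positivity : 0 < 1 / Real.pi ^ 2) one_pos
    (by norm_num : (0 : ℝ) < 1 / 4) (continuous_stepSymbol _ _ _)
    (fun lam h θ hθ => norm_lazySymbol_le h hθ) tendsto_lazySymbol_pow
    (fun lam h n x hn => ?_) hκ hL ht one_ne_zero hx
  have := stepOp_pow_single (ι := Fin 3) ![1 / 4, 1 / 2, 1 / 4] ![1, 0, -1] lam 0 n x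
  rwa [sub_zero] at this

end HorizontalSums

/-! ### First return probabilities as series -/

section ReturnSeries

/-- `F n` is the `n`-th killed iterate, cut to `0` on `A` so that it can be computed in real numbers
from a recursion valid only off `A`. The starting point may lie in `A`; hence the first step is kept
apart, and the initial term is a return at time `1`. -/
theorem returnProb_eq_of_real {S : Type*} [MeasurableSpace S] (κ : Kernel S S) [IsMarkovKernel κ]
    {A B : Set S} (hA : MeasurableSet A) (hB : MeasurableSet B) {E : (S → ℝ) → S → ℝ}
    (hE : ∀ F : S → ℝ, 0 ≤ F → ∀ z, ∫⁻ w, ENNReal.ofReal (F w) ∂κ z = ENNReal.ofReal (E F z))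
    {F : ℕ → S → ℝ} (hF : ∀ n, 0 ≤ F n) (hFA : ∀ n, ∀ z ∈ A, F n z = 0)
    (hF0 : ∀ z ∉ A, F 0 z = E ((A ∩ B).indicator 1) z)
    (hFs : ∀ n, ∀ z ∉ A, F (n + 1) z = E (F n) z) (x : S) :
    returnProb κ x A B = (ENNReal.ofReal (E ((A ∩ B).indicator 1) x) +
      ∑' n, ENNReal.ofReal (E (F n) x)).toReal := by
  have hg : ∀ z, κ z (A ∩ B) = ENNReal.ofReal (E ((A ∩ B).indicator 1) z) := by
    intro z
    rw [← hE ((A ∩ B).indicator 1) (Set.indicator_nonneg fun _ _ => zero_le_one),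
      ← lintegral_indicator_one (hA.inter hB)]
    refine lintegral_congr fun w => ?_
    by_cases hw : w ∈ A ∩ B
    · simp only [Set.indicator_of_mem hw, Pi.one_apply, ENNReal.ofReal_one]
    · simp only [Set.indicator_of_notMem hw, ENNReal.ofReal_zero]
  have hind : ∀ n, Aᶜ.indicator ((killedOp κ A)^[n] fun y => κ y (A ∩ B)) =
      fun z => ENNReal.ofReal (F n z) := by
    intro n
    induction n with
    | zero =>
      ext z
      by_cases hz : z ∈ A
      · rw [Set.indicator_of_notMem (Set.notMem_compl_iff.2 hz), hFA 0 z hz, ENNReal.ofReal_zero]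
      · rw [Set.indicator_of_mem (Set.mem_compl hz), hF0 z hz]
        exact hg z
    | succ n ih =>
      ext z
      by_cases hz : z ∈ A
      · rw [Set.indicator_of_notMem (Set.notMem_compl_iff.2 hz), hFA (n + 1) z hz, ENNReal.ofReal_zero]
      · rw [Set.indicator_of_mem (Set.mem_compl hz), Function.iterate_succ_apply', killedOp, ih,
          hE _ (hF n), hFs n z hz]
  rw [returnProb_eq_tsum κ hA hB, tsum_eq_zero_add' ENNReal.summable]
  congr 2
  · exact hg x
  · refine tsum_congr fun n => ?_
    rw [Function.iterate_succ_apply', killedOp, hind, hE _ (hF n)]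

theorem toReal_tsum_ofReal_two_mul {f : ℕ → ℝ} (hf : ∀ n, 0 ≤ f n) (hodd : ∀ j, f (2 * j + 1) = 0) :
    (∑' n, ENNReal.ofReal (f n)).toReal = ∑' j, f (2 * j) := by
  rw [← tsum_even_add_odd ENNReal.summable ENNReal.summable]
  simp only [hodd, ENNReal.ofReal_zero, tsum_zero, add_zero]
  rw [ENNReal.tsum_toReal_eq fun _ => ENNReal.ofReal_ne_top]
  exact tsum_congr fun j => ENNReal.toReal_ofReal (hf _)

theorem lintegral_bernoulliMeasure {X : Type*} [MeasurableSpace X] [DiscreteMeasurableSpace X]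
    (x y : X) (p : unitInterval) (f : X → ℝ≥0∞) :
    ∫⁻ z, f z ∂bernoulliMeasure x y p =
      ENNReal.ofReal p * f x + ENNReal.ofReal (1 - p) * f y := by
  rw [bernoulliMeasure_def, lintegral_add_measure, lintegral_smul_measure, lintegral_smul_measure,
    lintegral_dirac, lintegral_dirac]
  congr 2
  · rw [Real.toNNReal_of_nonneg p.2.1]; rfl
  · rw [Real.toNNReal_of_nonneg (by linarith [p.2.2])]; rfl

theorem lintegral_besselStep {s : ℝ} (hs : -1 < s) (r : ℕ) (f : ℕ → ℝ≥0∞) :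
    ∫⁻ y, f y ∂besselStep s hs r = ENNReal.ofReal (upProb s r) * f (r + 1) +
      ENNReal.ofReal (1 - upProb s r) * f (r - 1) :=
  lintegral_bernoulliMeasure _ _ _ _

theorem ofReal_convexComb {p a b : ℝ} (h : p ∈ unitInterval) (ha : 0 ≤ a) (hb : 0 ≤ b) :
    ENNReal.ofReal p * ENNReal.ofReal a + ENNReal.ofReal (1 - p) * ENNReal.ofReal b =
      ENNReal.ofReal (p * a + (1 - p) * b) := by
  have h1 : 0 ≤ 1 - p := by linarith [h.2]
  rw [ENNReal.ofReal_add (mul_nonneg h.1 ha) (mul_nonneg h1 hb), ENNReal.ofReal_mul h.1,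
    ENNReal.ofReal_mul h1]

/-- The operator of the Bessel walk, acting on functions. -/
noncomputable def besselOp (s : ℝ) (φ : ℕ → ℝ) (r : ℕ) : ℝ :=
  upProb s r * φ (r + 1) + (1 - upProb s r) * φ (r - 1)

theorem besselOp_nonneg {s : ℝ} (hs : -1 < s) {φ : ℕ → ℝ} (hφ : ∀ r, 0 ≤ φ r) (r : ℕ) :
    0 ≤ besselOp s φ r := by
  have h1 := upProb_mem hs r
  have h2 : 0 ≤ 1 - upProb s r := by linarith [h1.2]
  exact add_nonneg (mul_nonneg h1.1 (hφ _)) (mul_nonneg h2 (hφ _))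

theorem besselOp_of_ne_zero (s : ℝ) (φ : ℕ → ℝ) {r : ℕ} (hr : r ≠ 0) :
    besselOp s φ r = killedStep s φ r := by
  obtain ⟨x, rfl⟩ := Nat.exists_eq_succ_of_ne_zero hr
  rw [Nat.succ_eq_add_one, killedStep_succ]
  rfl

theorem besselOp_zero (s : ℝ) (φ : ℕ → ℝ) : besselOp s φ 0 = φ 1 := by
  simp [besselOp, upProb_zero]

theorem lintegral_besselStep_ofReal {s : ℝ} (hs : -1 < s) (r : ℕ) {φ : ℕ → ℝ}
    (hφ : ∀ r, 0 ≤ φ r) :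
    ∫⁻ y, ENNReal.ofReal (φ y) ∂besselStep s hs r = ENNReal.ofReal (besselOp s φ r) := by
  rw [lintegral_besselStep, ofReal_convexComb (upProb_mem hs r) (hφ _) (hφ _)]
  rfl

theorem killedStep_pow_nonneg {s : ℝ} (hs : -1 < s) (n : ℕ) {φ : ℕ → ℝ} (hφ : 0 ≤ φ) :
    0 ≤ (killedStep s ^ n) φ := by
  induction n with
  | zero => exact hφ
  | succ n ih =>
    rw [pow_succ', Module.End.mul_apply]
    have := killedStep_mono hs ih
    rwa [map_zero] at this

theorem killedStep_pow_apply_zero (s : ℝ) (n : ℕ) {φ : ℕ → ℝ} (hφ : φ 0 = 0) :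
    (killedStep s ^ n) φ 0 = 0 := by
  cases n with
  | zero => exact hφ
  | succ n =>
    rw [pow_succ', Module.End.mul_apply, killedStep_zero]

/-- The function equal to the probability to step down to `0`. -/
noncomputable def exitProb (s : ℝ) : ℕ → ℝ := Pi.single 1 (1 - upProb s 1)

theorem exitProb_nonneg {s : ℝ} (hs : -1 < s) : 0 ≤ exitProb s := by
  refine Pi.single_nonneg.2 ?_
  linarith [(upProb_mem hs 1).2]

theorem besselOp_single_zero (s : ℝ) {r : ℕ} (hr : r ≠ 0) :
    besselOp s (Pi.single 0 1) r = exitProb s r := by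
  rw [besselOp, exitProb]
  by_cases h1 : r = 1
  · simp [h1]
  · rw [Pi.single_eq_of_ne h1, Pi.single_eq_of_ne (by omega), Pi.single_eq_of_ne (by omega)]
    simp

theorem killedExp_exitProb (s : ℝ) (n : ℕ) :
    killedExp s n (exitProb s) = (1 - upProb s 1) * killedExp s n (Pi.single 1 1) := by
  have : exitProb s = (1 - upProb s 1) • (Pi.single 1 1 : ℕ → ℝ) := by
    ext x
    by_cases h : x = 1
    · simp [exitProb, h]
    · simp [exitProb, h]
  rw [this, map_smul, smul_eq_mul]

theorem killedExp_exitProb_odd (s : ℝ) (j : ℕ) : killedExp s (2 * j + 1) (exitProb s) = 0 := by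
  refine killedExp_single_of_odd s _ _ fun x hx => ?_
  rw [exitProb, Pi.single_eq_of_ne]
  omega

end ReturnSeries

/-! ### The walk on the diamond graph -/

section Diamond

/-- The averaging operator of the simple random walk on `ℤ`. -/
noncomputable def simpleOp (f : ℤ → ℝ) (i : ℤ) : ℝ := 1 / 2 * f (i + 1) + (1 - 1 / 2) * f (i - 1)

theorem simpleOp_nonneg {f : ℤ → ℝ} (hf : ∀ i, 0 ≤ f i) (i : ℤ) : 0 ≤ simpleOp f i := by
  have h1 := hf (i + 1)
  have h2 := hf (i - 1)
  unfold simpleOp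
  linarith

theorem lintegral_diamondKernel {s : ℝ} (hs : -1 < s) {F : ℤ × ℕ → ℝ} (hF : 0 ≤ F) (z : ℤ × ℕ) :
    ∫⁻ w, ENNReal.ofReal (F w) ∂diamondKernel s hs z =
      ENNReal.ofReal (simpleOp (fun i => besselOp s (fun r => F (i, r)) z.2) z.1) := by
  change ∫⁻ w, ENNReal.ofReal (F w) ∂((simpleStep z.1).prod (besselStep s hs z.2)) = _
  rw [lintegral_prod _ (measurable_of_countable _).aemeasurable]
  simp only [fun i => lintegral_besselStep_ofReal hs z.2 (φ := fun r => F (i, r)) fun r => hF (i, r)]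
  have h1 : ∀ i, 0 ≤ besselOp s (fun r => F (i, r)) z.2 := fun i =>
    besselOp_nonneg hs (fun r => hF (i, r)) _
  rw [simpleStep, lintegral_bernoulliMeasure, ofReal_convexComb half.2 (h1 _) (h1 _)]
  rfl

theorem simpleOp_mul_const (f : ℤ → ℝ) (c : ℝ) (i : ℤ) :
    simpleOp (fun i => f i * c) i = simpleOp f i * c := by
  unfold simpleOp; ring

theorem besselOp_const_mul (s : ℝ) (φ : ℕ → ℝ) (c : ℝ) (r : ℕ) :
    besselOp s (fun r => c * φ r) r = c * besselOp s φ r := by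
  unfold besselOp; ring

theorem simpleOp_simpleOp (f : ℤ → ℝ) (i : ℤ) :
    simpleOp (simpleOp f) i = 1 / 4 * f (i + 2) + 1 / 2 * f i + 1 / 4 * f (i - 2) := by
  unfold simpleOp
  rw [show i + 1 + 1 = i + 2 by ring, show i + 1 - 1 = i by ring, show i - 1 + 1 = i by ring,
    show i - 1 - 1 = i - 2 by ring]
  ring

/-- Two simple steps move by `2`, `0` or `-2` with weights `1 / 4`, `1 / 2`, `1 / 4`, which at even
positions is a lazy step in units of `2`. -/
theorem simpleOp_iterate_two_mul (f : ℤ → ℝ) (n : ℕ) :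
    (fun x : Fin 1 → ℤ => simpleOp^[2 * n] f (2 * x 0)) =
      (lazyOp ^ n) fun x : Fin 1 → ℤ => f (2 * x 0) := by
  induction n with
  | zero => rfl
  | succ n ih =>
    rw [pow_succ', Module.End.mul_apply, ← ih]
    ext x
    rw [show 2 * (n + 1) = 2 * n + 1 + 1 by ring, Function.iterate_succ_apply',
      Function.iterate_succ_apply', simpleOp_simpleOp, lazyOp_apply]
    simp [mul_add, mul_sub]

theorem lazyOp_pow_single_eq_sub (b a : Fin 1 → ℤ) (n : ℕ) :
    (lazyOp ^ n) (Pi.single b 1) a = (lazyOp ^ n) (Pi.single 0 1) (a - b) := by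
  apply Complex.ofReal_injective
  rw [lazyOp, stepOp_pow_single _ _ 0 b n a, stepOp_pow_single _ _ 0 0 n (a - b), sub_zero]

/-- Independence of the two moves makes the killed iterates of a product function products. A return
at time `2 * j + 2` consists of a forced step up, `2 * j` killed steps from `1` back to `1` and a
step down, while the horizontal walk makes `2 * j + 2` simple steps, that is `j + 1` lazy ones. -/
theorem returnProb_diamondKernel {s : ℝ} (hs : -1 < s) (k : ℕ) :
    returnProb (diamondKernel s hs) (0, 0)
      {z | (planePoint z).im = 0} {z | planePoint z = (k : ℂ)} =
      ∑' j, ((1 - upProb s 1) * killedExp s (2 * j) (Pi.single 1 1)) *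
        (lazyOp ^ (1 * j + 1)) (Pi.single 0 1) (fun _ => -(k : ℤ)) := by
  set A : Set (ℤ × ℕ) := {z | (planePoint z).im = 0} with hAdef
  set B : Set (ℤ × ℕ) := {z | planePoint z = (k : ℂ)} with hBdef
  have hA : ∀ z : ℤ × ℕ, z ∈ A ↔ z.2 = 0 := by
    intro z
    simp [hAdef, planePoint]
  -- States count half units, so the point `k` is the state `2 * k`.
  have hAB : A ∩ B = {((2 * k : ℤ), 0)} := by
    ext ⟨i, r⟩
    simp only [Set.mem_inter_iff, hA, hBdef, Set.mem_ofPred_eq, Set.mem_singleton_iff,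
      Prod.mk.injEq, planePoint, Complex.ext_iff, Complex.natCast_re, Complex.natCast_im]
    constructor
    · rintro ⟨rfl, h, -⟩
      refine ⟨?_, rfl⟩
      rw [div_eq_iff two_ne_zero] at h
      have h2 : (i : ℝ) = ((2 * k : ℤ) : ℝ) := by push_cast; linarith
      exact_mod_cast h2
    · rintro ⟨rfl, rfl⟩
      simp
  set f : ℕ → ℤ → ℝ := fun n => simpleOp^[n] (Pi.single (2 * k : ℤ) 1) with hf
  have hf0 : ∀ n i, 0 ≤ f n i := by
    intro n
    induction n with
    | zero => exact fun i => (Pi.single_nonneg.2 zero_le_one : (0 : ℤ → ℝ) ≤ Pi.single (2 * k : ℤ) 1) i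
    | succ n ih =>
      intro i
      simp only [hf, Function.iterate_succ_apply']
      exact simpleOp_nonneg ih i
  have hfs : ∀ n i, simpleOp (f n) i = f (n + 1) i := fun n i => by
    simp only [hf, Function.iterate_succ_apply']
  have hind : ∀ i r, (A ∩ B).indicator (1 : ℤ × ℕ → ℝ) (i, r) =
      f 0 i * (Pi.single 0 1 : ℕ → ℝ) r := by
    intro i r
    rw [hAB]
    simp only [hf, Function.iterate_zero, id]
    by_cases hi : i = 2 * k <;> by_cases hr : r = 0 <;> simp [hi, hr]
  have hE : ∀ (g : ℤ → ℝ) (φ : ℕ → ℝ) (z : ℤ × ℕ),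
      simpleOp (fun i => besselOp s (fun r => g i * φ r) z.2) z.1 =
        simpleOp g z.1 * besselOp s φ z.2 := by
    intro g φ z
    simp only [besselOp_const_mul, simpleOp_mul_const]
  set ψ : ℕ → ℕ → ℝ := fun n => (killedStep s ^ n) (exitProb s) with hψ
  -- The horizontal index `n + 1` is one ahead of the vertical one because the final step down is
  -- already contained in `exitProb`.
  have key := returnProb_eq_of_real (diamondKernel s hs) (A := A) (B := B)
    (MeasurableSet.of_discrete) (MeasurableSet.of_discrete)
    (fun F hF z => lintegral_diamondKernel hs hF z)
    (F := fun n z => f (n + 1) z.1 * ψ n z.2)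
    (fun n z => mul_nonneg (hf0 _ _) (killedStep_pow_nonneg hs n (exitProb_nonneg hs) z.2))
    (fun n z hz => by
      simp only [hψ]
      rw [(hA z).1 hz, killedStep_pow_apply_zero s n (by simp [exitProb]), mul_zero])
    (fun z hz => by
      simp only [hind, hE]
      rw [besselOp_single_zero s (fun h => hz ((hA z).2 h)), hfs]
      rfl)
    (fun n z hz => by
      simp only [hE]
      rw [besselOp_of_ne_zero s _ (fun h => hz ((hA z).2 h)), hfs]
      simp only [hψ, pow_succ', Module.End.mul_apply])
    (0, 0)
  rw [key]
  simp only [hind, besselOp_zero, simpleOp_mul_const, hfs]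
  have h01 : (Pi.single 0 1 : ℕ → ℝ) 1 = 0 := Pi.single_eq_of_ne one_ne_zero _
  rw [h01, mul_zero, ENNReal.ofReal_zero, zero_add, toReal_tsum_ofReal_two_mul]
  · refine tsum_congr fun j => ?_
    have h1 : f (2 * j + 1 + 1) 0 = (lazyOp ^ (1 * j + 1)) (Pi.single 0 1) (fun _ => -(k : ℤ)) := by
      have h2 := congrFun (simpleOp_iterate_two_mul (Pi.single (2 * k : ℤ) 1) (j + 1)) 0
      have h3 : (fun x : Fin 1 → ℤ => (Pi.single (2 * k : ℤ) 1 : ℤ → ℝ) (2 * x 0)) =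
          Pi.single (fun _ => (k : ℤ)) 1 := by
        ext x
        have h4 : x = (fun _ => (k : ℤ)) ↔ 2 * x 0 = 2 * k := by
          rw [funext_iff, Fin.forall_fin_one]; omega
        simp only [Pi.single_apply, h4]
      rw [h3, lazyOp_pow_single_eq_sub] at h2
      rw [one_mul]
      have h5 : (0 : Fin 1 → ℤ) - (fun _ => (k : ℤ)) = fun _ => -(k : ℤ) := by
        ext; simp
      rw [h5] at h2
      rw [← h2]
      simp only [hf, Pi.zero_apply, mul_zero]
      rfl
    rw [h1, mul_comm, ← killedExp_exitProb]
    rfl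
  · exact fun n => mul_nonneg (hf0 _ _) (killedStep_pow_nonneg hs n (exitProb_nonneg hs) 1)
  · intro j
    have := killedExp_exitProb_odd s j
    rw [killedExp_apply] at this
    simp only [hψ, this, mul_zero]

end Diamond

/-! ### The walk on `ℤ^d × ℕ` -/

section Grid

variable {d : ℕ} {v s : ℝ}

/-- The operator of the Bessel walk on `ℤ^d × ℕ`, acting on functions. -/
noncomputable def gridOp (d : ℕ) (v s : ℝ) :
    Module.End ℝ ((Fin d → ℤ) × ℕ → ℝ) where
  toFun F z := v * besselOp s (fun r => F (z.1, r)) z.2 +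
    (1 - v) * nnOp d (fun y => F (y, z.2)) z.1
  map_add' F G := by
    ext z
    simp only [besselOp, nnOp, stepOp_apply, Pi.add_apply, mul_add, Finset.sum_add_distrib]
    ring
  map_smul' c F := by
    ext z
    simp only [besselOp, nnOp, stepOp_apply, Pi.smul_apply, smul_eq_mul, RingHom.id_apply,
      mul_left_comm _ c, ← Finset.mul_sum]
    ring

theorem gridOp_apply (F : (Fin d → ℤ) × ℕ → ℝ) (z : (Fin d → ℤ) × ℕ) :
    gridOp d v s F z = v * besselOp s (fun r => F (z.1, r)) z.2 +
      (1 - v) * nnOp d (fun y => F (y, z.2)) z.1 := rfl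

theorem nnOp_nonneg {h : (Fin d → ℤ) → ℝ} (hh : ∀ y, 0 ≤ h y) (x : Fin d → ℤ) :
    0 ≤ nnOp d h x := by
  rw [nnOp, stepOp_apply]
  exact Finset.sum_nonneg fun i _ => mul_nonneg (by positivity) (hh _)

theorem nnOp_pow_nonneg {h : (Fin d → ℤ) → ℝ} (hh : ∀ y, 0 ≤ h y) (j : ℕ) (x : Fin d → ℤ) :
    0 ≤ (nnOp d ^ j) h x := by
  induction j generalizing x with
  | zero => exact hh x
  | succ j ih =>
    rw [pow_succ', Module.End.mul_apply]
    exact nnOp_nonneg ih x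

theorem lintegral_simpleStepDim {d : ℕ} [NeZero d] {h : (Fin d → ℤ) → ℝ} (hh : ∀ y, 0 ≤ h y)
    (x : Fin d → ℤ) :
    ∫⁻ y, ENNReal.ofReal (h y) ∂simpleStepDim d x = ENNReal.ofReal (nnOp d h x) := by
  have hd : (0 : ℝ) < 2 * d := by
    have : (0 : ℝ) < d := by exact_mod_cast NeZero.pos d
    linarith
  rw [simpleStepDim, lintegral_smul_measure, lintegral_finsetSum_measure]
  simp only [lintegral_add_measure, lintegral_dirac, smul_eq_mul]
  rw [nnOp, stepOp_apply, ← Finset.mul_sum, ENNReal.ofReal_mul (by positivity),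
    ENNReal.ofReal_inv_of_pos hd, ENNReal.ofReal_sum_of_nonneg fun _ _ => hh _,
    Fintype.sum_sum_type, ← Finset.sum_add_distrib]
  have e : ((2 * d : ℕ) : ℝ≥0∞) = ENNReal.ofReal (2 * d) := by
    rw [← ENNReal.ofReal_natCast]
    push_cast
    rfl
  rw [e]
  simp [nnStep, sub_eq_add_neg]

theorem lintegral_gridKernel {d : ℕ} [NeZero d] (v : unitInterval) (hs : -1 < s)
    {F : (Fin d → ℤ) × ℕ → ℝ} (hF : 0 ≤ F) (z : (Fin d → ℤ) × ℕ) :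
    ∫⁻ w, ENNReal.ofReal (F w) ∂gridKernel d v s hs z = ENNReal.ofReal (gridOp d v s F z) := by
  change ∫⁻ w, ENNReal.ofReal (F w) ∂(ENNReal.ofReal v •
    (Measure.dirac z.1).prod (besselStep s hs z.2) +
      ENNReal.ofReal (1 - v) • (simpleStepDim d z.1).prod (Measure.dirac z.2)) = _
  rw [lintegral_add_measure, lintegral_smul_measure, lintegral_smul_measure,
    lintegral_prod _ (measurable_of_countable _).aemeasurable,
    lintegral_prod _ (measurable_of_countable _).aemeasurable, lintegral_dirac,
    lintegral_besselStep_ofReal hs z.2 (φ := fun r => F (z.1, r)) fun r => hF (z.1, r)]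
  simp only [lintegral_dirac]
  rw [lintegral_simpleStepDim (h := fun y => F (y, z.2)) fun y => hF (y, z.2), smul_eq_mul,
    smul_eq_mul, ofReal_convexComb v.2 (besselOp_nonneg hs (fun r => hF (z.1, r)) _)
      (nnOp_nonneg (fun y => hF (y, z.2)) _), gridOp_apply]

theorem gridOp_mul (f : (Fin d → ℤ) → ℝ) (φ : ℕ → ℝ) (z : (Fin d → ℤ) × ℕ) :
    gridOp d v s (fun z => f z.1 * φ z.2) z =
      v * (f z.1 * besselOp s φ z.2) + (1 - v) * (nnOp d f z.1 * φ z.2) := by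
  rw [gridOp_apply]
  simp only [besselOp_const_mul]
  congr 2
  rw [nnOp, stepOp_apply, stepOp_apply, Finset.sum_mul]
  exact Finset.sum_congr rfl fun i _ => by ring

/-- The contribution to the killed walk of the paths with `m` vertical and `j` horizontal moves. -/
noncomputable def gridTerm (v s : ℝ) (f : (Fin d → ℤ) → ℝ) (φ : ℕ → ℝ) (m j : ℕ)
    (z : (Fin d → ℤ) × ℕ) : ℝ :=
  v ^ m * (1 - v) ^ j * ((nnOp d ^ j) f z.1 * (killedStep s ^ m) φ z.2)

theorem gridOp_gridTerm (f : (Fin d → ℤ) → ℝ) (φ : ℕ → ℝ) (m j : ℕ) {z : (Fin d → ℤ) × ℕ}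
    (hz : z.2 ≠ 0) : gridOp d v s (gridTerm v s f φ m j) z =
      gridTerm v s f φ (m + 1) j z + gridTerm v s f φ m (j + 1) z := by
  have e : gridTerm v s f φ m j = (v ^ m * (1 - v) ^ j) •
      fun z => (nnOp d ^ j) f z.1 * (killedStep s ^ m) φ z.2 := rfl
  rw [e, map_smul, Pi.smul_apply, gridOp_mul, besselOp_of_ne_zero s _ hz]
  simp only [gridTerm, pow_succ' (nnOp d), pow_succ' (killedStep s), Module.End.mul_apply,
    smul_eq_mul]
  ring

/-- The killed walk on `ℤ^d × ℕ` applied to a product function. -/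
noncomputable def gridSum (v s : ℝ) (f : (Fin d → ℤ) → ℝ) (φ : ℕ → ℝ) (n : ℕ) :
    (Fin d → ℤ) × ℕ → ℝ :=
  ∑ p ∈ Finset.HasAntidiagonal.antidiagonal n, (n.choose p.1 : ℝ) • gridTerm v s f φ p.1 p.2

theorem gridSum_apply (f : (Fin d → ℤ) → ℝ) (φ : ℕ → ℝ) (n : ℕ) (z : (Fin d → ℤ) × ℕ) :
    gridSum v s f φ n z =
      ∑ p ∈ Finset.HasAntidiagonal.antidiagonal n, (n.choose p.1 : ℝ) * gridTerm v s f φ p.1 p.2 z := by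
  rw [gridSum, Finset.sum_apply]
  rfl

/-- Vertical and horizontal moves commute away from the line, so `n` moves expand binomially; the
step is Pascal's rule on the antidiagonal. -/
theorem gridSum_succ (f : (Fin d → ℤ) → ℝ) (φ : ℕ → ℝ) (n : ℕ) {z : (Fin d → ℤ) × ℕ}
    (hz : z.2 ≠ 0) : gridSum v s f φ (n + 1) z = gridOp d v s (gridSum v s f φ n) z := by
  rw [gridSum_apply, Finset.sum_antidiagonal_choose_succ_mul fun m j => gridTerm v s f φ m j z,
    gridSum, map_sum, Finset.sum_apply, ← Finset.sum_add_distrib]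
  refine Finset.sum_congr rfl fun p hp => ?_
  rw [map_smul, Pi.smul_apply, gridOp_gridTerm f φ _ _ hz, smul_eq_mul,
    Nat.choose_symm_of_eq_add (Finset.HasAntidiagonal.mem_antidiagonal.1 hp).symm]
  ring

theorem gridTerm_nonneg (hs : -1 < s) (hv0 : 0 ≤ v) (hv1 : v ≤ 1) {f : (Fin d → ℤ) → ℝ}
    {φ : ℕ → ℝ} (hf : ∀ y, 0 ≤ f y) (hφ : 0 ≤ φ) (m j : ℕ) (z : (Fin d → ℤ) × ℕ) :
    0 ≤ gridTerm v s f φ m j z :=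
  mul_nonneg (mul_nonneg (pow_nonneg hv0 _) (pow_nonneg (by linarith) _))
    (mul_nonneg (nnOp_pow_nonneg hf j _) (killedStep_pow_nonneg hs m hφ _))

theorem gridTerm_height_zero (f : (Fin d → ℤ) → ℝ) {φ : ℕ → ℝ} (hφ : φ 0 = 0) (m j : ℕ)
    (y : Fin d → ℤ) : gridTerm v s f φ m j (y, 0) = 0 := by
  rw [gridTerm, killedStep_pow_apply_zero s m hφ, mul_zero, mul_zero]

theorem gridOp_gridTerm_zero (f : (Fin d → ℤ) → ℝ) {φ : ℕ → ℝ} (hφ : φ 0 = 0) (m j : ℕ)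
    (a : Fin d → ℤ) : gridOp d v s (gridTerm v s f φ m j) (a, 0) =
      v ^ (m + 1) * (1 - v) ^ j * (nnOp d ^ j) f a * killedExp s m φ := by
  have e : gridTerm v s f φ m j = (v ^ m * (1 - v) ^ j) •
      fun z => (nnOp d ^ j) f z.1 * (killedStep s ^ m) φ z.2 := rfl
  rw [e, map_smul, Pi.smul_apply, gridOp_mul, besselOp_zero, killedStep_pow_apply_zero s m hφ,
    killedExp_apply, smul_eq_mul]
  ring

theorem tsum_antidiagonal (f : ℕ → ℕ → ℝ≥0∞) :
    ∑' n, ∑ p ∈ Finset.HasAntidiagonal.antidiagonal n, f p.1 p.2 = ∑' m, ∑' j, f m j := by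
  rw [← ENNReal.tsum_prod,
    ← Finset.HasAntidiagonal.sigmaAntidiagonalEquivProd.tsum_eq (fun p : ℕ × ℕ => f p.1 p.2),
    ENNReal.tsum_sigma']
  refine tsum_congr fun n => ?_
  rw [tsum_fintype, ← Finset.sum_coe_sort]
  rfl

/-- A horizontal first move is itself a return, to a neighbour of `a`, which `hab` excludes. So the
first move is vertical, and so is the last. With `m` vertical moves in between, the horizontal moves
fill `m + 1` gaps between vertical moves, hence `geomWalk` at index `m + 1`; by parity only even `m`
contribute. -/
theorem returnProb_gridKernel {d : ℕ} [NeZero d] (v : unitInterval) (hv0 : 0 < v) (hv1 : v < 1)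
    (hs : -1 < s) {a b : Fin d → ℤ} (hab : ∀ i, a + nnStep d i ≠ b) :
    returnProb (gridKernel d v s hs) (a, 0) {z | z.2 = 0} {(b, 0)} =
      ∑' j, (v * ((1 - upProb s 1) * killedExp s (2 * j) (Pi.single 1 1))) *
        geomWalk d v (2 * j + 1) (a - b) := by
  have hv0' : 0 < (v : ℝ) := hv0
  have hv1' : (v : ℝ) < 1 := hv1
  set A : Set ((Fin d → ℤ) × ℕ) := {z | z.2 = 0} with hA
  set f : (Fin d → ℤ) → ℝ := Pi.single b 1 with hf
  have hf0 : ∀ y, 0 ≤ f y := (Pi.single_nonneg.2 zero_le_one : (0 : (Fin d → ℤ) → ℝ) ≤ _)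
  -- The factor `v` pays for the last vertical move; the first one is counted in the power `v ^ (m +
  -- 1)` of `c`.
  set φ : ℕ → ℝ := (v : ℝ) • exitProb s with hφ
  have hφ0 : 0 ≤ φ := smul_nonneg hv0'.le (exitProb_nonneg hs)
  have hφz : φ 0 = 0 := by simp [hφ, exitProb]
  have hind : (A ∩ {(b, 0)}).indicator (1 : (Fin d → ℤ) × ℕ → ℝ) =
      fun z => f z.1 * (Pi.single 0 1 : ℕ → ℝ) z.2 := by
    have : A ∩ {(b, 0)} = {(b, 0)} := by
      exact Set.inter_eq_right.2 fun z hz => by rw [hz]; rfl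
    rw [this]
    ext ⟨y, r⟩
    by_cases hy : y = b <;> by_cases hr : r = 0 <;> simp [hf, hy, hr]
  have key := returnProb_eq_of_real (gridKernel d v s hs) (A := A) (B := {(b, 0)})
    (MeasurableSet.of_discrete) (MeasurableSet.of_discrete)
    (fun F hF z => lintegral_gridKernel v hs hF z) (F := gridSum v s f φ)
    (fun n z => by
      rw [gridSum_apply]
      exact Finset.sum_nonneg fun p _ => mul_nonneg (Nat.cast_nonneg _)
        (gridTerm_nonneg hs hv0'.le hv1'.le hf0 hφ0 _ _ _))
    (fun n z hz => by
      obtain ⟨y, r⟩ := z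
      obtain rfl : r = 0 := hz
      rw [gridSum_apply]
      exact Finset.sum_eq_zero fun p _ => by rw [gridTerm_height_zero f hφz, mul_zero])
    (fun z hz => by
      have hz' : z.2 ≠ 0 := hz
      rw [hind, gridOp_mul, besselOp_single_zero s hz', Pi.single_eq_of_ne hz', gridSum_apply]
      simp [gridTerm, hφ]
      ring)
    (fun n z hz => gridSum_succ f φ n hz) (a, 0)
  have hfirst : gridOp d v s ((A ∩ {(b, 0)}).indicator 1) (a, 0) = 0 := by
    rw [hind, gridOp_mul, besselOp_zero, Pi.single_eq_of_ne one_ne_zero, Pi.single_eq_same,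
      nnOp, stepOp_apply, Finset.sum_eq_zero fun i _ => by
        rw [hf, Pi.single_eq_of_ne (hab i), mul_zero]]
    simp
  rw [key, hfirst, ENNReal.ofReal_zero, zero_add]
  set c : ℕ → ℕ → ℝ := fun m j => ((j + m).choose m : ℝ) * (v : ℝ) ^ (m + 1) * (1 - v : ℝ) ^ j *
    (nnOp d ^ j) (Pi.single 0 1) (a - b) with hc
  have hc0 : ∀ m j, 0 ≤ c m j := fun m j =>
    mul_nonneg (mul_nonneg (mul_nonneg (Nat.cast_nonneg _) (pow_nonneg hv0'.le _))
      (pow_nonneg (by linarith) _)) (nnOp_pow_nonneg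
        (Pi.single_nonneg.2 zero_le_one : (0 : (Fin d → ℤ) → ℝ) ≤ _) j _)
  have hφe : ∀ m, 0 ≤ killedExp s m φ := fun m => killedExp_nonneg hs m hφ0
  have h1 : ∀ n, ENNReal.ofReal (gridOp d v s (gridSum v s f φ n) (a, 0)) =
      ∑ p ∈ Finset.HasAntidiagonal.antidiagonal n, ENNReal.ofReal (c p.1 p.2 * killedExp s p.1 φ) := by
    intro n
    rw [gridSum, map_sum, Finset.sum_apply, ENNReal.ofReal_sum_of_nonneg]
    · refine Finset.sum_congr rfl fun p hp => ?_
      rw [map_smul, Pi.smul_apply, gridOp_gridTerm_zero f hφz, hf, nnOp_pow_single_eq_sub,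
        smul_eq_mul]
      simp only [hc]
      rw [add_comm p.2, Finset.HasAntidiagonal.mem_antidiagonal.1 hp]
      congr 1
      ring
    · intro p _
      rw [map_smul, Pi.smul_apply, gridOp_gridTerm_zero f hφz, smul_eq_mul]
      exact mul_nonneg (Nat.cast_nonneg _) (mul_nonneg (mul_nonneg (mul_nonneg
        (pow_nonneg hv0'.le _) (pow_nonneg (by linarith) _)) (nnOp_pow_nonneg hf0 _ _)) (hφe _))
  simp only [h1]
  -- The sum over the total number of moves is regrouped by the number of vertical moves, freely
  -- because the terms are in `ℝ≥0∞`.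
  rw [tsum_antidiagonal fun m j => ENNReal.ofReal (c m j * killedExp s m φ)]
  have h2 : ∀ m, ∑' j, ENNReal.ofReal (c m j * killedExp s m φ) =
      ENNReal.ofReal (killedExp s m φ * geomWalk d v (m + 1) (a - b)) := by
    intro m
    rw [← ENNReal.ofReal_tsum_of_nonneg (fun j => mul_nonneg (hc0 m j) (hφe m))
      ((summable_geomWalk hv0' hv1' m (a - b)).mul_right _), tsum_mul_right, mul_comm]
    rfl
  have h3 : ∀ m, killedExp s m φ = v * killedExp s m (exitProb s) := fun m => by
    rw [hφ, map_smul, smul_eq_mul]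
  simp only [h2]
  rw [toReal_tsum_ofReal_two_mul]
  · refine tsum_congr fun j => ?_
    rw [h3, killedExp_exitProb]
  · exact fun m => mul_nonneg (hφe m) (tsum_nonneg fun j => hc0 m j)
  · intro j
    rw [h3, killedExp_exitProb_odd, mul_zero, zero_mul]

end Grid

/-! ### The asymptotics of the return probabilities -/

section Asymptotic

open Topology

theorem isEquivalent_div_rpow_of_tendsto {X : Type*} {l : Filter X} {R f : X → ℝ} {e C : ℝ}
    (hR : Tendsto R l atTop) (hC : C ≠ 0) (h : Tendsto (fun x => R x ^ e * f x) l (𝓝 C)) :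
    f ~[l] fun x => C / R x ^ e := by
  have h1 := (isEquivalent_const_iff_tendsto hC).2 h
  have h2 := h1.mul (IsEquivalent.refl (u := fun x => (R x ^ e)⁻¹))
  refine (h2.congr_left ?_).congr_right ?_
  · filter_upwards [hR.eventually_gt_atTop 0] with x hx
    have : R x ^ e ≠ 0 := (Real.rpow_pos_of_pos hx e).ne'
    simp only [Pi.mul_apply]
    field_simp
  · exact Eventually.of_forall fun x => by simp [div_eq_mul_inv]

theorem euclDist_eq {d : ℕ} (a b : Fin d → ℤ) :
    euclDist a b = √(∑ i, (((a - b) i : ℤ) : ℝ) ^ 2) := rfl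

theorem euclDist_nnStep {d : ℕ} (a : Fin d → ℤ) (i : Fin d ⊕ Fin d) :
    euclDist a (a + nnStep d i) = 1 := by
  have h : ∑ j, ((a j - (a + nnStep d i) j : ℤ) : ℝ) ^ 2 = 1 := by
    rcases i with i | i <;>
    · rw [Finset.sum_eq_single i]
      · simp [nnStep]
      · intro j _ hj
        simp [nnStep, hj]
      · simp
  rw [euclDist, h, Real.sqrt_one]

theorem exists_isEquivalent_gridKernel {s : ℝ} (hs : -1 < s) (d : ℕ) [NeZero d]
    (v : unitInterval) (hv0 : 0 < v) (hv1 : v < 1) :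
    ∃ C : ℝ, 0 < C ∧
      (fun p : (Fin d → ℤ) × (Fin d → ℤ) => returnProb (gridKernel d v s hs) (p.1, 0)
        {z | z.2 = 0} {(p.2, 0)})
      ~[comap (fun p => euclDist p.1 p.2) atTop]
        fun p => C / euclDist p.1 p.2 ^ ((d : ℝ) + 1 + s) := by
  have hv0' : 0 < (v : ℝ) := hv0
  have hv1' : (v : ℝ) < 1 := hv1
  obtain ⟨L, hL, ht⟩ := exists_tendsto_returnTime hs
  have hR : Tendsto (fun p : (Fin d → ℤ) × (Fin d → ℤ) => euclDist p.1 p.2)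
      (comap (fun p => euclDist p.1 p.2) atTop) atTop := tendsto_comap
  have ht' : Tendsto (fun j : ℕ => (j : ℝ) ^ ((s + 1) / 2 + 1) *
      (v * ((1 - upProb s 1) * killedExp s (2 * j) (Pi.single 1 1)))) atTop (𝓝 (v * L)) := by
    refine (ht.const_mul (v : ℝ)).congr fun j => ?_
    rw [show (s + 3) / 2 = (s + 1) / 2 + 1 by ring]
    ring
  obtain ⟨C, hC, hlim⟩ := exists_tendsto_tsum_geomWalk (d := d) hv0' hv1'
    (by linarith : 0 < (s + 1) / 2) (mul_pos hv0' hL) ht'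
    (l := comap (fun p : (Fin d → ℤ) × (Fin d → ℤ) => euclDist p.1 p.2) atTop)
    (x := fun p => p.1 - p.2) hR
  refine ⟨C, hC, isEquivalent_div_rpow_of_tendsto hR hC.ne' (hlim.congr' ?_)⟩
  -- Distance greater than `1` rules out a return at time `1` by a horizontal move.
  filter_upwards [hR.eventually_gt_atTop 1] with p hp
  rw [returnProb_gridKernel v hv0 hv1 hs, ← euclDist_eq]
  · congr 2
    ring
  · rintro i hi
    rw [← hi, euclDist_nnStep] at hp
    exact lt_irrefl _ hp

theorem exists_isEquivalent_diamondKernel {s : ℝ} (hs : -1 < s) :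
    ∃ b : ℝ, 0 < b ∧
      (fun k : ℕ => returnProb (diamondKernel s hs) (0, 0)
        {z | (planePoint z).im = 0} {z | planePoint z = (k : ℂ)})
      ~[atTop] fun k : ℕ => b / (k : ℝ) ^ (2 + s) := by
  obtain ⟨L, hL, ht⟩ := exists_tendsto_returnTime hs
  rw [show (s + 3) / 2 = (s + 1) / 2 + 1 by ring] at ht
  have hsq : ∀ k : ℕ, √(∑ _i : Fin 1, ((-(k : ℤ) : ℤ) : ℝ) ^ 2) = k := fun k => by
    simp [Real.sqrt_sq]
  have hR : Tendsto (fun k : ℕ => √(∑ _i : Fin 1, ((-(k : ℤ) : ℤ) : ℝ) ^ 2)) atTop atTop := by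
    simp only [hsq]
    exact tendsto_natCast_atTop_atTop
  obtain ⟨C, hC, hlim⟩ := exists_tendsto_tsum_lazyOp (by linarith : 0 < (s + 1) / 2) hL ht
    (x := fun (k : ℕ) (_ : Fin 1) => -(k : ℤ)) hR
  refine ⟨C, hC, isEquivalent_div_rpow_of_tendsto tendsto_natCast_atTop_atTop hC.ne'
    (hlim.congr fun k => ?_)⟩
  rw [returnProb_diamondKernel hs, hsq]
  congr 2
  push_cast
  ring

end Asymptotic

end BesselWalk

theorem proposition4p2 (s : ℝ) (hs : -1 < s) :
    -- the walk on the diamond graph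
    (∃ b : ℝ, 0 < b ∧
      (fun k : ℕ => returnProb (diamondKernel s hs) (0, 0)
        {z | (planePoint z).im = 0} {z | planePoint z = (k : ℂ)})
      ~[atTop] fun k : ℕ => b / (k : ℝ) ^ (2 + s)) ∧
    -- the walk on the grid `ℤ × ℕ`
    (∃ c : ℝ, 0 < c ∧
      (fun k : ℕ => returnProb (gridKernel 1 half s hs) (0, 0)
        {z | z.2 = 0} {(fun _ => (k : ℤ), 0)})
      ~[atTop] fun k : ℕ => c / (k : ℝ) ^ (2 + s)) ∧
    -- the walk on `ℤ^d × ℕ`, for every `d ≥ 1` and every probability `v` of a vertical move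
    (∀ (d : ℕ) [NeZero d] (v : unitInterval), 0 < v → v < 1 →
      ∃ C : ℝ, 0 < C ∧
        (fun p : (Fin d → ℤ) × (Fin d → ℤ) => returnProb (gridKernel d v s hs) (p.1, 0)
          {z | z.2 = 0} {(p.2, 0)})
        ~[comap (fun p => euclDist p.1 p.2) atTop]
          fun p => C / euclDist p.1 p.2 ^ ((d : ℝ) + 1 + s)) := by
  refine ⟨exists_isEquivalent_diamondKernel hs, ?_,
    fun d _ v hv0 hv1 => exists_isEquivalent_gridKernel hs d v hv0 hv1⟩
  have h0 : (0 : unitInterval) < half := by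
    rw [← Subtype.coe_lt_coe]; norm_num [half]
  have h1 : half < (1 : unitInterval) := by
    rw [← Subtype.coe_lt_coe]; norm_num [half]
  -- The second claim is the case `d = 1`, `v = 1 / 2` of the third, pulled back along `k ↦ (0, k)`.
  obtain ⟨c, hc, h⟩ := exists_isEquivalent_gridKernel hs 1 half h0 h1
  have hdist : ∀ k : ℕ, euclDist (0 : Fin 1 → ℤ) (fun _ => (k : ℤ)) = k := fun k => by
    simp [euclDist, Real.sqrt_sq]
  have hk : Tendsto (fun k : ℕ => ((0 : Fin 1 → ℤ), fun _ : Fin 1 => (k : ℤ))) atTop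
      (comap (fun p => euclDist p.1 p.2) atTop) := by
    rw [tendsto_comap_iff]
    exact tendsto_natCast_atTop_atTop.congr fun k => (hdist k).symm
  refine ⟨c, hc, (h.comp_tendsto hk).congr_right (Eventually.of_forall fun k => ?_)⟩
  simp only [Function.comp, hdist]
  congr 2
  push_cast
  ring
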